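/- Let $\mathcal{A}ssoc$ (resp. $\mathcal{A}ssoc_{>0}$) be the non-$\Sigma$ operad with one operation $a_n$ in each arity $n\ge 0$ (resp. $n\ge 1$). Let $\triangle$ be the weak $\mathcal{A}ssoc_{>0}$-bimodule of simplices $\triangle(n)=\{0\le t_1\le\dots\le t_n\le 1\}$, where $a_k\circ_i$ adds $i-1$ coordinates $0$ at the beginning and $k-i$ coordinates $1$ at the end, and $\circ_i a_k$ replaces $t_i$ by $k$ copies of it. Let $\square$ be the $\mathcal{A}ssoc_{>0}$-bimodule of cubes $\square(n)=[0,1]^{n-1}$, $n\ge 1$, $\square(0)=\emptyset$, where $a_k(x_1,\dots,x_k)$ is $x_1,\dots,x_k$ written in a row with a coordinate $1$ inserted between $x_i$ and $x_{i+1}$, and $x(a_{k_1},\dots,a_{k_n})$ inserts $k_i-1$ coordinates $0$ before the $i$-th coordinate of $x$ (at the end for $i=n$). For $n\ge 1$ let $\Xi_n$ be the poset of compositions $T$ of $n$ into positive parts $|b_1|,\dots,|b_k|$ (the *beads* of $T$), with an arrow $\alpha:T\to T'$ when $T$ refines $T'$. Put $\lambda(T)=\square(|b_1|)\times\dots\times\square(|b_k|)$,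 covariant in $T$ as a face of $\square(n)$ (through $a_k$), and $\chi(T)=\{0\le t_1\le\dots\le t_k\le 1\}$, contravariant in $T$ through precomposition with the induced surjection of the sets of beads. Let $\overline{Wb\square}(n)=\lambda\otimes_{\Xi_n}\chi$ be the coend, i.e. the prisms $\lambda(T)\times\chi(T)$ glued together, and let $Wb\square(n)$ be its quotient by the relation that identifies, in each prism, $((x_i),(t_i))$ with $((x'_i),(t'_i))$ whenever, for each $i$, either $(x_i,t_i)=(x'_i,t'_i)$ or $t_i=t'_i\in\{0,1\}$. Let $Wb\square(0)$ be a point. (i) The sequence $Wb\square(n)$, $n\ge 0$, has a structure of a weak bimodule over $\mathcal{A}ssoc_{>0}$, given by grafting: $a_k\circ_i$ adds $i-1$ beads with one leaf and parameter $0$ on the left and $k-i$ beads with one leaf and parameter $1$ on the right, and $\circ_i a_k$ acts by the right action on the factor $\square(|b|)$ of the bead $b$ of the $i$-th leaf. With this structure, let $\mathcal{O}$ be any $\mathcal{A}ssoc_{>0}$-bimodule, $\eta:\mathcal{A}ssoc\to\mathcal{O}$ a map of $\mathcal{A}ssoc_{>0}$-bimodules, and $g$ a loop in the space of $\mathcal{A}ssoc_{>0}$-bimodule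 maps $\square\to\mathcal{O}$ based at $\square\to\mathcal{A}ssoc\xrightarrow{\eta}\mathcal{O}$, i.e. continuous maps $g_n:\square(n)\times[0,1]\to\mathcal{O}(n)$ which are a bimodule map for each fixed $t\in[0,1]$ and satisfy $g_n(x,0)=g_n(x,1)=\eta(a_n)$. Then the evaluation map $\xi^g:Wb\square\to\mathcal{O}$, $$\xi^g\bigl[(x_1,\dots,x_k),(t_1,\dots,t_k)\bigr]=a_k\bigl(g_{|b_1|}(x_1,t_1),\dots,g_{|b_k|}(x_k,t_k)\bigr)\quad(n\ge1),\qquad \xi^g_0=\eta(a_0),$$ is well defined and is a morphism of weak $\mathcal{A}ssoc_{>0}$-bimodules, where $\mathcal{O}$ is a weak bimodule through $a_n\circ_i x=a_n(\eta(a_1),\dots,\eta(a_1),x,\eta(a_1),\dots,\eta(a_1))$ ($x$ at the $i$-th place) and $x\circ_i a_n=x(a_1,\dots,a_1,a_n,a_1,\dots,a_1)$ ($a_n$ at the $i$-th place). (ii) The weak bimodule $Wb\square$ is cofibrant, i.e. it is obtained from the empty weak bimodule by a (possibly transfinite) sequence of free attachments of cells, and every $Wb\square(n)$ is contractible. (iii)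 As a weak bimodule $Wb\square$ is homeomorphic to $\triangle$; in particular every $Wb\square(n)$ is homeomorphic to the closed $n$-disc. Moreover $Wb\square$ is a refinement of $\triangle$: let $\triangle_N\subset\triangle$ consist of the $N$-skeleta of the simplices $\triangle(n)$, $n\ge0$, and for $0\le d\le N$ let $Wb\square_{N,d}$ be the weak sub-bimodule of $Wb\square$ generated by $Wb\square(0),\dots,Wb\square(N-1)$ and the images in $Wb\square(N)$ of the faces of dimension at most $d$ of the prisms. Then $(\triangle_N)_{N\ge 0}$ and $(Wb\square_{N,d})$, with the pairs $(N,d)$ in lexicographic order, are filtrations by successive free attachments of cells, and there are a strictly increasing map $\alpha$ from the index set of the first to that of the second, and a homeomorphism of weak bimodules $\triangle\to Wb\square$, that takes $\triangle_N$ onto $Wb\square_{\alpha(N)}$ for every $N$. -/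

import Mathlib

universe u v

namespace WbSquare

/-! ### Weak bimodules over `Assoc_{>0}`

`Assoc_{>0}` is the non-symmetric operad with one operation `a_n` in each arity `n ≥ 1`, none in
arity `0`, and `a_n ∘_i a_m = a_{n+m-1}`. The target degree of an operation is a free index `r`
with an equation, so that the axioms need no transport. -/

/-- The operations of a weak bimodule over `Assoc_{>0}` on a sequence `X`.
* `left p q : X k → X (p + k + q)` is `x ↦ a_{p+1+q} ∘_{p+1} x`
  (`p` inputs of `a_{p+1+q}` to the left of `x`, and `q` to the right of it).
* `right p m q : X (p + 1 + q) → X (p + (m + 1) + q)` is `x ↦ x ∘_{p+1} a_{m+1}`. -/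
structure WeakOps (X : ℕ → Type u) where
  left : ∀ (p q : ℕ) {k r : ℕ}, p + k + q = r → X k → X r
  right : ∀ (p m q : ℕ) {k r : ℕ}, p + 1 + q = k → p + m + 1 + q = r → X k → X r

/-- A weak bimodule over `Assoc_{>0}`: continuous operations subject to the unit, associativity,
commutativity and compatibility axioms. -/
structure WeakBimodule (X : ℕ → Type u) [∀ n, TopologicalSpace (X n)] extends WeakOps X where
  continuous_left : ∀ (p q : ℕ) {k r : ℕ} (h : p + k + q = r), Continuous (left p q h)
  continuous_right : ∀ (p m q : ℕ) {k r : ℕ} (h : p + 1 + q = k) (h' : p + m + 1 + q = r),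
    Continuous (right p m q h h')
  /-- `a_1 ∘_1 x = x` -/
  left_unit : ∀ {k : ℕ} (h : 0 + k + 0 = k) (x : X k), left 0 0 h x = x
  /-- `x ∘_{p+1} a_1 = x` -/
  right_unit : ∀ (p q : ℕ) {k : ℕ} (h : p + 1 + q = k) (h' : p + 0 + 1 + q = k) (x : X k),
    right p 0 q h h' x = x
  /-- associativity of the left action -/
  left_left : ∀ (p q p' q' : ℕ) {k l r : ℕ} (h : p' + k + q' = l) (h' : p + l + q = r)
    (h'' : (p + p') + k + (q' + q) = r) (x : X k),
    left p q h' (left p' q' h x) = left (p + p') (q' + q) h'' x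
  /-- associativity of the right action -/
  right_right : ∀ (p q s s' m : ℕ) {k l r : ℕ} (h₁ : p + 1 + q = k)
    (h₂ : p + (s + s') + 1 + q = l) (h₃ : (p + s) + 1 + (s' + q) = l)
    (h₄ : (p + s) + m + 1 + (s' + q) = r) (h₅ : p + (s + m + s') + 1 + q = r) (x : X k),
    right (p + s) m (s' + q) h₃ h₄ (right p (s + s') q h₁ h₂ x) = right p (s + m + s') q h₁ h₅ x
  /-- commutativity of the right action on different inputs -/
  right_comm : ∀ (a b c m m' : ℕ) {k l l' r : ℕ} (h₁ : a + 1 + (b + 1 + c) = k)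
    (h₂ : a + m + 1 + (b + 1 + c) = l) (h₃ : (a + m + 1 + b) + 1 + c = l)
    (h₄ : (a + m + 1 + b) + m' + 1 + c = r) (h₅ : (a + 1 + b) + 1 + c = k)
    (h₆ : (a + 1 + b) + m' + 1 + c = l') (h₇ : a + 1 + (b + m' + 1 + c) = l')
    (h₈ : a + m + 1 + (b + m' + 1 + c) = r) (x : X k),
    right (a + m + 1 + b) m' c h₃ h₄ (right a m (b + 1 + c) h₁ h₂ x) =
      right a m (b + m' + 1 + c) h₇ h₈ (right (a + 1 + b) m' c h₅ h₆ x)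
  /-- associativity between the left and the right action -/
  left_right : ∀ (p q s s' m : ℕ) {k l l' r : ℕ} (h₁ : s + 1 + s' = k) (h₂ : p + k + q = l)
    (h₃ : (p + s) + 1 + (s' + q) = l) (h₄ : (p + s) + m + 1 + (s' + q) = r)
    (h₅ : s + m + 1 + s' = l') (h₆ : p + l' + q = r) (x : X k),
    right (p + s) m (s' + q) h₃ h₄ (left p q h₂ x) = left p q h₆ (right s m s' h₁ h₅ x)
  /-- `(a_n ∘_i x) ∘_j a_{m+1} = (a_n ∘_j a_{m+1}) ∘_{i+m} x` for `j < i` -/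
  right_before : ∀ (a b q m : ℕ) {k l r : ℕ} (h₁ : (a + 1 + b) + k + q = l)
    (h₂ : a + 1 + (b + k + q) = l) (h₃ : a + m + 1 + (b + k + q) = r)
    (h₄ : (a + m + 1 + b) + k + q = r) (x : X k),
    right a m (b + k + q) h₂ h₃ (left (a + 1 + b) q h₁ x) = left (a + m + 1 + b) q h₄ x
  /-- `(a_n ∘_i x) ∘_{j+k-1} a_{m+1} = (a_n ∘_j a_{m+1}) ∘_i x` for `i < j`, `x` of degree `k` -/
  right_after : ∀ (p a b m : ℕ) {k l r : ℕ} (h₁ : p + k + (a + 1 + b) = l)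
    (h₂ : (p + k + a) + 1 + b = l) (h₃ : (p + k + a) + m + 1 + b = r)
    (h₄ : p + k + (a + m + 1 + b) = r) (x : X k),
    right (p + k + a) m b h₂ h₃ (left p (a + 1 + b) h₁ x) = left p (a + m + 1 + b) h₄ x

/-- A morphism: continuous in each degree and compatible with all the operations. -/
structure IsWeakHom {X : ℕ → Type u} {Y : ℕ → Type v} [∀ n, TopologicalSpace (X n)]
    [∀ n, TopologicalSpace (Y n)] (A : WeakOps X) (B : WeakOps Y) (f : ∀ n, X n → Y n) : Prop where
  continuous : ∀ n, Continuous (f n)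
  map_left : ∀ (p q : ℕ) {k r : ℕ} (h : p + k + q = r) (x : X k),
    f r (A.left p q h x) = B.left p q h (f k x)
  map_right : ∀ (p m q : ℕ) {k r : ℕ} (h : p + 1 + q = k) (h' : p + m + 1 + q = r) (x : X k),
    f r (A.right p m q h h' x) = B.right p m q h h' (f k x)

/-- A weak sub-bimodule: a sequence of subsets closed under the operations. -/
structure SubWeak {X : ℕ → Type u} (A : WeakOps X) where
  carrier : ∀ n, Set (X n)
  left_mem : ∀ (p q : ℕ) {k r : ℕ} (h : p + k + q = r) (x : X k),
    x ∈ carrier k → A.left p q h x ∈ carrier r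
  right_mem : ∀ (p m q : ℕ) {k r : ℕ} (h : p + 1 + q = k) (h' : p + m + 1 + q = r) (x : X k),
    x ∈ carrier k → A.right p m q h h' x ∈ carrier r

/-- The operations on a weak sub-bimodule, which carries the subspace topology. -/
def SubWeak.ops {X : ℕ → Type u} {A : WeakOps X} (S : SubWeak A) :
    WeakOps (fun n => S.carrier n) where
  left p q _ _ h x := ⟨A.left p q h x.1, S.left_mem p q h x.1 x.2⟩
  right p m q _ _ h h' x := ⟨A.right p m q h h' x.1, S.right_mem p m q h h' x.1 x.2⟩

/-- The weak sub-bimodule generated by a sequence of subsets. -/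
def SubWeak.generate {X : ℕ → Type u} (A : WeakOps X) (G : ∀ n, Set (X n)) : SubWeak A where
  carrier n := {x | ∀ S : SubWeak A, (∀ m, G m ⊆ S.carrier m) → x ∈ S.carrier n}
  left_mem p q _ _ h x hx S hS := S.left_mem p q h x (hx S hS)
  right_mem p m q _ _ h h' x hx S hS := S.right_mem p m q h h' x (hx S hS)

/-! ### Free attachment of cells, cofibrant weak bimodules, refinements -/

/-- The closed `d`-disc. -/
abbrev Disc (d : ℕ) : Type := Metric.closedBall (0 : EuclideanSpace ℝ (Fin d)) 1

/-- Its boundary sphere (empty for `d = 0`). -/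
abbrev BdDisc (d : ℕ) : Type := Metric.sphere (0 : EuclideanSpace ℝ (Fin d)) 1

/-- The inclusion of the boundary sphere into the disc. -/
def bdIncl {d : ℕ} (x : BdDisc d) : Disc d := ⟨x.1, Metric.sphere_subset_closedBall x.2⟩

/-- `B` is obtained from `A` along `ι` by a free attachment of discs `c` of dimension `dim c` in
degree `deg c`: the square of free weak bimodules on the spheres and on the discs, `A` and `B` is
cocartesian. Morphisms out of a free weak bimodule are written as the corresponding families
of continuous maps out of the generators. -/
def AttachesCells {Y X : ℕ → Type} [∀ n, TopologicalSpace (Y n)] [∀ n, TopologicalSpace (X n)]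
    (A : WeakOps Y) (B : WeakOps X) (ι : ∀ n, Y n → X n) : Prop :=
  IsWeakHom A B ι ∧
  ∃ (C : Type) (deg dim : C → ℕ) (f : ∀ c, BdDisc (dim c) → Y (deg c))
    (Φ : ∀ c, Disc (dim c) → X (deg c)),
    (∀ c, Continuous (f c)) ∧ (∀ c, Continuous (Φ c)) ∧
    (∀ c x, Φ c (bdIncl x) = ι (deg c) (f c x)) ∧
    ∀ (Z : ℕ → Type) [∀ n, TopologicalSpace (Z n)] (E : WeakBimodule Z)
      (φ : ∀ n, Y n → Z n) (ψ : ∀ c, Disc (dim c) → Z (deg c)),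
      IsWeakHom A E.toWeakOps φ → (∀ c, Continuous (ψ c)) →
      (∀ c x, ψ c (bdIncl x) = φ (deg c) (f c x)) →
      ∃! θ : ∀ n, X n → Z n, IsWeakHom B E.toWeakOps θ ∧ (∀ n y, θ n (ι n y) = φ n y) ∧
        ∀ c x, θ (deg c) (Φ c x) = ψ c x

section Filtration

variable {X : ℕ → Type} {A : WeakOps X} {J : Type} [LinearOrder J]

/-- The union of the terms of a filtration that precede `j`. -/
def Below (F : J → SubWeak A) (j : J) (n : ℕ) : Type :=
  {x : X n // ∃ i, i < j ∧ x ∈ (F i).carrier n}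

/-- The colimit topology on the union of the preceding terms. -/
instance (F : J → SubWeak A) [∀ n, TopologicalSpace (X n)] (j : J) (n : ℕ) :
    TopologicalSpace (Below F j n) :=
  ⨆ i : {i : J // i < j}, TopologicalSpace.coinduced
    (fun x : (F i.1).carrier n => (⟨x.1, i.1, i.2, x.2⟩ : Below F j n)) inferInstance

/-- The operations on the union of the preceding terms. -/
def belowOps (F : J → SubWeak A) (j : J) : WeakOps (Below F j) where
  left p q _ _ h x := ⟨A.left p q h x.1, by
    obtain ⟨i, hi, hx⟩ := x.2
    exact ⟨i, hi, (F i).left_mem p q h x.1 hx⟩⟩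
  right p m q _ _ h h' x := ⟨A.right p m q h h' x.1, by
    obtain ⟨i, hi, hx⟩ := x.2
    exact ⟨i, hi, (F i).right_mem p m q h h' x.1 hx⟩⟩

/-- A (well-ordered) filtration of a weak bimodule by successive free attachments of cells,
starting from the empty one: every term is obtained from the colimit of the preceding terms
by a free attachment of cells, and the whole weak bimodule is the colimit of all the terms. -/
structure IsCellFiltration [∀ n, TopologicalSpace (X n)] (A : WeakOps X)
    (F : J → SubWeak A) : Prop where
  wellFounded : WellFounded ((· < ·) : J → J → Prop)
  mono : ∀ i j, i ≤ j → ∀ n, (F i).carrier n ⊆ (F j).carrier n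
  attach : ∀ j : J, AttachesCells (belowOps F j) (F j).ops
    (fun n x => ⟨x.1, x.2.elim fun i hi => mono i j hi.1.le n hi.2⟩)
  exhaust : ∀ n (x : X n), ∃ j, x ∈ (F j).carrier n
  isOpen_of : ∀ n (U : Set (X n)),
    (∀ j, IsOpen {x : (F j).carrier n | x.1 ∈ U}) → IsOpen U

end Filtration

/-- Cofibrant weak bimodules: those obtained from the empty one by a possibly transfinite sequence
of free attachments of cells. -/
def IsCofibrant {X : ℕ → Type} [∀ n, TopologicalSpace (X n)] (A : WeakBimodule X) : Prop :=
  ∃ (J : Type) (_ : LinearOrder J) (F : J → SubWeak A.toWeakOps), IsCellFiltration A.toWeakOps F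

/-- `A` with the cell filtration `F` is a refinement of `B` with the cell filtration `G`: the terms
of `G` are identified, compatibly and in increasing order, with some of the terms of `F`, and the
identifications induce a homeomorphism of weak bimodules in the limit. -/
def IsRefinement {X Y : ℕ → Type} [∀ n, TopologicalSpace (X n)] [∀ n, TopologicalSpace (Y n)]
    {A : WeakOps X} {B : WeakOps Y} {J K : Type} [LinearOrder J] [LinearOrder K]
    (F : J → SubWeak A) (G : K → SubWeak B) : Prop :=
  IsCellFiltration A F ∧ IsCellFiltration B G ∧
  ∃ α : K → J, StrictMono α ∧ ∃ f : ∀ n, Y n ≃ₜ X n, IsWeakHom B A (fun n => f n) ∧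
    ∀ k n, f n '' (G k).carrier n = (F (α k)).carrier n

/-! ### The weak bimodule of simplices -/

/-- `(t_1, …, t_k) ↦ (0, …, 0, t_1, …, t_k, 1, …, 1)` with `p` zeros and `q` ones. -/
def pad (p q : ℕ) {k r : ℕ} (_h : p + k + q = r) (t : Fin k → unitInterval) :
    Fin r → unitInterval :=
  fun j => if j.1 < p then 0 else if h' : j.1 - p < k then t ⟨j.1 - p, h'⟩ else 1

/-- `(t_1, …, t_k) ↦ (t_1, …, t_p, t_{p+1}, …, t_{p+1}, t_{p+2}, …, t_k)`, with `m + 1` copies of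
`t_{p+1}`. -/
def dup (p m q : ℕ) {k r : ℕ} (h : p + 1 + q = k) (h' : p + m + 1 + q = r)
    (t : Fin k → unitInterval) : Fin r → unitInterval :=
  fun j => t ⟨if j.1 < p then j.1 else if j.1 ≤ p + m then p else j.1 - m, by
    have := j.2; split_ifs <;> omega⟩

/-- The simplex `0 ≤ t_1 ≤ … ≤ t_n ≤ 1`. -/
abbrev Tri (n : ℕ) : Type := {t : Fin n → unitInterval // Monotone t}

theorem pad_monotone (p q : ℕ) {k r : ℕ} (h : p + k + q = r) {t : Fin k → unitInterval}
    (ht : Monotone t) : Monotone (pad p q h t) := by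
  intro i j hij
  have hij' : i.1 ≤ j.1 := hij
  simp only [pad]
  split_ifs
  all_goals first
    | exact le_rfl
    | exact unitInterval.nonneg _
    | exact unitInterval.le_one _
    | (exfalso; omega)
    | (apply ht; simp only [Fin.mk_le_mk]; omega)

theorem dup_monotone (p m q : ℕ) {k r : ℕ} (h : p + 1 + q = k) (h' : p + m + 1 + q = r)
    {t : Fin k → unitInterval} (ht : Monotone t) : Monotone (dup p m q h h' t) := by
  intro i j hij
  have hij' : i.1 ≤ j.1 := hij
  apply ht
  simp only [Fin.mk_le_mk]
  split_ifs <;> omega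

/-- The weak bimodule `△` of simplices. -/
def tri : WeakBimodule Tri where
  left p q _ _ h t := ⟨pad p q h t.1, pad_monotone p q h t.2⟩
  right p m q _ _ h h' t := ⟨dup p m q h h' t.1, dup_monotone p m q h h' t.2⟩
  continuous_left p q k r h := by
    refine Continuous.subtype_mk (continuous_pi fun j => ?_) _
    simp only [pad]
    split_ifs
    · exact continuous_const
    · exact (continuous_apply _).comp continuous_subtype_val
    · exact continuous_const
  continuous_right p m q k r h h' := by
    refine Continuous.subtype_mk (continuous_pi fun j => ?_) _
    exact (continuous_apply _).comp continuous_subtype_val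
  left_unit h t := by
    apply Subtype.ext; funext j; simp [pad]
  right_unit p q k h h' t := by
    apply Subtype.ext; funext j; simp only [dup]; refine congrArg t.1 (Fin.ext ?_); simp only
    split_ifs <;> omega
  left_left p q p' q' k l r h h' h'' t := by
    apply Subtype.ext; funext j; simp only [pad]
    have := j.2
    repeat' split
    all_goals first
      | rfl
      | (exfalso; omega)
      | (refine congrArg t.1 (Fin.ext ?_); simp only; omega)
  right_right p q s s' m k l r h₁ h₂ h₃ h₄ h₅ t := by
    apply Subtype.ext; funext j; simp only [dup]; refine congrArg t.1 (Fin.ext ?_); simp only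
    split_ifs <;> omega
  right_comm a b c m m' k l l' r h₁ h₂ h₃ h₄ h₅ h₆ h₇ h₈ t := by
    apply Subtype.ext; funext j; simp only [dup]; refine congrArg t.1 (Fin.ext ?_); simp only
    split_ifs <;> omega
  left_right p q s s' m k l l' r h₁ h₂ h₃ h₄ h₅ h₆ t := by
    apply Subtype.ext; funext j; simp only [dup, pad]
    have := j.2
    repeat' split
    all_goals first
      | rfl
      | (exfalso; omega)
      | (refine congrArg t.1 (Fin.ext ?_); simp only; omega)
  right_before a b q m k l r h₁ h₂ h₃ h₄ t := by
    apply Subtype.ext; funext j; simp only [dup, pad]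
    have := j.2
    repeat' split
    all_goals first
      | rfl
      | (exfalso; omega)
      | (refine congrArg t.1 (Fin.ext ?_); simp only; omega)
  right_after p a b m k l r h₁ h₂ h₃ h₄ t := by
    apply Subtype.ext; funext j; simp only [dup, pad]
    have := j.2
    repeat' split
    all_goals first
      | rfl
      | (exfalso; omega)

/-- The values of `t` in the open interval `(0, 1)`. -/
def interiorValues {n : ℕ} (t : Fin n → unitInterval) : Set unitInterval :=
  {s | s ∈ Set.range t ∧ 0 < s ∧ s < 1}

/-- The filtration of `△` by the `k`-skeleta of the simplices: a point of `△(n)` lies in the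
interior of a face whose dimension is the number of different values in `(0, 1)`. -/
def triSkeleton (N : ℕ) : SubWeak tri.toWeakOps where
  carrier n := {t | (interiorValues t.1).ncard ≤ N}
  left_mem p q k r h t ht := by
    refine le_trans (Set.ncard_le_ncard ?_ ((Set.finite_range t.1).subset fun s hs => hs.1)) ht
    rintro s ⟨⟨j, rfl⟩, h0, h1⟩
    refine ⟨?_, h0, h1⟩
    revert h0 h1
    simp only [tri, pad]
    split_ifs
    · intro h0; exact absurd h0 (lt_irrefl _)
    · intro _ _; exact Set.mem_range_self _
    · intro _ h1; exact absurd h1 (lt_irrefl _)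
  right_mem p m q k r h h' t ht := by
    refine le_trans (Set.ncard_le_ncard ?_ ((Set.finite_range t.1).subset fun s hs => hs.1)) ht
    rintro s ⟨⟨j, rfl⟩, h0, h1⟩
    exact ⟨Set.mem_range_self _, h0, h1⟩

/-! ### Bimodules over `Assoc_{>0}` -/

/-- The operations of a bimodule over `Assoc_{>0}` on a sequence `X`.
* `left ns : X (n_1) × … × X (n_k) → X (n_1 + … + n_k)` is `(x_1, …, x_k) ↦ a_k(x_1, …, x_k)`, `k ≥ 1`.
* `right ks : X n → X (k_1 + … + k_n)` is `x ↦ x(a_{k_1}, …, a_{k_n})`, all `k_i ≥ 1`. -/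
structure BimodOps (X : ℕ → Type u) where
  left : ∀ {k r : ℕ} (ns : Fin k → ℕ), 0 < k → ∑ i, ns i = r → (∀ i, X (ns i)) → X r
  right : ∀ {n r : ℕ} (ks : Fin n → ℕ), (∀ i, 0 < ks i) → ∑ i, ks i = r → X n → X r

/-- The block of the position `i` in a row of consecutive blocks of sizes `ns`, with the position
of `i` inside this block. -/
def locate {k r : ℕ} (ns : Fin k → ℕ) (h : ∑ i, ns i = r) (i : Fin r) : Σ b, Fin (ns b) :=
  finSigmaFinEquiv.symm (Fin.cast h.symm i)

/-- A doubly indexed family, written as one row. -/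
def flat {k : ℕ} {ms : Fin k → ℕ} {α : Type u} (ns : ∀ i, Fin (ms i) → α) (s : Fin (∑ i, ms i)) : α :=
  ns (locate ms rfl s).1 (locate ms rfl s).2

/-- A bimodule over `Assoc_{>0}`: the operations satisfy the unit and associativity axioms and are
continuous. Continuity of the left action is the one for the product in compactly generated spaces,
i.e. it is tested on compact Hausdorff spaces; it follows from continuity for the usual product. -/
structure Bimodule (X : ℕ → Type u) [∀ n, TopologicalSpace (X n)] extends BimodOps X where
  continuous_left : ∀ {k r : ℕ} (ns : Fin k → ℕ) (hk : 0 < k) (h : ∑ i, ns i = r)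
    (K : Type) [TopologicalSpace K] [CompactSpace K] [T2Space K] (c : K → ∀ i, X (ns i)),
    Continuous c → Continuous fun z => left ns hk h (c z)
  continuous_right : ∀ {n r : ℕ} (ks : Fin n → ℕ) (hk : ∀ i, 0 < ks i) (h : ∑ i, ks i = r),
    Continuous (right ks hk h)
  left_unit : ∀ {n : ℕ} (h : ∑ _i : Fin 1, n = n) (x : X n),
    left (fun _ : Fin 1 => n) Nat.one_pos h (fun _ => x) = x
  right_unit : ∀ {n : ℕ} (h : ∑ _i : Fin n, 1 = n) (x : X n),
    right (fun _ => 1) (fun _ => Nat.one_pos) h x = x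
  left_left : ∀ {k r : ℕ} (ms : Fin k → ℕ) (ns : ∀ i, Fin (ms i) → ℕ) (hk : 0 < k)
    (hm : ∀ i, 0 < ms i) (h : ∑ i, ∑ j, ns i j = r) (hk' : 0 < ∑ i, ms i)
    (h' : ∑ s, flat ns s = r) (x : ∀ i j, X (ns i j)),
    left (fun i => ∑ j, ns i j) hk h (fun i => left (ns i) (hm i) rfl (x i)) =
      left (flat ns) hk' h' (fun s => x (locate ms rfl s).1 (locate ms rfl s).2)
  right_right : ∀ {n r : ℕ} (ks : Fin n → ℕ) (ls : ∀ i, Fin (ks i) → ℕ) (hk : ∀ i, 0 < ks i)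
    (hl : ∀ s, 0 < flat ls s) (h : ∑ s, flat ls s = r) (hl' : ∀ i, 0 < ∑ j, ls i j)
    (h' : ∑ i, ∑ j, ls i j = r) (x : X n),
    right (flat ls) hl h (right ks hk rfl x) = right (fun i => ∑ j, ls i j) hl' h' x
  left_right : ∀ {k r : ℕ} (ns : Fin k → ℕ) (ls : ∀ i, Fin (ns i) → ℕ) (hk : 0 < k)
    (hl : ∀ s, 0 < flat ls s) (hl' : ∀ i j, 0 < ls i j) (h : ∑ s, flat ls s = r)
    (h' : ∑ i, ∑ j, ls i j = r) (x : ∀ i, X (ns i)),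
    right (flat ls) hl h (left ns hk rfl x) =
      left (fun i => ∑ j, ls i j) hk h' (fun i => right (ls i) (hl' i) rfl (x i))

/-- A morphism of bimodules over `Assoc_{>0}`. -/
structure IsBimodHom {X : ℕ → Type u} {Y : ℕ → Type v} [∀ n, TopologicalSpace (X n)]
    [∀ n, TopologicalSpace (Y n)] (A : BimodOps X) (B : BimodOps Y) (f : ∀ n, X n → Y n) : Prop where
  continuous : ∀ n, Continuous (f n)
  map_left : ∀ {k r : ℕ} (ns : Fin k → ℕ) (hk : 0 < k) (h : ∑ i, ns i = r) (x : ∀ i, X (ns i)),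
    f r (A.left ns hk h x) = B.left ns hk h (fun i => f (ns i) (x i))
  map_right : ∀ {n r : ℕ} (ks : Fin n → ℕ) (hk : ∀ i, 0 < ks i) (h : ∑ i, ks i = r) (x : X n),
    f r (A.right ks hk h x) = B.right ks hk h (f n x)

/-- The operad `Assoc` (a point `a_n` in every arity `n ≥ 0`) as a bimodule over `Assoc_{>0}`. -/
def assoc : Bimodule (fun _ => Unit) where
  left _ _ _ _ := ()
  right _ _ _ _ := ()
  continuous_left _ _ _ _ _ _ _ _ _ := continuous_const
  continuous_right _ _ _ := continuous_const
  left_unit _ _ := rfl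
  right_unit _ _ := rfl
  left_left _ _ _ _ _ _ _ _ := rfl
  right_right _ _ _ _ _ _ _ _ := rfl
  left_right _ _ _ _ _ _ _ _ := rfl

theorem sum_insert (p q k : ℕ) :
    ∑ b : Fin (p + 1 + q), (if b.1 = p then k else 1) = p + k + q := by
  rw [Fin.sum_univ_eq_sum_range (fun b => if b = p then k else 1) (p + 1 + q),
    Finset.sum_range_add, Finset.sum_range_succ]
  have h1 : ∑ x ∈ Finset.range p, (if x = p then k else 1) = p := by
    rw [Finset.sum_congr rfl (g := fun _ => 1)]
    · simp
    · intro x hx; rw [if_neg]; have := Finset.mem_range.1 hx; omega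
  have h2 : ∑ x ∈ Finset.range q, (if p + 1 + x = p then k else 1) = q := by
    rw [Finset.sum_congr rfl (g := fun _ => 1)]
    · simp
    · intro x hx; rw [if_neg]; omega
  simp [h1, h2]

/-- The `b`-th entry of the row `(e, …, e, x, e, …, e)` with `x` at the position `p`. -/
def insertEntry {X : ℕ → Type u} (p : ℕ) {k : ℕ} (e : X 1) (x : X k) (b : ℕ) :
    X (if b = p then k else 1) :=
  if hb : b = p then cast (by rw [if_pos hb]) x else cast (by rw [if_neg hb]) e

/-- The weak bimodule operations on a bimodule `M` with a morphism of bimodules `η : Assoc → M`: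
`a_{p+1+q} ∘_{p+1} x = a_{p+1+q}(η(a_1), …, η(a_1), x, η(a_1), …, η(a_1))` and
`x ∘_{p+1} a_{m+1} = x(a_1, …, a_1, a_{m+1}, a_1, …, a_1)`. -/
def BimodOps.weakOps {X : ℕ → Type u} (M : BimodOps X) (η : ∀ n : ℕ, Unit → X n) : WeakOps X where
  left p q k _ h x := M.left (fun b : Fin (p + 1 + q) => if b.1 = p then k else 1) (by omega)
    ((sum_insert p q k).trans h) (fun b => insertEntry p (η 1 ()) x b.1)
  right p m q k r h h' x := M.right (fun b : Fin k => if b.1 = p then m + 1 else 1)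
    (fun b => by split_ifs <;> omega)
    (by subst h; rw [sum_insert p q (m + 1)]; omega) x

/-! ### The bimodule of cubes -/

/-- `□(n)`: the cube `[0,1]^{n-1}` for `n ≥ 1`, and the empty set for `n = 0`. -/
abbrev Square (n : ℕ) : Type := {_d : Fin (n - 1) → unitInterval // 0 < n}

/-- The family `d_1, …, d_{n-1}` (indexed from `0`), continued by `1`. -/
def gapAt {n : ℕ} (d : Fin (n - 1) → unitInterval) (j : ℕ) : unitInterval :=
  if h : j < n - 1 then d ⟨j, h⟩ else 1

/-- The coordinates of `a_k(x_1, …, x_k)`: the coordinates of `x_1, …, x_k` in this order, with a `1`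
inserted between each `x_i` and `x_{i+1}`. -/
def joinCoord {k r : ℕ} (ns : Fin k → ℕ) (h : ∑ i, ns i = r) (x : ∀ i, Square (ns i)) :
    Fin (r - 1) → unitInterval :=
  fun j => gapAt (x (locate ns h ⟨j.1, by omega⟩).1).1 (locate ns h ⟨j.1, by omega⟩).2.1

/-- The coordinates of `x(a_{k_1}, …, a_{k_n})`: `k_1 - 1` zeros, `d_1`, `k_2 - 1` zeros, `d_2`, …,
`d_{n-1}`, `k_n - 1` zeros. -/
def splitCoord {n r : ℕ} (ks : Fin n → ℕ) (h : ∑ i, ks i = r) (x : Square n) :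
    Fin (r - 1) → unitInterval :=
  fun j => if (locate ks h ⟨j.1, by omega⟩).2.1 + 1 < ks (locate ks h ⟨j.1, by omega⟩).1 then 0
    else gapAt x.1 (locate ks h ⟨j.1, by omega⟩).1.1

/-- The total size of the blocks that precede the block `m`. -/
def sizeBefore {k : ℕ} (ns : Fin k → ℕ) (m : ℕ) : ℕ := ∑ i : Fin k, if i.1 < m then ns i else 0

theorem sizeBefore_succ {k : ℕ} (ns : Fin k → ℕ) (b : Fin k) :
    sizeBefore ns (b.1 + 1) = sizeBefore ns b.1 + ns b := by
  have h : ns b = ∑ i : Fin k, if i = b then ns i else 0 := by simp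
  rw [h, sizeBefore, sizeBefore, ← Finset.sum_add_distrib]
  refine Finset.sum_congr rfl fun i _ => ?_
  simp only [Fin.ext_iff]
  split_ifs <;> omega

theorem sizeBefore_mono {k : ℕ} (ns : Fin k → ℕ) {a b : ℕ} (hab : a ≤ b) :
    sizeBefore ns a ≤ sizeBefore ns b := by
  refine Finset.sum_le_sum fun i _ => ?_
  split_ifs <;> omega

theorem sizeBefore_top {k : ℕ} (ns : Fin k → ℕ) : sizeBefore ns k = ∑ i, ns i :=
  Finset.sum_congr rfl fun i _ => if_pos i.2

theorem sizeBefore_eq {k : ℕ} (ns : Fin k → ℕ) (m : ℕ) (hm : m ≤ k) :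
    ∑ i : Fin m, ns (Fin.castLE hm i) = sizeBefore ns m := by
  induction m with
  | zero => simp [sizeBefore]
  | succ m ih =>
    rw [Fin.sum_univ_castSucc, sizeBefore_succ ns ⟨m, hm⟩, ← ih (by omega)]; rfl

theorem locate_val {k r : ℕ} (ns : Fin k → ℕ) (h : ∑ i, ns i = r) (i : Fin r) :
    i.1 = sizeBefore ns (locate ns h i).1.1 + (locate ns h i).2.1 := by
  rw [← sizeBefore_eq ns _ (locate ns h i).1.2.le, ← finSigmaFinEquiv_apply, locate,
    Equiv.apply_symm_apply]; rfl

theorem locate_surjective {k r : ℕ} (ns : Fin k → ℕ) (h : ∑ i, ns i = r) :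
    Function.Surjective (locate ns h) := by
  subst h
  exact finSigmaFinEquiv.symm.surjective

theorem locate_last {k r : ℕ} (ns : Fin k → ℕ) (h : ∑ i, ns i = r) (i : Fin r) (hi : i.1 + 1 = r) :
    (locate ns h i).2.1 + 1 = ns (locate ns h i).1 := by
  have h1 := locate_val ns h i
  have h2 := sizeBefore_succ ns (locate ns h i).1
  have h3 := sizeBefore_mono ns (Nat.succ_le_of_lt (locate ns h i).1.2)
  have h4 := sizeBefore_top ns
  have h5 := (locate ns h i).2.2
  simp only [Nat.succ_eq_add_one] at h3
  omega

theorem locate_last_iff {k r : ℕ} (ns : Fin k → ℕ) (h : ∑ i, ns i = r) (hn : ∀ i, 0 < ns i)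
    (i : Fin r) : i.1 + 1 = r ↔
      ((locate ns h i).2.1 + 1 = ns (locate ns h i).1 ∧ (locate ns h i).1.1 + 1 = k) := by
  have h1 := locate_val ns h i
  have h2 := sizeBefore_succ ns (locate ns h i).1
  have h4 := sizeBefore_top ns
  constructor
  · intro hi
    refine ⟨locate_last ns h i hi, ?_⟩
    by_contra hb
    have hlt : (locate ns h i).1.1 + 1 < k := by have := (locate ns h i).1.2; omega
    have h3 := sizeBefore_mono ns (Nat.succ_le_of_lt hlt)
    have h5 := sizeBefore_succ ns ⟨(locate ns h i).1.1 + 1, hlt⟩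
    have h6 := hn ⟨(locate ns h i).1.1 + 1, hlt⟩
    have h8 := locate_last ns h i hi
    simp only [Nat.succ_eq_add_one] at h3 h5
    omega
  · rintro ⟨h5, h6⟩
    rw [h6] at h2
    omega

theorem locate_lt {k r : ℕ} (ns : Fin k → ℕ) (h : ∑ i, ns i = r) {i j : Fin r} (hij : i < j) :
    (locate ns h i).1.1 < (locate ns h j).1.1 ∨
      ((locate ns h i).1 = (locate ns h j).1 ∧ (locate ns h i).2.1 < (locate ns h j).2.1) := by
  have hi := locate_val ns h i
  have hj := locate_val ns h j
  have hij' : i.1 < j.1 := hij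
  rcases lt_trichotomy (locate ns h i).1.1 (locate ns h j).1.1 with hlt | heq | hgt
  · exact Or.inl hlt
  · refine Or.inr ⟨Fin.ext heq, ?_⟩
    rw [heq] at hi
    omega
  · exfalso
    have h1 := sizeBefore_mono ns (Nat.succ_le_of_lt hgt)
    have h2 := sizeBefore_succ ns (locate ns h j).1
    have h3 := (locate ns h j).2.2
    simp only [Nat.succ_eq_add_one] at h1
    omega

/-- Locating a position in two steps, or in the row of all the blocks. -/
theorem locate_flat {k r : ℕ} {ms : Fin k → ℕ} (ns : ∀ i, Fin (ms i) → ℕ)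
    (h : ∑ i, ∑ j, ns i j = r) (h' : ∑ s, flat ns s = r) (s : Fin r) :
    (⟨(locate (fun i => ∑ j, ns i j) h s).1,
        locate (ns _) rfl (locate (fun i => ∑ j, ns i j) h s).2⟩ : Σ i, Σ j, Fin (ns i j)) =
      ⟨(locate ms rfl (locate (flat ns) h' s).1).1, (locate ms rfl (locate (flat ns) h' s).1).2,
        (locate (flat ns) h' s).2⟩ := by
  let key : (Σ i, Σ j, Fin (ns i j)) → ℕ ×ₗ (ℕ ×ₗ ℕ) :=
    fun x => toLex (x.1.1, toLex (x.2.1.1, x.2.2.1))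
  have hkey : Function.Injective key := by
    rintro ⟨i, j, l⟩ ⟨i', j', l'⟩ hx
    simp only [key, EmbeddingLike.apply_eq_iff_eq, Prod.mk.injEq] at hx
    obtain ⟨h1, h2, h3⟩ := hx
    obtain rfl := Fin.ext h1
    obtain rfl := Fin.ext h2
    obtain rfl := Fin.ext h3
    rfl
  let f : Fin r → Σ i, Σ j, Fin (ns i j) := fun s =>
    ⟨(locate (fun i => ∑ j, ns i j) h s).1,
        locate (ns _) rfl (locate (fun i => ∑ j, ns i j) h s).2⟩
  let g : Fin r → Σ i, Σ j, Fin (ns i j) := fun s =>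
    ⟨(locate ms rfl (locate (flat ns) h' s).1).1, (locate ms rfl (locate (flat ns) h' s).1).2,
        (locate (flat ns) h' s).2⟩
  have hf : Function.Surjective f := by
    rintro ⟨i, jl⟩
    obtain ⟨u, rfl⟩ := locate_surjective (ns i) rfl jl
    obtain ⟨s, hs⟩ := locate_surjective (fun i => ∑ j, ns i j) h ⟨i, u⟩
    exact ⟨s, by simp only [f]; rw [hs]⟩
  have hg : Function.Surjective g := by
    have : ∀ (t : Σ i, Fin (ms i)) (l : Fin (ns t.1 t.2)), ∃ s, g s = ⟨t.1, t.2, l⟩ := by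
      intro t l
      obtain ⟨v, rfl⟩ := locate_surjective ms rfl t
      obtain ⟨s, hs⟩ := locate_surjective (flat ns) h' ⟨v, l⟩
      exact ⟨s, by simp only [g]; rw [hs]⟩
    rintro ⟨i, j, l⟩
    exact this ⟨i, j⟩ l
  have hfm : StrictMono (key ∘ f) := by
    intro a b hab
    simp only [Function.comp, key, f, Prod.Lex.toLex_lt_toLex]
    rcases locate_lt (fun i => ∑ j, ns i j) h hab with h1 | ⟨h1, h2⟩
    · exact Or.inl h1
    · generalize locate (fun i => ∑ j, ns i j) h a = x at h1 h2 ⊢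
      generalize locate (fun i => ∑ j, ns i j) h b = y at h1 h2 ⊢
      obtain ⟨x1, x2⟩ := x
      obtain ⟨y1, y2⟩ := y
      simp only at h1
      subst h1
      refine Or.inr ⟨rfl, ?_⟩
      rcases locate_lt (ns x1) rfl (show x2 < y2 from h2) with h3 | ⟨h3, h4⟩
      · exact Or.inl h3
      · exact Or.inr ⟨congrArg _ h3, h4⟩
  have hgm : StrictMono (key ∘ g) := by
    intro a b hab
    simp only [Function.comp, key, g, Prod.Lex.toLex_lt_toLex]
    rcases locate_lt (flat ns) h' hab with h1 | ⟨h1, h2⟩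
    · rcases locate_lt ms rfl (show (locate (flat ns) h' a).1 < (locate (flat ns) h' b).1 from h1)
        with h3 | ⟨h3, h4⟩
      · exact Or.inl h3
      · exact Or.inr ⟨congrArg _ h3, Or.inl h4⟩
    · exact Or.inr ⟨congrArg (fun v => (locate ms rfl v).1.1) h1,
        Or.inr ⟨congrArg (fun v => (locate ms rfl v).2.1) h1, h2⟩⟩
  have hfg : key ∘ f = key ∘ g := by
    rw [← StrictMono.range_inj hfm hgm, hf.range_comp, hg.range_comp]
  exact hkey (congrFun hfg s)

theorem gapAt_joinCoord {k r : ℕ} (ns : Fin k → ℕ) (h : ∑ i, ns i = r) (x : ∀ i, Square (ns i))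
    (j : Fin r) :
    gapAt (joinCoord ns h x) j.1 = gapAt (x (locate ns h j).1).1 (locate ns h j).2.1 := by
  by_cases hj : j.1 < r - 1
  · rw [gapAt, dif_pos hj]; rfl
  · rw [gapAt, dif_neg hj, gapAt, dif_neg]
    have := locate_last ns h j (by omega)
    omega

theorem gapAt_splitCoord {n r : ℕ} (ks : Fin n → ℕ) (h : ∑ i, ks i = r) (hk : ∀ i, 0 < ks i)
    (x : Square n) (j : Fin r) :
    gapAt (splitCoord ks h x) j.1 = if (locate ks h j).2.1 + 1 < ks (locate ks h j).1 then 0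
      else gapAt x.1 (locate ks h j).1.1 := by
  by_cases hj : j.1 < r - 1
  · rw [gapAt, dif_pos hj]; rfl
  · have := (locate_last_iff ks h hk j).1 (by omega)
    rw [gapAt, dif_neg hj, if_neg (by omega), gapAt, dif_neg (by omega)]

theorem square_ext {n : ℕ} {x y : Square n} (h : ∀ j : Fin n, j.1 < n - 1 → gapAt x.1 j.1 = gapAt y.1 j.1) :
    x = y := by
  apply Subtype.ext; funext j
  have := h ⟨j.1, by omega⟩ j.2
  simpa [gapAt] using this

theorem sum_pos_of_square {k r : ℕ} {ns : Fin k → ℕ} (hk : 0 < k) (h : ∑ i, ns i = r)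
    (x : ∀ i, Square (ns i)) : 0 < r := by
  have h1 := Finset.single_le_sum (f := ns) (fun _ _ => Nat.zero_le _)
    (Finset.mem_univ (⟨0, hk⟩ : Fin k))
  have h2 := (x ⟨0, hk⟩).2
  omega

theorem sum_pos_of_pos {n r : ℕ} {ks : Fin n → ℕ} (hk : ∀ i, 0 < ks i) (h : ∑ i, ks i = r)
    (hn : 0 < n) : 0 < r := by
  have h1 := Finset.single_le_sum (f := ks) (fun _ _ => Nat.zero_le _)
    (Finset.mem_univ (⟨0, hn⟩ : Fin n))
  have h2 := hk ⟨0, hn⟩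
  omega

theorem continuous_gapAt {n : ℕ} (j : ℕ) : Continuous fun x : Square n => gapAt x.1 j := by
  unfold gapAt
  split_ifs
  · exact (continuous_apply _).comp continuous_subtype_val
  · exact continuous_const

/-- The bimodule `□` of cubes. -/
def square : Bimodule Square where
  left ns hk h x := ⟨joinCoord ns h x, sum_pos_of_square hk h x⟩
  right ks hk h x := ⟨splitCoord ks h x, sum_pos_of_pos hk h x.2⟩
  continuous_left ns hk h K _ _ _ c hc := by
    refine Continuous.subtype_mk (continuous_pi fun j => ?_) _
    exact (continuous_gapAt _).comp ((continuous_apply _).comp hc)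
  continuous_right ks hk h := by
    refine Continuous.subtype_mk (continuous_pi fun j => ?_) _
    simp only [splitCoord]
    split_ifs
    · exact continuous_const
    · exact continuous_gapAt _
  left_unit {n} h x := by
    refine square_ext fun j _ => ?_
    rw [gapAt_joinCoord]
    have h1 := locate_val (fun _ : Fin 1 => n) h j
    have h2 : (locate (fun _ : Fin 1 => n) h j).1.1 = 0 := by omega
    rw [h2] at h1
    have h3 : sizeBefore (fun _ : Fin 1 => n) 0 = 0 := by simp [sizeBefore]
    rw [h3, zero_add] at h1
    rw [← h1]
  right_unit {n} h x := by
    refine square_ext fun j _ => ?_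
    rw [gapAt_splitCoord _ _ (fun _ => Nat.one_pos), if_neg (by omega)]
    have h1 := locate_val (fun _ : Fin n => 1) h j
    have h2 := (locate (fun _ : Fin n => 1) h j).2.2
    have h3 : ∀ m, m ≤ n → sizeBefore (fun _ : Fin n => 1) m = m := by
      intro m hm; rw [← sizeBefore_eq _ _ hm]; simp
    rw [h3 _ (locate (fun _ : Fin n => 1) h j).1.2.le] at h1
    congr 1
    omega
  left_left ms ns hk hm h hk' h' x := by
    refine square_ext fun j _ => ?_
    simp only [gapAt_joinCoord]
    exact (congrArg (fun t : Σ i, Σ j, Fin (ns i j) => gapAt (x t.1 t.2.1).1 t.2.2.1)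
      (locate_flat ns h h' j)).trans
      (gapAt_joinCoord (flat ns) h' (fun s => x (locate ms rfl s).1 (locate ms rfl s).2) j).symm
  right_right {n r} ks ls hk hl h hl' h' x := by
    refine square_ext fun j _ => ?_
    have hl2 : ∀ i j, 0 < ls i j := by
      intro i j
      obtain ⟨v, hv⟩ := locate_surjective ks rfl ⟨i, j⟩
      have := hl v
      rw [flat, hv] at this
      exact this
    rw [gapAt_splitCoord _ _ hl, gapAt_splitCoord _ _ hl', gapAt_splitCoord _ _ hk]
    have h1 := locate_flat ls h' h j
    have h2 := congrArg (fun t : Σ i, Σ j, Fin (ls i j) =>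
      if t.2.2.1 + 1 < ls t.1 t.2.1 then 0 else if t.2.1.1 + 1 < ks t.1 then 0 else
        gapAt x.1 t.1.1) h1
    simp only at h2
    refine Eq.trans ?_ (h2.symm.trans ?_)
    · rfl
    · have h3 := locate_last_iff (ls _) rfl (hl2 _) (locate (fun i => ∑ j, ls i j) h' j).2
      have h4 := (locate (fun i => ∑ j, ls i j) h' j).2.2
      have h5 := (locate (ls _) rfl (locate (fun i => ∑ j, ls i j) h' j).2).2.2
      have h6 := (locate (ls _) rfl (locate (fun i => ∑ j, ls i j) h' j).2).1.2
      split_ifs <;> first | rfl | (exfalso; omega)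
  left_right ns ls hk hl hl' h h' x := by
    refine square_ext fun j _ => ?_
    rw [gapAt_splitCoord _ _ hl, gapAt_joinCoord, gapAt_joinCoord]
    simp only [gapAt_splitCoord _ _ (hl' _)]
    exact (congrArg (fun t : Σ i, Σ j, Fin (ls i j) =>
      if t.2.2.1 + 1 < ls t.1 t.2.1 then 0 else gapAt (x t.1).1 t.2.1.1)
      (locate_flat ls h' h j)).symm

/-! ### The spaces `Wb□(n)`

An object of the category `Ξ_n` is a tree with `n` leaves, beads `b_1, …, b_k` joined to the root
vertex, and `|b_i| ≥ 1` leaves attached to `b_i`; that is, a composition `n = |b_1| + … + |b_k|`.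
There is a (unique) morphism `T → T'` when `T` refines `T'`. -/

/-- The disjoint union over the trees `T` of the prisms `λ(T) × χ(T)`, where
`λ(T) = □(|b_1|) × … × □(|b_k|)` and `χ(T) = {0 ≤ t_1 ≤ … ≤ t_k ≤ 1}`. For `n = 0` this is a
point, since there is only the tree without beads. -/
abbrev Prisms (n : ℕ) : Type :=
  Σ T : Composition n, (∀ b : Fin T.length, Square (T.blocksFun b)) × Tri T.length

/-- The bead of the tree `T` to which the leaf `i` is attached. -/
def bead {n : ℕ} (T : Composition n) (i : Fin n) : Fin T.length :=
  (locate T.blocksFun T.sum_blocksFun i).1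

/-- The image of `(x_1, …, x_k)` under the inclusion of `λ(T)` as a face of `□(n)`. -/
def gaps {n : ℕ} (P : Prisms n) : Fin (n - 1) → unitInterval :=
  joinCoord P.1.blocksFun P.1.sum_blocksFun P.2.1

/-- The parameters `t` of a point of a prism, as a function on the leaves. -/
def times {n : ℕ} (P : Prisms n) : Fin n → unitInterval := fun i => P.2.2.1 (bead P.1 i)

/-- The gluing of the prisms: for a morphism `α : T → T'`, `x ∈ λ(T)` and `s ∈ χ(T')`, the points
`(x, χ(α)(s)) ∈ λ(T) × χ(T)` and `(λ(α)(x), s) ∈ λ(T') × χ(T')` are identified. Here `λ(α)` is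
the inclusion of faces of `□(n)`, and `χ(α)(s) = s ∘ α_*` with `α_*` the induced map of beads. -/
def Glue {n : ℕ} (P Q : Prisms n) : Prop :=
  (∀ i j, bead P.1 i = bead P.1 j → bead Q.1 i = bead Q.1 j) ∧ gaps P = gaps Q ∧
    times P = times Q

/-- The coend of `λ` and `χ` over `Ξ_n`, with the quotient topology. -/
def WbBar (n : ℕ) : Type := Quot (Glue (n := n))

instance instTopologicalSpaceWbBar (n : ℕ) : TopologicalSpace (WbBar n) :=
  instTopologicalSpaceQuot

/-- The collapse: inside each prism, `(x, t)` and `(x', t')` are identified if, for every bead,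
`(x_b, t_b) = (x'_b, t'_b)`, or `t_b = t'_b = ε` with `ε ∈ {0, 1}`. -/
def Collapse {n : ℕ} (u v : WbBar n) : Prop :=
  ∃ (T : Composition n) (x x' : ∀ b : Fin T.length, Square (T.blocksFun b)) (t t' : Tri T.length),
    (∀ b, (x b = x' b ∧ t.1 b = t'.1 b) ∨ (t.1 b = t'.1 b ∧ (t.1 b = 0 ∨ t.1 b = 1))) ∧
      u = Quot.mk _ ⟨T, x, t⟩ ∧ v = Quot.mk _ ⟨T, x', t'⟩

/-- The space `Wb□(n)`, with the quotient topology (a point for `n = 0`). -/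
def Wb (n : ℕ) : Type := Quot (Collapse (n := n))

instance instTopologicalSpaceWb (n : ℕ) : TopologicalSpace (Wb n) := instTopologicalSpaceQuot

/-- The class in `Wb□(n)` of a point of a prism. -/
def Wb.mk {n : ℕ} (P : Prisms n) : Wb n := Quot.mk _ (Quot.mk _ P)

/-- Compatibility of weak bimodule operations on `Wb□` with the grafting of trees.
Grafting the tree `T` into the input `p + 1` of a corolla with `p + 1 + q` inputs turns the other
inputs into new beads with one leaf, which have the parameter `0` on the left of `T`, and `1` on
the right of it. Grafting a corolla with `m + 1` inputs into the leaf `p + 1` of `T` acts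
on the bead of this leaf through the right action on `□`. In coordinates, the former acts as on
`△` on the parameters and inserts distances `1`; the latter acts as on `△` on the parameters and
inserts `m` distances `0` between the copies of the leaf. -/
structure IsGrafting (A : WeakOps Wb) : Prop where
  left_mk : ∀ (p q : ℕ) {k r : ℕ} (h : p + k + q = r) (P : Prisms k) (Q : Prisms r),
    times Q = pad p q h (times P) → (∀ j, j < p → gapAt (gaps Q) j = 1) →
    (∀ j, gapAt (gaps Q) (p + j) = gapAt (gaps P) j) → A.left p q h (Wb.mk P) = Wb.mk Q
  right_mk : ∀ (p m q : ℕ) {k r : ℕ} (h : p + 1 + q = k) (h' : p + m + 1 + q = r)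
    (P : Prisms k) (Q : Prisms r),
    times Q = dup p m q h h' (times P) → (∀ j, j < p → gapAt (gaps Q) j = gapAt (gaps P) j) →
    (∀ j, j < m → gapAt (gaps Q) (p + j) = 0) →
    (∀ j, gapAt (gaps Q) (p + m + j) = gapAt (gaps P) (p + j)) →
    A.right p m q h h' (Wb.mk P) = Wb.mk Q

/-! ### Loops of bimodule maps `□ → O` and their evaluation maps -/

/-- A loop `g : □(n) × [0,1] → O(n)` in the space of morphisms of bimodules `□ → O`, based at the
composition of `□ → Assoc` and `η : Assoc → O`. -/
structure IsBimodLoop {O : ℕ → Type u} [∀ n, TopologicalSpace (O n)] (M : Bimodule O)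
    (η : ∀ n : ℕ, Unit → O n) (g : ∀ n, Square n → unitInterval → O n) : Prop where
  continuous : ∀ n, Continuous fun z : Square n × unitInterval => g n z.1 z.2
  isBimodHom : ∀ t, IsBimodHom square.toBimodOps M.toBimodOps (fun n x => g n x t)
  map_zero : ∀ n x, g n x 0 = η n ()
  map_one : ∀ n x, g n x 1 = η n ()

/-- `ξ : Wb□ → O` is the evaluation map of `g`: for `n ≥ 1` it sends the class of
`((x_1, …, x_k), (t_1, …, t_k))` to `a_k(g(x_1, t_1), …, g(x_k, t_k))`, and for `n = 0` the point of
`Wb□(0)` to `η(a_0)`. -/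
def IsEvaluation {O : ℕ → Type u} [∀ n, TopologicalSpace (O n)] (M : Bimodule O)
    (η : ∀ n : ℕ, Unit → O n) (g : ∀ n, Square n → unitInterval → O n)
    (ξ : ∀ n, Wb n → O n) : Prop :=
  (∀ (n : ℕ) (hn : 0 < n) (P : Prisms n), ξ n (Wb.mk P) =
    M.left P.1.blocksFun (P.1.length_pos_iff.2 hn) P.1.sum_blocksFun
      (fun b => g (P.1.blocksFun b) (P.2.1 b) (P.2.2.1 b))) ∧
  ∀ w, ξ 0 w = η 0 ()

/-! ### The cell filtration of `Wb□` -/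

/-- The dimension of the open face of a prism that contains the given point. -/
noncomputable def faceDim {n : ℕ} (P : Prisms n) : ℕ :=
  Set.ncard {j : Fin (n - 1) | 0 < gaps P j ∧ gaps P j < 1} + (interiorValues (times P)).ncard

/-- The image in `Wb□(n)` of the faces of dimension at most `d` of the prisms. -/
def wbFaces (n d : ℕ) : Set (Wb n) := {w | ∃ P : Prisms n, Wb.mk P = w ∧ faceDim P ≤ d}

/-- The indices `(N, d)` with `d ≤ N`, in lexicographic order. -/
abbrev CellIndex : Type := {p : ℕ ×ₗ ℕ // (ofLex p).2 ≤ (ofLex p).1}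

/-- The filtration of `Wb□` by its cells, in the order of their degrees, and inside each degree in
the order of their dimensions. The term `(N, d)` is generated by all of `Wb□(0), …, Wb□(N - 1)`, and
by the cells of dimension at most `d` of `Wb□(N)`; so the term `(N, N)` is generated by
`Wb□(0), …, Wb□(N)`. -/
def wbFiltration (A : WeakOps Wb) (i : CellIndex) : SubWeak A :=
  SubWeak.generate A fun n =>
    {w | n < (ofLex i.1).1 ∨ (n = (ofLex i.1).1 ∧ w ∈ wbFaces n (ofLex i.1).2)}

end WbSquare

/-!
A weak bimodule over `Assoc_{>0}` is a semi-cosimplicial object: all operations are composites of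
the coface operators, which graft a tree into `a_2`, or graft `a_2` into a leaf. For `△` these
repeat a coordinate, or add a coordinate `0` or `1`.

*The homeomorphism.* The distances and parameters of a prism assign to each of the `n` leaves a
parameter `t_j`, and to each pair of consecutive leaves a distance `d_j`, where leaves with
different parameters have distance `1` (`IsConfig`). The coend remembers exactly this
(`IsConfig.exists_prism` and `bead_ne_iff`), and the collapse forgets the distances between leaves
with parameter `0` or `1`. The formula `1 - (1 - t_j) ∏_{i < j} (1 - d_i t_i / 2)` turns these data
into an increasing sequence (`stretch`). It is bijective on the data up to the collapse, as it can
be inverted one coordinate at a time (`IsConfig.eq_of_stretch_eq`, `exists_config`): given the data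
up to the `j`-th leaf, the next coordinate first increases with `d_j`, while the parameters agree,
and then with `t_{j+1}`, while `d_j = 1`. The grafting of trees acts on the coordinates by
repetition and by adding `0` and `1`, so this is a homeomorphism `Wb□ ≃ △` of weak bimodules
(`wbHomeo`), and the weak bimodule structure of `Wb□` is transported along it.

*The evaluation map.* On a prism it is determined by the lists of beads with their values. The
gluing relation merges neighbouring beads with the same parameter and distance `1`, and `g(-, t)` is
a morphism for a fixed parameter `t`, so the value does not change (`joinList_entries`,
`evalPrism_glue`). The collapse is respected because `g` is constant at the parameters `0` and `1`.

*The filtrations.* In `△`, hence in `Wb□`, each element is obtained in an essentially unique way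
from a nondegenerate one, one that is not in the image of a coface operator (`IsRegular`). So a
saturated part is determined by its nondegenerate elements, and a cell of nondegenerate elements,
with boundary in a smaller part, is attached freely (`IsCellAttachment.attachesCells`,
`isCellFiltration_of`). A morphism on the free attachment is defined by its graph; continuity
follows from compactness. In both cases the cells have as coordinates the different parameters and
the distances in `(0, 1)` (`openCell`), and on the boundary of a cell the number of these values
drops (`ncard_lt_of_boundary`). The nondegenerate elements of `△_N` are the interiors of the
simplices of dimension at most `N`, and these correspond to the nondegenerate elements of
`Wb□_{N,N}`, so `α(N) = (N, N)` (`image_triSkeleton`).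
-/

namespace WbSquare

/-! ### Weak bimodules as sequences with coface operators -/

/-- The coface operators of a weak bimodule. A weak bimodule over `Assoc_{>0}` is the same thing as
a semi-cosimplicial object: `coface 0` and `coface (n + 1)` graft into the last and into the first
input of `a_2`, and `coface i` with `1 ≤ i ≤ n` grafts `a_2` into the `i`-th input. -/
def WeakOps.coface {X : ℕ → Type u} (A : WeakOps X) {n : ℕ} (i : ℕ) (hi : i ≤ n + 1) (x : X n) :
    X (n + 1) :=
  if h0 : i = 0 then A.left 1 0 (by omega) x
  else if h1 : i = n + 1 then A.left 0 1 (by omega) x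
  else A.right (i - 1) 1 (n - i) (k := n) (r := n + 1) (by omega) (by omega) x

section Coface

variable {X : ℕ → Type u} (A : WeakOps X)

theorem WeakOps.coface_zero {n : ℕ} (x : X n) :
    A.coface 0 (Nat.zero_le _) x = A.left 1 0 (by omega) x := by
  simp [WeakOps.coface]

theorem WeakOps.coface_last {n : ℕ} (x : X n) :
    A.coface (n + 1) le_rfl x = A.left 0 1 (by omega) x := by
  simp [WeakOps.coface]

theorem WeakOps.right_congr {p m q p' m' q' k r : ℕ} (h : p + 1 + q = k) (h' : p + m + 1 + q = r)
    (hp : p = p') (hm : m = m') (hq : q = q') (x : X k) :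
    A.right p m q h h' x = A.right p' m' q' (by omega) (by omega) x := by
  subst hp hm hq; rfl

theorem WeakOps.coface_mid {n : ℕ} (p q : ℕ) (h : p + 1 + q = n) (x : X n) :
    A.coface (p + 1) (by omega) x = A.right p 1 q h (by omega) x := by
  rw [WeakOps.coface, dif_neg (by omega), dif_neg (by omega)]
  exact A.right_congr _ _ (by omega) rfl (by omega) x

/-- The cosimplicial identity. -/
theorem WeakBimodule.coface_coface [∀ n, TopologicalSpace (X n)] (E : WeakBimodule X) {n i j : ℕ}
    (hij : i ≤ j) (hj : j ≤ n + 1) (x : X n) :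
    E.coface (j + 1) (by omega) (E.coface i (by omega) x) =
      E.coface i (by omega) (E.coface j hj x) := by
  rcases Nat.eq_zero_or_pos i with rfl | hi
  · rw [E.coface_zero, E.coface_zero]
    rcases Nat.eq_zero_or_pos j with rfl | hj0
    · rw [E.coface_mid 0 n (by omega), E.coface_zero,
        E.left_left 1 0 1 0 (h'' := by omega)]
      have := E.right_before 0 0 0 1 (k := n) (l := n + 1) (r := n + 1 + 1)
        (by omega) (by omega) (by omega) (by omega) x
      exact (E.right_congr _ _ rfl rfl (by omega) _).trans this
    · obtain ⟨s, rfl⟩ : ∃ s, j = s + 1 := ⟨j - 1, by omega⟩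
      rcases Nat.lt_or_ge s n with hs | hs
      · rw [E.coface_mid (s + 1) (n - s - 1) (by omega), E.coface_mid s (n - s - 1) (by omega)]
        have := E.left_right 1 0 s (n - s - 1) 1 (k := n) (l := n + 1) (r := n + 1 + 1)
          (l' := n + 1)
          (by omega) (by omega) (by omega) (by omega) (by omega) (by omega) x
        exact (E.right_congr _ _ (by omega) rfl (by omega) _).trans this
      · obtain rfl : s = n := by omega
        rw [E.coface_last, E.coface_last, E.left_left 0 1 1 0 (h'' := by omega),
          E.left_left 1 0 0 1 (h'' := by omega)]
  · obtain ⟨a, rfl⟩ : ∃ s, i = s + 1 := ⟨i - 1, by omega⟩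
    obtain ⟨s, rfl⟩ : ∃ s, j = s + 1 := ⟨j - 1, by omega⟩
    rcases Nat.lt_or_ge a n with ha | ha
    · rw [E.coface_mid a (n - a - 1) (by omega)]
      rcases Nat.lt_or_ge s n with hs | hs
      · rw [E.coface_mid s (n - s - 1) (by omega), E.coface_mid (s + 1) (n - s - 1) (by omega),
          E.coface_mid a (n - a) (by omega)]
        rcases Nat.eq_or_lt_of_le hij with hh | hh
        · obtain rfl : a = s := by omega
          have h1 := E.right_right a (n - a - 1) 1 0 1 (k := n) (l := n + 1) (r := n + 1 + 1)
            (by omega) (by omega) (by omega) (by omega) (by omega) x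
          have h2 := E.right_right a (n - a - 1) 0 1 1 (k := n) (l := n + 1) (r := n + 1 + 1)
            (by omega) (by omega) (by omega) (by omega) (by omega) x
          have h3 := h1.trans h2.symm
          refine Eq.trans ?_ (h3.trans ?_)
          · exact (E.right_congr _ _ (by omega) rfl (by omega) _)
          · exact (E.right_congr _ _ (by omega) rfl (by omega) _)
        · have h1 := E.right_comm a (s - a - 1) (n - s - 1) 1 1 (k := n) (l := n + 1) (l' := n + 1)
            (r := n + 1 + 1) (by omega) (by omega) (by omega) (by omega) (by omega) (by omega)
            (by omega) (by omega) x
          rw [E.right_congr (q := s - a - 1 + 1 + (n - s - 1)) (p' := a) (m' := 1)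
              (q' := n - a - 1) _ _ rfl rfl (by omega),
            E.right_congr (p := a + 1 + 1 + (s - a - 1)) (p' := s + 1) (m' := 1)
              (q' := n - s - 1) _ _ (by omega) rfl (by omega),
            E.right_congr (q := s - a - 1 + 1 + 1 + (n - s - 1)) (p' := a) (m' := 1)
              (q' := n - a) _ _ rfl rfl (by omega),
            E.right_congr (p := a + 1 + (s - a - 1)) (p' := s) (m' := 1) (q' := n - s - 1)
              _ _ (by omega) rfl (by omega)] at h1
          exact h1
      · obtain rfl : s = n := by omega
        rw [E.coface_last, E.coface_last, E.coface_mid a (s - a) (by omega)]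
        have h1 := E.left_right 0 1 a (s - a - 1) 1 (k := s) (l := s + 1) (r := s + 1 + 1)
          (l' := s + 1)
          (by omega) (by omega) (by omega) (by omega) (by omega) (by omega) x
        exact h1.symm.trans (E.right_congr _ _ (by omega) rfl (by omega) _)
    · obtain rfl : a = n := by omega
      obtain rfl : s = a := by omega
      rw [E.coface_last, E.coface_last, E.coface_mid s 0 (by omega),
        E.left_left 0 1 0 1 (h'' := by omega)]
      have := E.right_after 0 0 0 1 (k := s) (l := s + 1) (r := s + 1 + 1)
        (by omega) (by omega) (by omega) (by omega) x
      exact this.symm.trans (E.right_congr _ _ (by omega) rfl (by omega) _)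

/-- All operations are iterated coface operators. -/
structure WeakOps.GeneratedByCofaces : Prop where
  left_zero : ∀ {k : ℕ} (x : X k), A.left 0 0 (by omega) x = x
  left_succ : ∀ (p q : ℕ) {k r : ℕ} (h : p + k + q = r) (x : X k),
    A.left (p + 1) q (by omega) x = A.coface 0 (Nat.zero_le _) (A.left p q h x)
  left_zero_succ : ∀ (q : ℕ) {k r : ℕ} (h : 0 + k + q = r) (x : X k),
    A.left 0 (q + 1) (by omega) x = A.coface (r + 1) le_rfl (A.left 0 q h x)
  right_zero : ∀ (p q : ℕ) {k : ℕ} (h : p + 1 + q = k) (x : X k),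
    A.right p 0 q h (by omega) x = x
  right_succ : ∀ (p m q : ℕ) {k r : ℕ} (h : p + 1 + q = k) (h' : p + m + 1 + q = r) (x : X k),
    A.right p (m + 1) q h (by omega) x = A.coface (p + 1) (by omega) (A.right p m q h h' x)

/-- All operations of a weak bimodule are composites of coface operators. -/
theorem WeakBimodule.generatedByCofaces [∀ n, TopologicalSpace (X n)] (E : WeakBimodule X) :
    E.GeneratedByCofaces where
  left_zero x := E.left_unit _ x
  left_succ p q k r h x := by
    subst h
    rw [E.coface_zero, E.left_left 1 0 p q (h'' := by omega)]
    congr 1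
    omega
  left_zero_succ q k r h x := by
    subst h
    rw [E.coface_last, E.left_left 0 1 0 q (h'' := by omega)]
  right_zero p q k h x := E.right_unit p q h _ x
  right_succ p m q k r h h' x := by
    subst h h'
    rw [E.coface_mid p (m + q) (by omega)]
    have := E.right_right p q 0 m 1 (k := p + 1 + q) (l := p + m + 1 + q) (r := p + m + 1 + q + 1)
      (by omega) (by omega) (by omega) (by omega) (by omega) x
    rw [E.right_congr (m := 0 + 1 + m) (m' := m + 1) _ _ rfl (by omega) rfl,
      E.right_congr (m := 0 + m) (m' := m) _ _ rfl (by omega) rfl] at this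
    refine this.symm.trans (E.right_congr _ _ rfl rfl (by omega) _)

end Coface

section Hom

variable {X : ℕ → Type u} {Y : ℕ → Type v} {A : WeakOps X} {B : WeakOps Y} {f : ∀ n, X n → Y n}

theorem IsWeakHom.map_coface [∀ n, TopologicalSpace (X n)] [∀ n, TopologicalSpace (Y n)]
    (hf : IsWeakHom A B f) {n : ℕ} (i : ℕ) (hi : i ≤ n + 1) (x : X n) :
    f (n + 1) (A.coface i hi x) = B.coface i hi (f n x) := by
  simp only [WeakOps.coface]
  split_ifs
  · exact hf.map_left _ _ _ _
  · exact hf.map_left _ _ _ _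
  · exact hf.map_right _ _ _ _ _ _

/-- A property of elements that is preserved by the coface operators is preserved by all the
operations. -/
theorem WeakOps.GeneratedByCofaces.left_induction (hA : A.GeneratedByCofaces)
    {P : ∀ n, X n → Prop} (hP : ∀ n i (hi : i ≤ n + 1) x, P n x → P (n + 1) (A.coface i hi x))
    (p q : ℕ) {k r : ℕ} (h : p + k + q = r) (x : X k) (hx : P k x) : P r (A.left p q h x) := by
  subst h
  induction p with
  | zero =>
    induction q with
    | zero =>
      have : ∀ r (h : 0 + k + 0 = r), P r (A.left 0 0 h x) := by
        intro r h
        obtain rfl : k = r := by omega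
        rwa [hA.left_zero]
      exact this _ _
    | succ q ih =>
      have := hP _ _ le_rfl _ ih
      rw [← hA.left_zero_succ] at this
      exact this
  | succ p ih =>
    have h2 := hP _ 0 (Nat.zero_le _) _ ih
    rw [← hA.left_succ] at h2
    have : ∀ r (h : p + 1 + k + q = r) (h' : p + k + q + 1 = r), P r (A.left (p + 1) q h x) := by
      intro r h h'
      subst h'
      exact h2
    exact this _ rfl (by omega)

theorem WeakOps.GeneratedByCofaces.right_induction (hA : A.GeneratedByCofaces)
    {P : ∀ n, X n → Prop} (hP : ∀ n i (hi : i ≤ n + 1) x, P n x → P (n + 1) (A.coface i hi x))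
    (p m q : ℕ) {k r : ℕ} (h : p + 1 + q = k) (h' : p + m + 1 + q = r) (x : X k) (hx : P k x) :
    P r (A.right p m q h h' x) := by
  induction m generalizing r with
  | zero =>
    obtain rfl : k = r := by omega
    rwa [hA.right_zero]
  | succ m ih =>
    obtain ⟨r, rfl⟩ : ∃ s, r = s + 1 := ⟨r - 1, by omega⟩
    rw [hA.right_succ p m q h (by omega)]
    exact hP _ _ _ _ (ih _)

/-- A degreewise continuous map that commutes with the coface operators is a morphism. -/
theorem IsWeakHom.of_coface [∀ n, TopologicalSpace (X n)] [∀ n, TopologicalSpace (Y n)]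
    (hA : A.GeneratedByCofaces) (hB : B.GeneratedByCofaces) (hc : ∀ n, Continuous (f n))
    (hf : ∀ n i (hi : i ≤ n + 1) x, f (n + 1) (A.coface i hi x) = B.coface i hi (f n x)) :
    IsWeakHom A B f where
  continuous := hc
  map_left p q k r h x := by
    subst h
    induction p with
    | zero =>
      induction q with
      | zero =>
        have : ∀ r (h : 0 + k + 0 = r), f r (A.left 0 0 h x) = B.left 0 0 h (f k x) := by
          intro r h
          obtain rfl : k = r := by omega
          rw [hA.left_zero, hB.left_zero]
        exact this _ _
      | succ q ih =>
        rw [hA.left_zero_succ q rfl, hB.left_zero_succ q rfl, ← ih, ← hf]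
        rfl
    | succ p ih =>
      have : ∀ r (h : p + 1 + k + q = r) (h' : p + k + q + 1 = r),
          f r (A.left (p + 1) q h x) = B.left (p + 1) q h (f k x) := by
        intro r h h'
        subst h'
        rw [hA.left_succ p q rfl, hB.left_succ p q rfl, ← ih, ← hf]
      exact this _ rfl (by omega)
  map_right p m q k r h h' x := by
    induction m generalizing r with
    | zero =>
      obtain rfl : k = r := by omega
      rw [hA.right_zero, hB.right_zero]
    | succ m ih =>
      obtain ⟨r, rfl⟩ : ∃ s, r = s + 1 := ⟨r - 1, by omega⟩
      rw [hA.right_succ p m q h (by omega), hB.right_succ p m q h (by omega), ← ih, ← hf]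

end Hom

/-! ### Regular weak bimodules -/

/-- A weak bimodule in which every element is obtained in an essentially unique way from a
nondegenerate one: the coface operators are injective, and an element in the images of two of them
comes from an element two degrees below. -/
structure IsRegular {X : ℕ → Type u} (A : WeakOps X) : Prop where
  generated : A.GeneratedByCofaces
  injective : ∀ n i (hi : i ≤ n + 1), Function.Injective (A.coface (n := n) i hi)
  coface_ne : ∀ (x x' : X 0), A.coface 0 (by omega) x ≠ A.coface 1 (by omega) x'
  diamond : ∀ n i j (hij : i < j) (hj : j ≤ n + 2) (x x' : X (n + 1)),
    A.coface i (by omega) x = A.coface j hj x' →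
      ∃ y : X n, x = A.coface (j - 1) (by omega) y ∧ x' = A.coface i (by omega) y

/-- The degenerate elements: those in the image of a coface operator. -/
inductive IsDegenerate {X : ℕ → Type u} (A : WeakOps X) : ∀ n, X n → Prop
  | coface {n : ℕ} (i : ℕ) (hi : i ≤ n + 1) (x : X n) : IsDegenerate A (n + 1) (A.coface i hi x)

theorem IsDegenerate.exists {X : ℕ → Type u} {A : WeakOps X} {n : ℕ} {x : X (n + 1)}
    (h : IsDegenerate A (n + 1) x) : ∃ i, ∃ hi : i ≤ n + 1, ∃ y : X n, A.coface i hi y = x := by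
  have : ∀ m (z : X m) (h : IsDegenerate A m z) (e : m = n + 1) (hz : e ▸ z = x),
      ∃ i, ∃ hi : i ≤ n + 1, ∃ y : X n, A.coface i hi y = x := by
    rintro m z ⟨i, hi, y⟩ e hz
    obtain rfl := Nat.succ_injective e
    exact ⟨i, hi, y, hz⟩
  exact this _ x h rfl rfl

theorem IsDegenerate.degree_pos {X : ℕ → Type u} {A : WeakOps X} {n : ℕ} {x : X n}
    (h : IsDegenerate A n x) : 0 < n := by
  cases h; omega

/-- Regularity is inherited along an injective map of weak bimodules with saturated image. -/
theorem IsRegular.of_injective {X : ℕ → Type u} {Y : ℕ → Type v} {A : WeakOps X} {B : WeakOps Y}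
    {f : ∀ n, X n → Y n} (hB : IsRegular B) (hf : ∀ n, Function.Injective (f n))
    (hl : ∀ (p q : ℕ) {k r : ℕ} (h : p + k + q = r) (x : X k),
      f r (A.left p q h x) = B.left p q h (f k x))
    (hr : ∀ (p m q : ℕ) {k r : ℕ} (h : p + 1 + q = k) (h' : p + m + 1 + q = r) (x : X k),
      f r (A.right p m q h h' x) = B.right p m q h h' (f k x))
    (hs : ∀ n i (hi : i ≤ n + 1) (y : Y n), B.coface i hi y ∈ Set.range (f (n + 1)) →
      y ∈ Set.range (f n)) : IsRegular A := by
  have hc : ∀ {n : ℕ} (i : ℕ) (hi : i ≤ n + 1) (x : X n),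
      f (n + 1) (A.coface i hi x) = B.coface i hi (f n x) := by
    intro n i hi x
    simp only [WeakOps.coface]
    split_ifs
    · exact hl _ _ _ _
    · exact hl _ _ _ _
    · exact hr _ _ _ _ _ _
  refine ⟨⟨?_, ?_, ?_, ?_, ?_⟩, ?_, ?_, ?_⟩
  · intro k x; apply hf; rw [hl, hB.generated.left_zero]
  · intro p q k r h x; apply hf; rw [hl, hB.generated.left_succ p q h, hc, hl]
  · intro q k r h x; apply hf; rw [hl, hB.generated.left_zero_succ q h, hc, hl]
  · intro p q k h x; apply hf; rw [hr, hB.generated.right_zero]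
  · intro p m q k r h h' x; apply hf; rw [hr, hB.generated.right_succ p m q h h', hc, hr]
  · intro n i hi x y hxy
    have := congrArg (f _) hxy
    rw [hc, hc] at this
    exact hf _ (hB.injective _ _ _ this)
  · intro x x' h
    have := congrArg (f _) h
    rw [hc, hc] at this
    exact hB.coface_ne _ _ this
  · intro n i j hij hj x x' h
    have := congrArg (f _) h
    rw [hc, hc] at this
    obtain ⟨y, h1, h2⟩ := hB.diamond n i j hij hj _ _ this
    obtain ⟨y, rfl⟩ := hs _ _ _ _ ⟨x, h1⟩
    refine ⟨y, hf _ ?_, hf _ ?_⟩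
    · rw [hc, h1]
    · rw [hc, h2]

/-! ### The weak bimodule of simplices is regular -/

/-- The family `t_1, …, t_n`, indexed from `0` and continued by `1`. -/
def seqAt {n : ℕ} (t : Fin n → unitInterval) (j : ℕ) : unitInterval :=
  if h : j < n then t ⟨j, h⟩ else 1

theorem seqAt_val {n : ℕ} (t : Fin n → unitInterval) (j : Fin n) : seqAt t j.1 = t j := by
  simp [seqAt]

theorem seqAt_of_le {n : ℕ} (t : Fin n → unitInterval) {j : ℕ} (h : n ≤ j) : seqAt t j = 1 := by
  simp [seqAt, h]

theorem seqAt_monotone {n : ℕ} {t : Fin n → unitInterval} (ht : Monotone t) :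
    Monotone (seqAt t) := by
  intro i j hij
  simp only [seqAt]
  split_ifs
  · exact ht hij
  · exact unitInterval.le_one _
  · omega
  · exact le_rfl

theorem seqAt_injective {n : ℕ} {t t' : Fin n → unitInterval} (h : ∀ j, seqAt t j = seqAt t' j) :
    t = t' := by
  funext j
  rw [← seqAt_val t, ← seqAt_val t', h]

theorem tri_ext {n : ℕ} {t t' : Tri n} (h : ∀ j, seqAt t.1 j = seqAt t'.1 j) : t = t' :=
  Subtype.ext (seqAt_injective h)

/-- The element of `△(n)` given by a monotone sequence. -/
def Tri.ofSeq (n : ℕ) (s : ℕ → unitInterval) (hs : Monotone s) : Tri n :=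
  ⟨fun j => s j.1, fun _ _ h => hs h⟩

theorem seqAt_ofSeq {n : ℕ} {s : ℕ → unitInterval} (hs : Monotone s) (h1 : ∀ j, n ≤ j → s j = 1)
    (j : ℕ) : seqAt (Tri.ofSeq n s hs).1 j = s j := by
  by_cases hj : j < n
  · simp [seqAt, hj, Tri.ofSeq]
  · rw [seqAt_of_le _ (by omega), h1 j (by omega)]

theorem seqAt_pad (p q : ℕ) {k r : ℕ} (h : p + k + q = r) (t : Fin k → unitInterval) (j : ℕ) :
    seqAt (pad p q h t) j = if j < p then 0 else seqAt t (j - p) := by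
  simp only [seqAt, pad]
  split_ifs <;> first | rfl | omega

theorem seqAt_dup (p m q : ℕ) {k r : ℕ} (h : p + 1 + q = k) (h' : p + m + 1 + q = r)
    (t : Fin k → unitInterval) (j : ℕ) :
    seqAt (dup p m q h h' t) j = seqAt t (if j < p then j else if j ≤ p + m then p else j - m) := by
  by_cases hj : j < r
  · rw [seqAt, dif_pos hj, seqAt, dif_pos (by split_ifs <;> omega)]
    rfl
  · rw [seqAt_of_le _ (by omega), seqAt_of_le _ (by split_ifs <;> omega)]

theorem seqAt_coface {n i : ℕ} (hi : i ≤ n + 1) (t : Tri n) (j : ℕ) :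
    seqAt (tri.coface i hi t).1 j =
      if j < i then seqAt t.1 j else if j = 0 then 0 else seqAt t.1 (j - 1) := by
  rcases Nat.eq_zero_or_pos i with rfl | h0
  · rw [WeakOps.coface_zero]
    refine (seqAt_pad 1 0 (by omega) t.1 j).trans ?_
    simp
  · obtain ⟨p, rfl⟩ : ∃ p, i = p + 1 := ⟨i - 1, by omega⟩
    rcases Nat.lt_or_ge p n with h1 | h1
    · rw [WeakOps.coface_mid _ p (n - p - 1) (by omega)]
      refine (seqAt_dup p 1 (n - p - 1) (by omega) (by omega) t.1 j).trans ?_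
      have : (if j < p then j else if j ≤ p + 1 then p else j - 1) =
        if j < p + 1 then j else j - 1 := by split_ifs <;> omega
      rw [this]
      split_ifs <;> first | rfl | omega
    · obtain rfl : p = n := by omega
      rw [WeakOps.coface_last]
      refine (seqAt_pad 0 1 (by omega) t.1 j).trans ?_
      simp only [seqAt]
      split_ifs <;> first | rfl | omega

/-- Two expressions of a monotone sequence as a coface come from the sequence without both of
the entries that were added. -/
theorem tri_isRegular : IsRegular tri.toWeakOps where
  generated := tri.generatedByCofaces
  injective n i hi x y h := by
    refine tri_ext fun j => ?_
    have h1 := congrArg (fun t : Tri (n + 1) => seqAt t.1 j) h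
    have h2 := congrArg (fun t : Tri (n + 1) => seqAt t.1 (j + 1)) h
    simp only [seqAt_coface, Nat.add_sub_cancel, Nat.succ_ne_zero, if_false] at h1 h2
    by_cases hj : j < i
    · rwa [if_pos hj, if_pos hj] at h1
    · rwa [if_neg (by omega), if_neg (by omega)] at h2
  coface_ne x y h := by
    have h1 := congrArg (fun t : Tri 1 => seqAt t.1 0) h
    simp only [seqAt_coface] at h1
    simp [seqAt] at h1
  diamond n i j hij hj x x' h := by
    have h1 : ∀ a, (if a < i then seqAt x.1 a else if a = 0 then 0 else seqAt x.1 (a - 1)) =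
        if a < j then seqAt x'.1 a else if a = 0 then 0 else seqAt x'.1 (a - 1) := by
      intro a
      have := congrArg (fun t : Tri (n + 2) => seqAt t.1 a) h
      simpa only [seqAt_coface] using this
    have hm := seqAt_monotone x'.2
    have htop : ∀ a, n + 1 ≤ a → seqAt x'.1 a = 1 := fun a => seqAt_of_le _
    let s : ℕ → unitInterval := fun a => if a < i then seqAt x'.1 a else seqAt x'.1 (a + 1)
    have hs : Monotone s := by
      intro a b hab
      simp only [s]
      split_ifs <;> exact hm (by omega)
    have hs1 : ∀ a, n ≤ a → s a = 1 := by
      intro a ha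
      simp only [s]
      split_ifs with hai
      · -- here `i = n + 1`, `j = n + 2` and `a = n`
        obtain rfl : a = n := by omega
        have h2 := h1 a
        have h3 := h1 (a + 1)
        have h4 := htop (a + 1) le_rfl
        rw [if_pos hai, if_pos (by omega)] at h2
        rw [if_neg (by omega), if_neg (by omega), if_pos (by omega), h4] at h3
        rw [← h2, ← h3]; rfl
      · exact htop _ (by omega)
    refine ⟨Tri.ofSeq n s hs, tri_ext fun a => ?_, tri_ext fun a => ?_⟩
    · rw [seqAt_coface, seqAt_ofSeq hs hs1, seqAt_ofSeq hs hs1]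
      simp only [s]
      have h2 := h1 a
      have h3 := h1 (a + 1)
      have h4 := h1 (a - 1)
      grind
    · rw [seqAt_coface, seqAt_ofSeq hs hs1, seqAt_ofSeq hs hs1]
      simp only [s]
      have h2 := h1 a
      have h4 := h1 (a - 1)
      grind

/-- The simplex as a closed subset of a cube is compact. -/
instance (n : ℕ) : CompactSpace (Tri n) := by
  apply isCompact_iff_compactSpace.1
  have : IsClosed {t : Fin n → unitInterval | Monotone t} := isClosed_monotone
  exact this.isCompact

/-- A point of a simplex is nondegenerate exactly when it lies in the interior. -/
theorem not_isDegenerate_tri {n : ℕ} (t : Tri n) : ¬ IsDegenerate tri.toWeakOps n t ↔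
    (∀ j, j < n → 0 < seqAt t.1 j ∧ seqAt t.1 j < 1) ∧
      ∀ j, j + 1 < n → seqAt t.1 j < seqAt t.1 (j + 1) := by
  have hm := seqAt_monotone t.2
  constructor
  · intro h
    obtain _ | m := n
    · exact ⟨fun j hj => absurd hj (by omega), fun j hj => absurd hj (by omega)⟩
    -- an equality between two consecutive entries of `0, t_1, …, t_n, 1` makes `t` degenerate
    have key : ∀ i, i ≤ m + 1 → (if i = 0 then 0 else seqAt t.1 (i - 1)) ≠ seqAt t.1 i := by
      intro i hi he
      apply h
      let s : ℕ → unitInterval := fun a => if a < i then seqAt t.1 a else seqAt t.1 (a + 1)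
      have hs : Monotone s := by
        intro a b hab
        simp only [s]
        split_ifs <;> exact hm (by omega)
      have hs1 : ∀ a, m ≤ a → s a = 1 := by
        intro a ha
        simp only [s]
        split_ifs with hai
        · obtain rfl : i = a + 1 := by omega
          rw [if_neg (by omega), seqAt_of_le (j := a + 1) _ (by omega)] at he
          exact he
        · exact seqAt_of_le _ (by omega)
      have : tri.coface i hi (Tri.ofSeq m s hs) = t := by
        refine tri_ext fun a => ?_
        rw [seqAt_coface, seqAt_ofSeq hs hs1, seqAt_ofSeq hs hs1]
        simp only [s]
        grind
      rw [← this]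
      exact .coface i hi _
    have h0 := key 0 (by omega)
    have h1 := key (m + 1) le_rfl
    rw [if_pos rfl] at h0
    rw [if_neg (by omega), seqAt_of_le (j := m + 1) _ le_rfl] at h1
    refine ⟨fun j hj => ⟨?_, ?_⟩, fun j hj => ?_⟩
    · exact (lt_of_le_of_ne (bot_le (α := unitInterval)) h0).trans_le (hm (Nat.zero_le _))
    · exact (hm (by omega : j ≤ m)).trans_lt (lt_of_le_of_ne (le_top (α := unitInterval)) h1)
    · have := key (j + 1) (by omega)
      exact lt_of_le_of_ne (hm (by omega)) this
  · rintro ⟨h1, h2⟩ hd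
    obtain _ | m := n
    · exact absurd hd.degree_pos (by omega)
    obtain ⟨i, hi, y, rfl⟩ := hd.exists
    rcases Nat.eq_zero_or_pos i with rfl | h0
    · have := (h1 0 (by omega)).1
      rw [seqAt_coface] at this
      simp at this
    · rcases Nat.lt_or_ge i (m + 1) with h3 | h3
      · have := h2 (i - 1) (by omega)
        rw [seqAt_coface, seqAt_coface] at this
        rw [if_pos (by omega), if_neg (by omega), if_neg (by omega)] at this
        exact absurd this (by simp)
      · have := (h1 m (by omega)).2
        rw [seqAt_coface, if_pos (by omega), seqAt_of_le _ le_rfl] at this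
        exact lt_irrefl _ this

/-! ### A criterion for free attachments of cells -/

theorem WeakBimodule.continuous_coface {X : ℕ → Type u} [∀ n, TopologicalSpace (X n)]
    (E : WeakBimodule X) {n : ℕ} (i : ℕ) (hi : i ≤ n + 1) :
    Continuous (E.coface (n := n) i hi) := by
  unfold WeakOps.coface
  split_ifs
  · exact E.continuous_left _ _ _
  · exact E.continuous_left _ _ _
  · exact E.continuous_right _ _ _ _ _

/-- The cells `Φ` of degree `N` are attached to the part `S` of a regular weak bimodule: the open
cells are disjoint, consist of nondegenerate elements outside of `S`, and contain all of these. -/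
structure IsCellAttachment {X : ℕ → Type u} [∀ n, TopologicalSpace (X n)] (B : WeakOps X)
    (S : ∀ n, Set (X n)) (N : ℕ) {C : Type} (dim : C → ℕ) (Φ : ∀ c, Disc (dim c) → X N) :
    Prop where
  continuous : ∀ c, Continuous (Φ c)
  injective : ∀ c c' (v : Disc (dim c)) (v' : Disc (dim c')), ‖v.1‖ < 1 → ‖v'.1‖ < 1 →
    Φ c v = Φ c' v' → (⟨c, v⟩ : Σ c, Disc (dim c)) = ⟨c', v'⟩
  nondegenerate : ∀ c (v : Disc (dim c)), ‖v.1‖ < 1 → ¬ IsDegenerate B N (Φ c v)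
  notMem : ∀ c (v : Disc (dim c)), ‖v.1‖ < 1 → Φ c v ∉ S N
  boundary : ∀ c (v : Disc (dim c)), ‖v.1‖ = 1 → Φ c v ∈ S N
  cover : ∀ n (x : X n), x ∈ S n ∨ IsDegenerate B n x ∨
    ∃ c v, (⟨N, Φ c v⟩ : Σ n, X n) = ⟨n, x⟩
  saturated : ∀ n i (hi : i ≤ n + 1) (x : X n), B.coface i hi x ∈ S (n + 1) → x ∈ S n

/-- The graph of the extension to `X` of the morphism `φ` on `Y` and of the maps `ψ` on the
cells. -/
inductive ExtensionGraph {X Y Z : ℕ → Type} (B : WeakOps X) (E : WeakOps Z) (ι : ∀ n, Y n → X n)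
    (φ : ∀ n, Y n → Z n) (N : ℕ) {C : Type} {dim : C → ℕ}
    (Φ : ∀ c, Disc (dim c) → X N) (ψ : ∀ c, Disc (dim c) → Z N) : ∀ n, X n → Z n → Prop
  | base (n : ℕ) (y : Y n) : ExtensionGraph B E ι φ N Φ ψ n (ι n y) (φ n y)
  | cell (c : C) (v : Disc (dim c)) : ExtensionGraph B E ι φ N Φ ψ N (Φ c v) (ψ c v)
  | coface {n : ℕ} (i : ℕ) (hi : i ≤ n + 1) (x : X n) (z : Z n) :
      ExtensionGraph B E ι φ N Φ ψ n x z →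
      ExtensionGraph B E ι φ N Φ ψ (n + 1) (B.coface i hi x) (E.coface i hi z)

theorem ExtensionGraph.cases_sigma {X Y Z : ℕ → Type} {B : WeakOps X} {E : WeakOps Z}
    {ι : ∀ n, Y n → X n} {φ : ∀ n, Y n → Z n} {N : ℕ} {C : Type} {dim : C → ℕ}
    {Φ : ∀ c, Disc (dim c) → X N} {ψ : ∀ c, Disc (dim c) → Z N} {n : ℕ} {x : X n} {z : Z n}
    (h : ExtensionGraph B E ι φ N Φ ψ n x z) :
    (∃ y, ι n y = x ∧ φ n y = z) ∨
    (∃ c v, (⟨N, Φ c v, ψ c v⟩ : Σ n, X n × Z n) = ⟨n, x, z⟩) ∨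
    ∃ m i, ∃ hi : i ≤ m + 1, ∃ x₁ z₁, ExtensionGraph B E ι φ N Φ ψ m x₁ z₁ ∧
      (⟨m + 1, B.coface i hi x₁, E.coface i hi z₁⟩ : Σ n, X n × Z n) = ⟨n, x, z⟩ := by
  cases h with
  | base n y => exact Or.inl ⟨y, rfl, rfl⟩
  | cell c v => exact Or.inr (Or.inl ⟨c, v, rfl⟩)
  | coface i hi x z h => exact Or.inr (Or.inr ⟨_, i, hi, x, z, h, rfl⟩)

section Extension

variable {X Y Z : ℕ → Type} [∀ n, TopologicalSpace (X n)] [∀ n, TopologicalSpace (Z n)]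
  {A : WeakOps Y} {B : WeakOps X} {E : WeakBimodule Z}
  {ι : ∀ n, Y n → X n} {φ : ∀ n, Y n → Z n} {N : ℕ} {C : Type} {dim : C → ℕ}
  {Φ : ∀ c, Disc (dim c) → X N} {ψ : ∀ c, Disc (dim c) → Z N}

theorem norm_lt_or_eq {d : ℕ} (v : Disc d) : ‖v.1‖ < 1 ∨ ‖v.1‖ = 1 :=
  lt_or_eq_of_le (mem_closedBall_zero_iff.1 v.2)

theorem ExtensionGraph.exists (h : IsCellAttachment B (fun n => Set.range (ι n)) N dim Φ) (n : ℕ)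
    (x : X n) : ∃ z, ExtensionGraph B E.toWeakOps ι φ N Φ ψ n x z := by
  induction n with
  | zero =>
    rcases h.cover 0 x with ⟨y, rfl⟩ | hd | ⟨c, v, he⟩
    · exact ⟨_, .base _ y⟩
    · exact absurd hd.degree_pos (lt_irrefl _)
    · cases he
      exact ⟨_, .cell c v⟩
  | succ n ih =>
    rcases h.cover (n + 1) x with ⟨y, rfl⟩ | hd | ⟨c, v, he⟩
    · exact ⟨_, .base _ y⟩
    · obtain ⟨i, hi, y, rfl⟩ := hd.exists
      obtain ⟨z, hz⟩ := ih y
      exact ⟨_, .coface i hi y z hz⟩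
    · cases he
      exact ⟨_, .cell c v⟩

variable [∀ n, TopologicalSpace (Y n)]

/-- On `Y` the extension is `φ`, since elements of `Y` are cofaces only of elements of `Y`. -/
theorem ExtensionGraph.eq_of_mem_range
    (h : IsCellAttachment B (fun n => Set.range (ι n)) N dim Φ) (hι : IsWeakHom A B ι)
    (hinj : ∀ n, Function.Injective (ι n)) (hφ : IsWeakHom A E.toWeakOps φ)
    (hψ : ∀ c (v : Disc (dim c)) y, ‖v.1‖ = 1 → Φ c v = ι N y → ψ c v = φ N y)
    {n : ℕ} {x : X n} {z : Z n} (hz : ExtensionGraph B E.toWeakOps ι φ N Φ ψ n x z) :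
    ∀ y, x = ι n y → z = φ n y := by
  induction hz with
  | base n y₀ => intro y hy; rw [hinj _ hy]
  | cell c v =>
    intro y hy
    rcases norm_lt_or_eq v with hv | hv
    · exact absurd ⟨y, hy.symm⟩ (h.notMem c v hv)
    · exact hψ c v y hv hy
  | coface i hi x z hz ih =>
    intro y hy
    obtain ⟨y₁, rfl⟩ := h.saturated _ i hi x ⟨y, hy.symm⟩
    rw [ih y₁ rfl, ← hφ.map_coface]
    rw [← hι.map_coface] at hy
    rw [hinj _ hy]

/-- Two ways to write an element of `X` have a common refinement, so the extension is well
defined. -/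
theorem ExtensionGraph.unique (hB : IsRegular B)
    (h : IsCellAttachment B (fun n => Set.range (ι n)) N dim Φ) (hι : IsWeakHom A B ι)
    (hinj : ∀ n, Function.Injective (ι n)) (hφ : IsWeakHom A E.toWeakOps φ)
    (hψ : ∀ c (v : Disc (dim c)) y, ‖v.1‖ = 1 → Φ c v = ι N y → ψ c v = φ N y)
    (n : ℕ) : ∀ {x : X n} {z z' : Z n}, ExtensionGraph B E.toWeakOps ι φ N Φ ψ n x z →
      ExtensionGraph B E.toWeakOps ι φ N Φ ψ n x z' → z = z' := by
  induction n with
  | zero =>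
    intro x z z' hz hz'
    by_cases hx : x ∈ Set.range (ι 0)
    · obtain ⟨y, rfl⟩ := hx
      rw [hz.eq_of_mem_range h hι hinj hφ hψ y rfl, hz'.eq_of_mem_range h hι hinj hφ hψ y rfl]
    rcases hz.cases_sigma with ⟨y, rfl, -⟩ | ⟨c, v, he⟩ | ⟨m, i, hi, x₁, z₁, h₁, he⟩
    · exact absurd ⟨y, rfl⟩ hx
    · rcases hz'.cases_sigma with ⟨y, rfl, -⟩ | ⟨c', v', he'⟩ | ⟨m, i, hi, x₁, z₁, h₁, he'⟩
      · exact absurd ⟨y, rfl⟩ hx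
      · cases he
        have hv : ‖v.1‖ < 1 := (norm_lt_or_eq v).resolve_right fun hv => hx (h.boundary c v hv)
        simp only [Sigma.mk.injEq, heq_eq_eq, true_and, Prod.mk.injEq] at he'
        have hv' : ‖v'.1‖ < 1 := (norm_lt_or_eq v').resolve_right fun hv =>
          hx (he'.1 ▸ h.boundary c' v' hv)
        cases h.injective _ _ _ _ hv' hv he'.1
        exact he'.2
      · have := congrArg Sigma.fst he'
        simp at this
    · have := congrArg Sigma.fst he
      simp at this
  | succ n ih =>
    intro x z z' hz hz'
    by_cases hx : x ∈ Set.range (ι (n + 1))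
    · obtain ⟨y, rfl⟩ := hx
      rw [hz.eq_of_mem_range h hι hinj hφ hψ y rfl, hz'.eq_of_mem_range h hι hinj hφ hψ y rfl]
    have key : ∀ {m x z} (e : m = n + 1),
        ExtensionGraph B E.toWeakOps ι φ N Φ ψ m x z → x ∉ Set.range (ι m) →
        (∃ c v, ‖v.1‖ < 1 ∧ (⟨N, Φ c v, ψ c v⟩ : Σ n, X n × Z n) = ⟨m, x, z⟩) ∨
        ∃ i, ∃ hi : i ≤ n + 1, ∃ x₁ z₁, ExtensionGraph B E.toWeakOps ι φ N Φ ψ n x₁ z₁ ∧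
          (⟨n + 1, B.coface i hi x₁, E.coface i hi z₁⟩ : Σ n, X n × Z n) = ⟨m, x, z⟩ := by
      intro m x z e hz hx
      rcases hz.cases_sigma with ⟨y, rfl, -⟩ | ⟨c, v, he⟩ | ⟨m, i, hi, x₁, z₁, h₁, he⟩
      · exact absurd ⟨y, rfl⟩ hx
      · cases he
        exact Or.inl ⟨c, v, (norm_lt_or_eq v).resolve_right fun hv => hx (h.boundary c v hv), rfl⟩
      · cases he
        obtain rfl := Nat.succ_injective e
        exact Or.inr ⟨i, hi, x₁, z₁, h₁, rfl⟩
    have hcell : ∀ c (v : Disc (dim c)), ‖v.1‖ < 1 → ∀ (z z' : Z (n + 1)) i (hi : i ≤ n + 1)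
        (x₁ : X n), (⟨N, Φ c v, ψ c v⟩ : Σ n, X n × Z n) = ⟨n + 1, x, z⟩ →
        B.coface i hi x₁ = x → z = z' := by
      intro c v hv z z' i hi x₁ he hx
      cases he
      exact absurd (hx ▸ IsDegenerate.coface i hi x₁) (h.nondegenerate c v hv)
    -- the case of two different coface operators
    have hlt : ∀ i j (_ : i < j) (hj : j ≤ n + 1) (x₁ x₂ : X n) (z₁ z₂ : Z n),
        ExtensionGraph B E.toWeakOps ι φ N Φ ψ n x₁ z₁ →
        ExtensionGraph B E.toWeakOps ι φ N Φ ψ n x₂ z₂ →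
        B.coface i (by omega) x₁ = B.coface j hj x₂ →
        E.coface i (by omega) z₁ = E.coface j hj z₂ := by
      intro i j hij hj x₁ x₂ z₁ z₂ h₁ h₂ he
      obtain _ | n := n
      · obtain rfl : i = 0 := by omega
        obtain rfl : j = 1 := by omega
        exact absurd he (hB.coface_ne _ _)
      · obtain ⟨y, rfl, rfl⟩ := hB.diamond n i j hij hj _ _ he
        obtain ⟨w, hw⟩ := ExtensionGraph.exists (E := E) (φ := φ) (ψ := ψ) h n y
        rw [ih h₁ (.coface _ _ _ _ hw), ih h₂ (.coface _ _ _ _ hw)]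
        obtain ⟨j, rfl⟩ : ∃ k, j = k + 1 := ⟨j - 1, by omega⟩
        exact (E.coface_coface (by omega) (by omega) w).symm
    rcases key rfl hz hx with ⟨c, v, hv, he⟩ | ⟨i, hi, x₁, z₁, h₁, he⟩
    · rcases key rfl hz' hx with ⟨c', v', hv', he'⟩ | ⟨j, hj, x₂, z₂, h₂, he'⟩
      · cases he
        simp only [Sigma.mk.injEq, heq_eq_eq, true_and, Prod.mk.injEq] at he'
        cases h.injective _ _ _ _ hv' hv he'.1
        exact he'.2
      · simp only [Sigma.mk.injEq, heq_eq_eq, true_and, Prod.mk.injEq] at he'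
        exact hcell c v hv _ _ j hj x₂ he he'.1
    · simp only [Sigma.mk.injEq, heq_eq_eq, true_and, Prod.mk.injEq] at he
      rcases key rfl hz' hx with ⟨c', v', hv', he'⟩ | ⟨j, hj, x₂, z₂, h₂, he'⟩
      · exact (hcell c' v' hv' _ _ i hi x₁ he' he.1).symm
      · simp only [Sigma.mk.injEq, heq_eq_eq, true_and, Prod.mk.injEq] at he'
        obtain ⟨rfl, rfl⟩ := he
        obtain ⟨h3, rfl⟩ := he'
        rcases lt_trichotomy i j with hij | rfl | hij
        · exact hlt i j hij hj _ _ _ _ h₁ h₂ h3.symm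
        · obtain rfl := hB.injective _ _ _ h3
          rw [ih h₁ h₂]
        · exact (hlt j i hij hi _ _ _ _ h₂ h₁ h3).symm

/-- A map is continuous when it is so on the old part, on the cells, and on the degenerate
elements. -/
theorem IsCellAttachment.continuous_of [∀ n, CompactSpace (X n)] [∀ n, T2Space (X n)]
    [∀ n, CompactSpace (Y n)] [Finite C] (hBc : ∀ n i hi, Continuous (B.coface (n := n) i hi))
    (hι : ∀ n, Continuous (ι n))
    (h : IsCellAttachment B (fun n => Set.range (ι n)) N dim Φ) {θ : ∀ n, X n → Z n}
    (h1 : ∀ n, Continuous fun y => θ n (ι n y)) (h2 : ∀ c, Continuous fun v => θ N (Φ c v))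
    (h3 : ∀ n i (hi : i ≤ n + 1) x, θ (n + 1) (B.coface i hi x) = E.coface i hi (θ n x)) (n : ℕ) :
    Continuous (θ n) := by
  have hcell : ∀ (n : ℕ) (K : Set (Z n)), IsClosed K →
      IsClosed {x : X n | θ n x ∈ K ∧ ∃ c v, (⟨N, Φ c v⟩ : Σ n, X n) = ⟨n, x⟩} := by
    intro n K hK
    by_cases hn : N = n
    · subst hn
      have : {x : X N | θ N x ∈ K ∧ ∃ c v, (⟨N, Φ c v⟩ : Σ n, X n) = ⟨N, x⟩} =
          ⋃ c, Φ c '' ((fun v => θ N (Φ c v)) ⁻¹' K) := by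
        ext x
        simp only [Sigma.mk.injEq, heq_eq_eq, true_and, Set.mem_ofPred_eq, Set.mem_iUnion,
          Set.mem_image, Set.mem_preimage]
        constructor
        · rintro ⟨hx, c, v, rfl⟩
          exact ⟨c, v, hx, rfl⟩
        · rintro ⟨c, v, hx, rfl⟩
          exact ⟨hx, c, v, rfl⟩
      rw [this]
      exact isClosed_iUnion_of_finite fun c =>
        (h.continuous c).isClosedMap _ (hK.preimage (h2 c))
    · convert isClosed_empty
      ext x
      simp only [Set.mem_ofPred_eq, Set.mem_empty_iff_false, iff_false]
      rintro ⟨-, c, v, he⟩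
      exact hn (congrArg Sigma.fst he)
  have hbase : ∀ (n : ℕ) (K : Set (Z n)), IsClosed K →
      IsClosed (ι n '' ((fun y => θ n (ι n y)) ⁻¹' K)) := fun n K hK =>
    (hι n).isClosedMap _ (hK.preimage (h1 n))
  induction n with
  | zero =>
    refine continuous_iff_isClosed.2 fun K hK => ?_
    convert (hbase 0 K hK).union (hcell 0 K hK) using 1
    ext x
    constructor
    · intro hx
      rcases h.cover 0 x with ⟨y, rfl⟩ | hd | hc
      · exact Or.inl ⟨y, hx, rfl⟩
      · exact absurd hd.degree_pos (lt_irrefl _)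
      · exact Or.inr ⟨hx, hc⟩
    · rintro (⟨y, hy, rfl⟩ | hx)
      · exact hy
      · exact hx.1
  | succ n ih =>
    refine continuous_iff_isClosed.2 fun K hK => ?_
    have hdeg : IsClosed (⋃ i : Fin (n + 2), B.coface i.1 (by omega) ''
        ((fun x => E.coface i.1 (by omega) (θ n x)) ⁻¹' K)) :=
      isClosed_iUnion_of_finite fun i => (hBc n i.1 (by omega)).isClosedMap _
        (hK.preimage ((E.continuous_coface i.1 (by omega)).comp ih))
    convert ((hbase (n + 1) K hK).union (hcell (n + 1) K hK)).union hdeg using 1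
    ext x
    constructor
    · intro hx
      rcases h.cover (n + 1) x with ⟨y, rfl⟩ | hd | hc
      · exact Or.inl (Or.inl ⟨y, hx, rfl⟩)
      · obtain ⟨i, hi, y, rfl⟩ := hd.exists
        refine Or.inr (Set.mem_iUnion.2 ⟨⟨i, by omega⟩, y, ?_, rfl⟩)
        rw [Set.mem_preimage, h3] at hx
        exact hx
      · exact Or.inl (Or.inr ⟨hx, hc⟩)
    · rintro ((⟨y, hy, rfl⟩ | hx) | hx)
      · exact hy
      · exact hx.1
      · obtain ⟨i, y, hy, rfl⟩ := Set.mem_iUnion.1 hx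
        rw [Set.mem_preimage, h3]
        exact hy

/-- In a regular weak bimodule of compact Hausdorff spaces, a cell attachment is a free
attachment of cells: an extension of a morphism over the cells is forced on the degenerate
elements, and it is continuous because finitely many closed pieces cover each degree. -/
theorem IsCellAttachment.attachesCells [∀ n, CompactSpace (X n)] [∀ n, T2Space (X n)]
    [∀ n, CompactSpace (Y n)] [Finite C] (hB : IsRegular B)
    (hBc : ∀ n i hi, Continuous (B.coface (n := n) i hi)) (hι : IsWeakHom A B ι)
    (hinj : ∀ n, Function.Injective (ι n))
    (h : IsCellAttachment B (fun n => Set.range (ι n)) N dim Φ) : AttachesCells A B ι := by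
  refine ⟨hι, C, fun _ => N, dim, ?_⟩
  have hb : ∀ c (x : BdDisc (dim c)), ∃ y, ι N y = Φ c (bdIncl x) := fun c x =>
    h.boundary c (bdIncl x) (mem_sphere_zero_iff_norm.1 x.2)
  choose f hf using hb
  refine ⟨f, Φ, fun c => ?_, h.continuous, fun c x => (hf c x).symm, ?_⟩
  · have he : Topology.IsClosedEmbedding (ι N) := (hι.continuous N).isClosedEmbedding (hinj N)
    rw [he.isEmbedding.continuous_iff]
    have : ι N ∘ f c = fun x => Φ c (bdIncl x) := funext (hf c)
    rw [this]
    exact (h.continuous c).comp (continuous_subtype_val.subtype_mk _)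
  · intro Z _ E φ ψ hφ hψc hψ
    have hψ' : ∀ c (v : Disc (dim c)) y, ‖v.1‖ = 1 → Φ c v = ι N y → ψ c v = φ N y := by
      intro c v y hv hy
      have h1 := hψ c ⟨v.1, mem_sphere_zero_iff_norm.2 hv⟩
      have h2 := hf c ⟨v.1, mem_sphere_zero_iff_norm.2 hv⟩
      rw [show bdIncl (⟨v.1, mem_sphere_zero_iff_norm.2 hv⟩ : BdDisc (dim c)) = v from rfl]
        at h1 h2
      rw [h1, hinj _ (h2.trans hy)]
    have hun := fun n {x z z'} => ExtensionGraph.unique (x := x) (z := z) (z' := z') hB h hι hinj hφ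
      hψ' n
    choose θ hθ using fun n x => ExtensionGraph.exists (E := E) (φ := φ) (ψ := ψ) h n x
    have hθι : ∀ n y, θ n (ι n y) = φ n y := fun n y => hun n (hθ _ _) (.base n y)
    have hθΦ : ∀ c v, θ N (Φ c v) = ψ c v := fun c v => hun N (hθ _ _) (.cell c v)
    have hθc : ∀ n i (hi : i ≤ n + 1) x, θ (n + 1) (B.coface i hi x) = E.coface i hi (θ n x) :=
      fun n i hi x => hun _ (hθ _ _) (.coface i hi x _ (hθ n x))
    refine ⟨θ, ⟨IsWeakHom.of_coface hB.generated E.generatedByCofaces (fun n => ?_) hθc,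
      hθι, hθΦ⟩, ?_⟩
    · refine h.continuous_of hBc hι.continuous ?_ ?_ hθc n
      · intro n
        simp only [hθι]
        exact hφ.continuous n
      · intro c
        simp only [hθΦ]
        exact hψc c
    · rintro θ' ⟨h1, h2, h3⟩
      have : ∀ {n x z}, ExtensionGraph B E.toWeakOps ι φ N Φ ψ n x z → θ' n x = z := by
        intro n x z hz
        induction hz with
        | base n y => exact h2 n y
        | cell c v => exact h3 c v
        | coface i hi x z hz ih => rw [h1.map_coface, ih]
      funext n x
      exact this (hθ n x)

end Extension

/-! ### A criterion for cell filtrations -/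

/-- Degree by degree, a part with finitely many new cells is the union of compact pieces: the part
before, the cells, and the cofaces of elements of lower degree. -/
theorem isClosed_of_cover {X : ℕ → Type} [∀ n, TopologicalSpace (X n)] [∀ n, CompactSpace (X n)]
    [∀ n, T2Space (X n)] {B : WeakOps X} (hBc : ∀ n i hi, Continuous (B.coface (n := n) i hi))
    {S S' : ∀ n, Set (X n)} (hS : ∀ n, IsClosed (S n)) (hSS : ∀ n, S n ⊆ S' n) {N : ℕ} {C : Type}
    [Finite C] {dim : C → ℕ} {Φ : ∀ c, Disc (dim c) → X N} (hΦ : ∀ c, Continuous (Φ c))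
    (hΦS : ∀ c v, Φ c v ∈ S' N)
    (hc : ∀ n i (hi : i ≤ n + 1) x, B.coface i hi x ∈ S' (n + 1) ↔ x ∈ S' n)
    (cover : ∀ n, ∀ x ∈ S' n, x ∈ S n ∨ IsDegenerate B n x ∨
      ∃ c v, (⟨N, Φ c v⟩ : Σ n, X n) = ⟨n, x⟩) (n : ℕ) : IsClosed (S' n) := by
  have hcell : ∀ n, IsClosed {x : X n | ∃ c v, (⟨N, Φ c v⟩ : Σ n, X n) = ⟨n, x⟩} := by
    intro n
    by_cases hn : N = n
    · subst hn
      convert isClosed_iUnion_of_finite fun c => (isCompact_range (hΦ c)).isClosed using 1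
      ext x
      simp
    · convert isClosed_empty
      ext x
      simp only [Set.mem_ofPred_eq, Set.mem_empty_iff_false, iff_false]
      rintro ⟨c, v, he⟩
      exact hn (congrArg Sigma.fst he)
  have hsub : ∀ n (x : X n), (∃ c v, (⟨N, Φ c v⟩ : Σ n, X n) = ⟨n, x⟩) → x ∈ S' n := by
    rintro n x ⟨c, v, he⟩
    cases he
    exact hΦS c v
  induction n with
  | zero =>
    convert (hS 0).union (hcell 0) using 1
    ext x
    constructor
    · intro hx
      rcases cover 0 x hx with h | hd | h
      · exact Or.inl h
      · exact absurd hd.degree_pos (lt_irrefl _)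
      · exact Or.inr h
    · rintro (h | h)
      · exact hSS _ h
      · exact hsub _ _ h
  | succ n ih =>
    have hdeg : IsClosed (⋃ i : Fin (n + 2), B.coface i.1 (by omega) '' S' n) :=
      isClosed_iUnion_of_finite fun i => (hBc n i.1 (by omega)).isClosedMap _ ih
    convert ((hS (n + 1)).union (hcell (n + 1))).union hdeg using 1
    ext x
    constructor
    · intro hx
      rcases cover (n + 1) x hx with h | hd | h
      · exact Or.inl (Or.inl h)
      · obtain ⟨i, hi, y, rfl⟩ := hd.exists
        exact Or.inr (Set.mem_iUnion.2 ⟨⟨i, by omega⟩, y, (hc _ _ _ _).1 hx, rfl⟩)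
      · exact Or.inl (Or.inr h)
    · rintro ((h | h) | h)
      · exact hSS _ h
      · exact hsub _ _ h
      · obtain ⟨i, y, hy, rfl⟩ := Set.mem_iUnion.1 h
        exact (hc _ _ _ _).2 hy

theorem SubWeak.coface_mem {X : ℕ → Type u} {A : WeakOps X} (S : SubWeak A) {n : ℕ} (i : ℕ)
    (hi : i ≤ n + 1) {x : X n} (hx : x ∈ S.carrier n) : A.coface i hi x ∈ S.carrier (n + 1) := by
  simp only [WeakOps.coface]
  split_ifs
  · exact S.left_mem _ _ _ _ hx
  · exact S.left_mem _ _ _ _ hx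
  · exact S.right_mem _ _ _ _ _ _ hx

theorem SubWeak.coe_coface {X : ℕ → Type u} {A : WeakOps X} (S : SubWeak A) {n : ℕ} (i : ℕ)
    (hi : i ≤ n + 1) (x : S.carrier n) : (S.ops.coface i hi x).1 = A.coface i hi x.1 := by
  simp only [WeakOps.coface]
  split_ifs <;> rfl

/-- A sequence of subsets stable under the coface operators is a weak sub-bimodule. -/
def SubWeak.ofCoface {X : ℕ → Type u} {A : WeakOps X} (hA : A.GeneratedByCofaces)
    (S : ∀ n, Set (X n))
    (h : ∀ n i (hi : i ≤ n + 1) x, x ∈ S n → A.coface i hi x ∈ S (n + 1)) : SubWeak A where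
  carrier := S
  left_mem p q _ _ h' x hx := hA.left_induction (P := fun n x => x ∈ S n) h p q h' x hx
  right_mem p m q _ _ h₁ h₂ x hx := hA.right_induction (P := fun n x => x ∈ S n) h p m q h₁ h₂ x hx

section Criterion

variable {X : ℕ → Type} [∀ n, TopologicalSpace (X n)] {A : WeakBimodule X} {J : Type}
  [LinearOrder J] {F : J → SubWeak A.toWeakOps}

/-- The inclusion of the union of the preceding terms. -/
def belowIncl (hm : ∀ i j, i ≤ j → ∀ n, (F i).carrier n ⊆ (F j).carrier n) (j : J) (n : ℕ)
    (x : Below F j n) : (F j).carrier n :=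
  ⟨x.1, x.2.elim fun i hi => hm i j hi.1.le n hi.2⟩

/-- The inclusion of a preceding term into the union of the preceding terms. -/
def belowMk (F : J → SubWeak A.toWeakOps) {i j : J} (hi : i < j) (n : ℕ)
    (x : (F i).carrier n) : Below F j n :=
  ⟨x.1, i, hi, x.2⟩

theorem continuous_belowMk {i j : J} (hi : i < j) (n : ℕ) : Continuous (belowMk F hi n) := by
  rw [continuous_iff_coinduced_le]
  exact le_iSup (fun i : {i : J // i < j} => TopologicalSpace.coinduced
    (fun x : (F i.1).carrier n => (⟨x.1, i.1, i.2, x.2⟩ : Below F j n)) inferInstance) ⟨i, hi⟩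

theorem continuous_belowIncl (hm : ∀ i j, i ≤ j → ∀ n, (F i).carrier n ⊆ (F j).carrier n) (j : J)
    (n : ℕ) : Continuous (belowIncl hm j n) := by
  refine continuous_iSup_dom.2 fun i => continuous_coinduced_dom.2 ?_
  exact continuous_subtype_val.subtype_mk _

/-- When the preceding terms have a largest one, and this is compact, the colimit of the preceding
terms is compact. -/
theorem compactSpace_below (j : J) (n : ℕ)
    (hp : (∀ i, ¬ i < j) ∨ ∃ i₀, i₀ < j ∧ ∀ i, i < j → i ≤ i₀)
    (hm : ∀ i j, i ≤ j → ∀ n, (F i).carrier n ⊆ (F j).carrier n)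
    (hc : ∀ i, i < j → IsCompact ((F i).carrier n)) : CompactSpace (Below F j n) := by
  rcases hp with hp | ⟨i₀, hi₀, hp⟩
  · have : IsEmpty (Below F j n) := ⟨fun x => x.2.elim fun i hi => hp i hi.1⟩
    infer_instance
  · have : CompactSpace ((F i₀).carrier n) := isCompact_iff_compactSpace.1 (hc i₀ hi₀)
    have hsurj : Function.Surjective (belowMk F hi₀ n) := by
      rintro ⟨x, i, hi, hx⟩
      exact ⟨⟨x, hm i i₀ (hp i hi) n hx⟩, rfl⟩
    exact hsurj.compactSpace (continuous_belowMk hi₀ n)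

/-- A filtration of a regular weak bimodule of compact Hausdorff spaces by saturated parts is a cell
filtration if every term has only finitely many new cells, all in the same degree, and an immediate
predecessor unless it is the first one. -/
theorem isCellFiltration_of [∀ n, CompactSpace (X n)] [∀ n, T2Space (X n)]
    (hA : IsRegular A.toWeakOps) (wf : WellFounded ((· < ·) : J → J → Prop))
    (hm : ∀ i j, i ≤ j → ∀ n, (F i).carrier n ⊆ (F j).carrier n)
    (hp : ∀ j : J, (∀ i, ¬ i < j) ∨ ∃ i₀, i₀ < j ∧ ∀ i, i < j → i ≤ i₀)
    (sat : ∀ j n i (hi : i ≤ n + 1) x, A.coface i hi x ∈ (F j).carrier (n + 1) →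
      x ∈ (F j).carrier n)
    (N : J → ℕ) (C : J → Type) [∀ j, Finite (C j)] (dim : ∀ j, C j → ℕ)
    (Φ : ∀ j c, Disc (dim j c) → X (N j)) (continuous : ∀ j c, Continuous (Φ j c))
    (injective : ∀ j c c' (v : Disc (dim j c)) (v' : Disc (dim j c')), ‖v.1‖ < 1 → ‖v'.1‖ < 1 →
      Φ j c v = Φ j c' v' → (⟨c, v⟩ : Σ c, Disc (dim j c)) = ⟨c', v'⟩)
    (mem : ∀ j c v, Φ j c v ∈ (F j).carrier (N j))
    (nondegenerate : ∀ j c v, ‖v.1‖ < 1 → ¬ IsDegenerate A.toWeakOps (N j) (Φ j c v))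
    (notMem : ∀ j c v, ‖v.1‖ < 1 → ∀ i, i < j → Φ j c v ∉ (F i).carrier (N j))
    (boundary : ∀ j c v, ‖v.1‖ = 1 → ∃ i, i < j ∧ Φ j c v ∈ (F i).carrier (N j))
    (cover : ∀ j n x, x ∈ (F j).carrier n → ¬ IsDegenerate A.toWeakOps n x →
      (∃ i, i < j ∧ x ∈ (F i).carrier n) ∨ ∃ c v, (⟨N j, Φ j c v⟩ : Σ n, X n) = ⟨n, x⟩)
    (exhaust : ∀ n, ∃ j, ∀ x, x ∈ (F j).carrier n) :
    IsCellFiltration A.toWeakOps F := by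
  have hclosed : ∀ j n, IsClosed ((F j).carrier n) := by
    intro j
    induction j using wf.induction with
    | _ j ih =>
      refine isClosed_of_cover (B := A.toWeakOps)
        (S := fun n => {x | ∃ i, i < j ∧ x ∈ (F i).carrier n})
        (fun n i hi => A.continuous_coface i hi) ?_ ?_ (continuous j) (mem j)
        (fun n i hi x => ⟨sat j n i hi x, (F j).coface_mem i hi⟩) ?_
      · intro n
        rcases hp j with h | ⟨i₀, hi₀, h⟩
        · convert isClosed_empty
          ext x
          simp only [Set.mem_ofPred_eq, Set.mem_empty_iff_false, iff_false]
          rintro ⟨i, hi, -⟩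
          exact h i hi
        · convert ih i₀ hi₀ n
          ext x
          exact ⟨fun ⟨i, hi, hx⟩ => hm i i₀ (h i hi) n hx, fun hx => ⟨i₀, hi₀, hx⟩⟩
      · rintro n x ⟨i, hi, hx⟩
        exact hm i j hi.le n hx
      · intro n x hx
        by_cases hd : IsDegenerate A.toWeakOps n x
        · exact Or.inr (Or.inl hd)
        · exact (cover j n x hx hd).imp id Or.inr
  have hdeg : ∀ j n (x : (F j).carrier n), IsDegenerate (F j).ops n x ↔
      IsDegenerate A.toWeakOps n x.1 := by
    intro j n x
    obtain _ | n := n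
    · exact ⟨fun h => absurd h.degree_pos (lt_irrefl _), fun h => absurd h.degree_pos (lt_irrefl _)⟩
    constructor
    · intro h
      obtain ⟨i, hi, y, rfl⟩ := h.exists
      rw [(F j).coe_coface]
      exact .coface i hi _
    · intro h
      obtain ⟨i, hi, y, hy⟩ := h.exists
      have hx := x.2
      rw [← hy] at hx
      have : x = (F j).ops.coface i hi ⟨y, sat _ _ _ _ _ hx⟩ := by
        apply Subtype.ext
        rw [(F j).coe_coface, hy]
      rw [this]
      exact .coface i hi _
  have hcompact : ∀ j n, CompactSpace ((F j).carrier n) := fun j n =>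
    isCompact_iff_compactSpace.1 (hclosed j n).isCompact
  refine ⟨wf, hm, fun j => ?_, fun n x => (exhaust n).imp fun j hj => hj x, fun n U hU => ?_⟩
  · have : ∀ n, CompactSpace (Below F j n) := fun n =>
      compactSpace_below j n (hp j) hm fun i _ => (hclosed i n).isCompact
    have hreg : IsRegular (F j).ops := by
      refine hA.of_injective (f := fun n x => x.1) (fun n => Subtype.val_injective)
        (fun _ _ _ _ _ _ => rfl) (fun _ _ _ _ _ _ _ _ => rfl) ?_
      rintro n i hi y ⟨x, hx⟩
      have h1 : A.coface i hi y ∈ (F j).carrier (n + 1) := by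
        rw [← show x.1 = A.coface i hi y from hx]
        exact x.2
      exact ⟨⟨y, sat _ _ _ _ _ h1⟩, rfl⟩
    have hrange : ∀ n (x : (F j).carrier n), x ∈ Set.range (belowIncl hm j n) ↔
        ∃ i, i < j ∧ x.1 ∈ (F i).carrier n := by
      intro n x
      constructor
      · rintro ⟨y, rfl⟩
        exact y.2
      · intro h
        exact ⟨⟨x.1, h⟩, rfl⟩
    refine IsCellAttachment.attachesCells (ι := belowIncl hm j) (N := N j) (dim := dim j)
      (Φ := fun c v => ⟨Φ j c v, mem j c v⟩) hreg (fun n i hi => ?_)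
      ⟨continuous_belowIncl hm j, fun _ _ _ _ _ _ => rfl, fun _ _ _ _ _ _ _ _ => rfl⟩
      (fun n x y hxy => Subtype.ext (show x.1 = y.1 from
        congrArg (fun z : (F j).carrier n => z.1) hxy)) ?_
    · refine Topology.IsInducing.subtypeVal.continuous_iff.2 ?_
      have : Subtype.val ∘ (F j).ops.coface (n := n) i hi =
          A.coface i hi ∘ fun x : (F j).carrier n => x.1 := funext fun x => (F j).coe_coface i hi x
      rw [this]
      exact (A.continuous_coface i hi).comp continuous_subtype_val
    · refine ⟨fun c => (continuous j c).subtype_mk _, ?_, ?_, ?_, ?_, ?_, ?_⟩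
      · intro c c' v v' hv hv' h
        exact injective j c c' v v' hv hv' (congrArg Subtype.val h)
      · intro c v hv
        rw [hdeg]
        exact nondegenerate j c v hv
      · intro c v hv h
        obtain ⟨i, hi, hx⟩ := (hrange _ _).1 h
        exact notMem j c v hv i hi hx
      · intro c v hv
        exact (hrange _ _).2 (boundary j c v hv)
      · intro n x
        rw [hrange, hdeg]
        by_cases hd : IsDegenerate A.toWeakOps n x.1
        · exact Or.inr (Or.inl hd)
        · rcases cover j n x.1 x.2 hd with h | ⟨c, v, h⟩
          · exact Or.inl h
          · obtain ⟨x, hx⟩ := x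
            refine Or.inr (Or.inr ⟨c, v, ?_⟩)
            cases h
            rfl
      · intro n i hi x h
        obtain ⟨l, hl, hx⟩ := (hrange _ _).1 h
        rw [(F j).coe_coface] at hx
        exact (hrange _ _).2 ⟨l, hl, sat _ _ _ _ _ hx⟩
  · obtain ⟨j, hj⟩ := exhaust n
    have h1 := hU j
    have h2 : U = (fun x => (⟨x, hj x⟩ : (F j).carrier n)) ⁻¹' {x | x.1 ∈ U} := rfl
    rw [h2]
    exact h1.preimage (continuous_id.subtype_mk _)

end Criterion

/-! ### Convex bodies and discs, the topology of the simplices -/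

/-- A bounded convex set with nonempty interior has a closed disc as its closure, and an open disc
as its interior. -/
theorem exists_disc_homeomorph_closure {κ : Type} [Fintype κ] {s : Set (κ → ℝ)} (hc : Convex ℝ s)
    (hne : (interior s).Nonempty) (hb : Bornology.IsBounded s) {d : ℕ} (hd : Fintype.card κ = d) :
    ∃ e : Disc d ≃ₜ closure s, ∀ v, ‖v.1‖ < 1 ↔ (e v).1 ∈ interior s := by
  let L : (κ → ℝ) ≃L[ℝ] EuclideanSpace ℝ (Fin d) :=
    ContinuousLinearEquiv.ofFinrankEq (by simp [hd])
  let H := L.toHomeomorph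
  have hcl : ∀ t, H '' closure t = closure (L '' t) := fun t => H.image_closure t
  have hin : ∀ t, H '' interior t = interior (L '' t) := fun t => H.image_interior t
  have hc' : Convex ℝ (L '' s) := hc.linear_image L.toLinearMap
  have hne' : (interior (L '' s)).Nonempty := by rw [← hin]; exact hne.image _
  have hb' : Bornology.IsBounded (L '' s) := L.lipschitz.isBounded_image hb
  obtain ⟨h, h1, h2, -⟩ :=
    exists_homeomorph_image_interior_closure_frontier_eq_unitBall hc' hne' hb'
  have h3 : (H.trans h) '' closure s = Metric.closedBall 0 1 := by
    rw [← h2, ← hcl, ← Set.image_comp]; rfl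
  have h4 : (H.trans h) '' interior s = Metric.ball 0 1 := by
    rw [← h1, ← hin, ← Set.image_comp]; rfl
  refine ⟨(((H.trans h).image (closure s)).trans (Homeomorph.setCongr h3)).symm, fun v => ?_⟩
  obtain ⟨x, rfl⟩ := (((H.trans h).image (closure s)).trans (Homeomorph.setCongr h3)).surjective v
  rw [Homeomorph.symm_apply_apply, ← mem_ball_zero_iff, ← h4]
  exact (H.trans h).injective.mem_set_image

theorem tri_homeomorph_disc (n : ℕ) : Nonempty (Tri n ≃ₜ Disc n) := by
  let K : Set (Fin n → ℝ) := {x | Monotone x ∧ ∀ i, x i ∈ Set.Icc (0 : ℝ) 1}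
  have hconv : Convex ℝ K := by
    rintro x ⟨hx, hx'⟩ y ⟨hy, hy'⟩ a b ha hb hab
    refine ⟨fun i j hij => ?_, fun i => ?_⟩
    · exact add_le_add (mul_le_mul_of_nonneg_left (hx hij) ha)
        (mul_le_mul_of_nonneg_left (hy hij) hb)
    · exact convex_Icc (0 : ℝ) 1 (hx' i) (hy' i) ha hb hab
  have hclosed : IsClosed K := by
    have h1 : IsClosed {x : Fin n → ℝ | Monotone x} := isClosed_monotone
    have h2 : IsClosed {x : Fin n → ℝ | ∀ i, x i ∈ Set.Icc (0 : ℝ) 1} := by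
      simp only [Set.ofPred_forall]
      exact isClosed_iInter fun i => isClosed_Icc.preimage (continuous_apply i)
    exact h1.inter h2
  have hbdd : Bornology.IsBounded K := by
    refine (Metric.isBounded_Icc (0 : Fin n → ℝ) 1).subset ?_
    rintro x ⟨-, hx⟩
    exact ⟨fun i => (hx i).1, fun i => (hx i).2⟩
  have hne : (interior K).Nonempty := by
    let U : Set (Fin n → ℝ) := {x | (∀ i, x i ∈ Set.Ioo (0 : ℝ) 1) ∧ ∀ i j, i < j → x i < x j}
    have hU : IsOpen U := by
      have h1 : IsOpen {x : Fin n → ℝ | ∀ i, x i ∈ Set.Ioo (0 : ℝ) 1} := by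
        simp only [Set.ofPred_forall]
        exact isOpen_iInter_of_finite fun i => isOpen_Ioo.preimage (continuous_apply i)
      have h2 : IsOpen {x : Fin n → ℝ | ∀ i j, i < j → x i < x j} := by
        simp only [Set.ofPred_forall]
        exact isOpen_iInter_of_finite fun i => isOpen_iInter_of_finite fun j =>
          isOpen_iInter_of_finite fun _ => isOpen_lt (continuous_apply i) (continuous_apply j)
      exact h1.inter h2
    have hUK : U ⊆ K := fun x hx =>
      ⟨(show StrictMono x from fun i j hij => hx.2 i j hij).monotone, fun i => ⟨(hx.1 i).1.le, (hx.1 i).2.le⟩⟩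
    refine Set.Nonempty.mono (interior_maximal hUK hU) ⟨fun i => (i.1 + 1) / (n + 1), fun i => ?_,
      fun i j hij => ?_⟩
    · have h2 : (i.1 : ℝ) + 1 < n + 1 := by exact_mod_cast Nat.succ_lt_succ i.2
      exact ⟨by positivity, (div_lt_one (by positivity)).2 h2⟩
    · have h2 : (i.1 : ℝ) + 1 < j.1 + 1 := by exact_mod_cast Nat.succ_lt_succ hij
      exact div_lt_div_of_pos_right h2 (by positivity)
  obtain ⟨e, -⟩ := exists_disc_homeomorph_closure hconv hne hbdd (d := n) (by simp)
  let f : Tri n ≃ₜ K :=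
    { toFun t := ⟨fun i => (t.1 i : ℝ), fun i j hij => t.2 hij, fun i => (t.1 i).2⟩
      invFun x := ⟨fun i => ⟨x.1 i, x.2.2 i⟩, fun i j hij => x.2.1 hij⟩
      left_inv _ := rfl
      right_inv _ := rfl
      continuous_toFun := (continuous_pi fun i => continuous_subtype_val.comp
        ((continuous_apply i).comp continuous_subtype_val)).subtype_mk _
      continuous_invFun := (continuous_pi fun i =>
        ((continuous_apply i).comp continuous_subtype_val).subtype_mk _).subtype_mk _ }
  exact ⟨(f.trans (Homeomorph.setCongr hclosed.closure_eq.symm)).trans e.symm⟩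

theorem contractibleSpace_tri (n : ℕ) : ContractibleSpace (Tri n) := by
  obtain ⟨e⟩ := tri_homeomorph_disc n
  have : ContractibleSpace (Disc n) :=
    (convex_closedBall (0 : EuclideanSpace ℝ (Fin n)) 1).contractibleSpace
      ⟨0, Metric.mem_closedBall_self zero_le_one⟩
  exact e.contractibleSpace

/-! ### Coordinates on the prisms -/

/-- The coordinates of the points of `λ ⊗ χ` in degree `n`: the distances `d` between consecutive
leaves and the parameters `t` of the leaves, both continued by `1`. Leaves with different parameters
lie on different beads, so their distance is `1`. -/
structure IsConfig (n : ℕ) (d t : ℕ → unitInterval) : Prop where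
  mono : Monotone t
  split : ∀ j, d j = 1 ∨ t j = t (j + 1)
  t_top : ∀ j, n ≤ j → t j = 1
  d_top : ∀ j, n ≤ j + 1 → d j = 1

theorem gapAt_of_le {n : ℕ} (d : Fin (n - 1) → unitInterval) {j : ℕ} (h : n ≤ j + 1) :
    gapAt d j = 1 := by
  rw [gapAt, dif_neg (by omega)]

theorem gapAt_injective {n : ℕ} {d d' : Fin (n - 1) → unitInterval}
    (h : ∀ j, gapAt d j = gapAt d' j) : d = d' := by
  funext j
  have := h j.1
  simpa [gapAt] using this

theorem locate_unique {k r : ℕ} (ns : Fin k → ℕ) (h : ∑ i, ns i = r) {j : Fin r} {b : Fin k}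
    {o : ℕ} (ho : o < ns b) (hj : j.1 = sizeBefore ns b.1 + o) : locate ns h j = ⟨b, o, ho⟩ := by
  obtain ⟨j', hj'⟩ := locate_surjective ns h ⟨b, o, ho⟩
  have := locate_val ns h j'
  rw [hj'] at this
  have : j = j' := Fin.ext (by rw [this, hj])
  rw [this, hj']

theorem bead_monotone {n : ℕ} (T : Composition n) : Monotone (bead T) := by
  intro i j hij
  rcases hij.eq_or_lt with rfl | h
  · exact le_rfl
  · rcases locate_lt T.blocksFun T.sum_blocksFun h with h | h
    · exact le_of_lt h
    · exact h.1.le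

/-- Consecutive leaves lie on different beads exactly when the second one is the first leaf of its
bead. -/
theorem bead_ne_iff {n : ℕ} (T : Composition n) {j : ℕ} (hj : j + 1 < n) :
    bead T ⟨j, by omega⟩ ≠ bead T ⟨j + 1, hj⟩ ↔ ∃ b : Fin T.length,
      sizeBefore T.blocksFun b.1 = j + 1 := by
  have h1 := locate_val T.blocksFun T.sum_blocksFun ⟨j, by omega⟩
  have h2 := locate_val T.blocksFun T.sum_blocksFun ⟨j + 1, hj⟩
  have h3 := (locate T.blocksFun T.sum_blocksFun ⟨j, by omega⟩).2.2
  have h4 := sizeBefore_succ T.blocksFun (bead T ⟨j, by omega⟩)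
  change j = sizeBefore T.blocksFun (bead T ⟨j, by omega⟩).1 + _ at h1
  change j + 1 = sizeBefore T.blocksFun (bead T ⟨j + 1, hj⟩).1 + _ at h2
  change _ < T.blocksFun (bead T ⟨j, by omega⟩) at h3
  constructor
  · intro hne
    refine ⟨bead T ⟨j + 1, hj⟩, ?_⟩
    have hlt : (bead T ⟨j, by omega⟩).1 < (bead T ⟨j + 1, hj⟩).1 :=
      lt_of_le_of_ne (bead_monotone T (by simp)) (fun h => hne (Fin.ext h))
    have := sizeBefore_mono T.blocksFun (Nat.succ_le_of_lt hlt)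
    simp only [Nat.succ_eq_add_one] at this
    omega
  · rintro ⟨b, hb⟩ he
    have hb0 : 0 < T.blocksFun b := T.blocks_pos' _ _
    have h5 : locate T.blocksFun T.sum_blocksFun ⟨j + 1, hj⟩ = ⟨b, 0, hb0⟩ :=
      locate_unique _ _ hb0 hb.symm
    have h6 : bead T ⟨j + 1, hj⟩ = b := congrArg Sigma.fst h5
    rw [he, h6] at h1
    omega

theorem sizeBefore_blocksFun {n : ℕ} (T : Composition n) (i : ℕ) (hi : i ≤ T.length) :
    sizeBefore T.blocksFun i = T.sizeUpTo i := by
  induction i with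
  | zero => simp [sizeBefore]
  | succ i ih =>
    rw [sizeBefore_succ T.blocksFun ⟨i, hi⟩, ih (by omega), T.sizeUpTo_succ hi]
    rfl

/-- There is a composition with prescribed boundaries between the blocks. -/
theorem exists_composition (n : ℕ) (r : ℕ → Prop) : ∃ T : Composition n, ∀ j (hj : j + 1 < n),
    bead T ⟨j, by omega⟩ ≠ bead T ⟨j + 1, hj⟩ ↔ r j := by
  classical
  let S : CompositionAsSet n :=
    { boundaries := Finset.univ.filter fun i => i.1 = 0 ∨ i.1 = n ∨ r (i.1 - 1)
      zero_mem := by simp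
      getLast_mem := by simp }
  refine ⟨S.toComposition, fun j hj => ?_⟩
  rw [bead_ne_iff]
  have hS : S.toComposition.boundaries = S.boundaries := S.toComposition_boundaries
  have h1 : (⟨j + 1, by omega⟩ : Fin (n + 1)) ∈ S.boundaries ↔ r j := by
    simp only [S, Finset.mem_filter, Finset.mem_univ, true_and]
    constructor
    · rintro (h | h | h)
      · omega
      · omega
      · exact h
    · exact fun h => Or.inr (Or.inr h)
  rw [← h1, ← hS]
  simp only [Composition.boundaries, Finset.mem_map, Finset.mem_univ, true_and]
  constructor
  · rintro ⟨b, hb⟩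
    rw [sizeBefore_blocksFun _ _ b.2.le] at hb
    exact ⟨b.castSucc, Fin.ext hb⟩
  · rintro ⟨b, hb⟩
    have hb' : S.toComposition.sizeUpTo b.1 = j + 1 := congrArg Fin.val hb
    have hlt : b.1 < S.toComposition.length := by
      by_contra hge
      have : b.1 = S.toComposition.length := by have := b.2; omega
      rw [this, Composition.sizeUpTo_length] at hb'
      omega
    refine ⟨⟨b.1, hlt⟩, ?_⟩
    rw [sizeBefore_blocksFun _ _ hlt.le]
    exact hb'

theorem gapAt_gaps {n : ℕ} (P : Prisms n) (j : Fin n) : gapAt (gaps P) j.1 =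
    gapAt (P.2.1 (bead P.1 j)).1 (locate P.1.blocksFun P.1.sum_blocksFun j).2.1 :=
  gapAt_joinCoord _ _ _ _

/-- The coordinates of a point of a prism. -/
theorem isConfig_prism {n : ℕ} (P : Prisms n) : IsConfig n (gapAt (gaps P)) (seqAt (times P)) where
  mono := seqAt_monotone fun _ _ h => P.2.2.2 (bead_monotone P.1 h)
  split j := by
    rcases Nat.lt_or_ge (j + 1) n with hj | hj
    · by_cases hb : bead P.1 ⟨j, by omega⟩ = bead P.1 ⟨j + 1, hj⟩
      · right
        rw [seqAt, dif_pos (by omega), seqAt, dif_pos hj, times, times, hb]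
      · left
        obtain ⟨b, hb'⟩ := (bead_ne_iff P.1 hj).1 hb
        have h1 := gapAt_gaps P ⟨j, by omega⟩
        simp only at h1
        rw [h1]
        refine gapAt_of_le _ ?_
        have h1 := locate_val P.1.blocksFun P.1.sum_blocksFun ⟨j, by omega⟩
        have h4 := sizeBefore_succ P.1.blocksFun (bead P.1 ⟨j, by omega⟩)
        change j = sizeBefore P.1.blocksFun (bead P.1 ⟨j, by omega⟩).1 + _ at h1
        by_contra hlt
        have h5 : (bead P.1 ⟨j, by omega⟩).1 < b.1 := by
          by_contra hle
          have := sizeBefore_mono P.1.blocksFun (Nat.le_of_not_lt hle)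
          omega
        have := sizeBefore_mono P.1.blocksFun (Nat.succ_le_of_lt h5)
        simp only [Nat.succ_eq_add_one] at this
        omega
    · exact Or.inl (gapAt_of_le _ hj)
  t_top j hj := seqAt_of_le _ hj
  d_top j hj := gapAt_of_le _ hj

/-- The point with coordinates `d` and `t` in the prism of the tree `T`. -/
def prismOf {n : ℕ} (T : Composition n) (d t : ℕ → unitInterval) (ht : Monotone t) : Prisms n :=
  ⟨T, fun b => ⟨fun j => d (sizeBefore T.blocksFun b.1 + j.1), T.blocks_pos' _ _⟩,
    fun b => t (sizeBefore T.blocksFun b.1), fun _ _ h => ht (sizeBefore_mono _ h)⟩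

theorem seqAt_times_prismOf {n : ℕ} (T : Composition n) {d t : ℕ → unitInterval}
    (h : IsConfig n d t) (hT : ∀ i j : Fin n, bead T i = bead T j → t i.1 = t j.1) (j : ℕ) :
    seqAt (times (prismOf T d t h.mono)) j = t j := by
  rcases Nat.lt_or_ge j n with hj | hj
  · rw [seqAt, dif_pos hj]
    have h0 : 0 < T.blocksFun (bead T ⟨j, hj⟩) := T.blocks_pos' _ _
    obtain ⟨i, hi⟩ := locate_surjective T.blocksFun T.sum_blocksFun ⟨bead T ⟨j, hj⟩, 0, h0⟩
    have h1 := locate_val T.blocksFun T.sum_blocksFun i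
    have h2 : bead T i = bead T ⟨j, hj⟩ := by rw [bead, hi]
    have h3 := hT _ _ h2
    rw [hi] at h1
    simp only [add_zero] at h1
    rw [h1] at h3
    exact h3
  · rw [seqAt_of_le _ hj, h.t_top _ hj]

theorem gapAt_gaps_prismOf {n : ℕ} (T : Composition n) {d t : ℕ → unitInterval}
    (h : IsConfig n d t) (hT : ∀ j (hj : j + 1 < n), bead T ⟨j, by omega⟩ ≠ bead T ⟨j + 1, hj⟩ →
      d j = 1) (j : ℕ) : gapAt (gaps (prismOf T d t h.mono)) j = d j := by
  rcases Nat.lt_or_ge (j + 1) n with hj | hj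
  · have hj' : j < n := by omega
    rw [gapAt_gaps _ ⟨j, hj'⟩]
    have h1 : j = sizeBefore T.blocksFun (bead T ⟨j, hj'⟩).1 +
      (locate T.blocksFun T.sum_blocksFun ⟨j, hj'⟩).2.1 :=
        locate_val T.blocksFun T.sum_blocksFun ⟨j, hj'⟩
    rw [gapAt]
    split_ifs with h2
    · exact congrArg d h1.symm
    · refine (hT j hj fun he => ?_).symm
      have h3 : j + 1 = sizeBefore T.blocksFun (bead T ⟨j + 1, hj⟩).1 +
        (locate T.blocksFun T.sum_blocksFun ⟨j + 1, hj⟩).2.1 :=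
          locate_val T.blocksFun T.sum_blocksFun ⟨j + 1, hj⟩
      have h4 : (locate T.blocksFun T.sum_blocksFun ⟨j + 1, hj⟩).2.1 <
        T.blocksFun (bead T ⟨j + 1, hj⟩) := (locate T.blocksFun T.sum_blocksFun ⟨j + 1, hj⟩).2.2
      have h5 : ¬ (locate T.blocksFun T.sum_blocksFun ⟨j, hj'⟩).2.1 <
        T.blocksFun (bead T ⟨j, hj'⟩) - 1 := h2
      rw [← he] at h3 h4
      omega
  · rw [gapAt_of_le _ hj, h.d_top _ hj]

/-- The coarsest tree that admits the parameters `t`: its beads are the level sets of `t`. -/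
theorem exists_level_composition {n : ℕ} {t : ℕ → unitInterval} (ht : Monotone t) :
    ∃ T : Composition n, (∀ i j : Fin n, bead T i = bead T j ↔ t i.1 = t j.1) ∧
      ∀ j (hj : j + 1 < n), bead T ⟨j, by omega⟩ ≠ bead T ⟨j + 1, hj⟩ → t j ≠ t (j + 1) := by
  obtain ⟨T, hT⟩ := exists_composition n fun j => t j ≠ t (j + 1)
  have key : ∀ (k i : ℕ) (h : i + k < n), bead T ⟨i, by omega⟩ = bead T ⟨i + k, h⟩ ↔
      t i = t (i + k) := by
    intro k i h
    induction k with
    | zero => simp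
    | succ k ih =>
      have h1 := ih (by omega)
      have h2 := not_iff_not.1 (hT (i + k) h)
      have h3 : bead T ⟨i, by omega⟩ ≤ bead T ⟨i + k, by omega⟩ := bead_monotone T (by simp)
      have h4 : bead T ⟨i + k, by omega⟩ ≤ bead T ⟨i + k + 1, h⟩ := bead_monotone T (by simp)
      have h5 : t i ≤ t (i + k) := ht (by omega)
      have h6 : t (i + k) ≤ t (i + k + 1) := ht (by omega)
      constructor
      · intro he
        have h7 : bead T ⟨i + k, by omega⟩ = bead T ⟨i, by omega⟩ :=
          le_antisymm (h4.trans he.symm.le) h3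
        rw [h1.1 h7.symm]
        exact h2.1 (h7.trans he)
      · intro he
        have h7 : t (i + k) = t i := le_antisymm (h6.trans he.symm.le) h5
        rw [h1.2 h7.symm]
        exact h2.2 (h7.trans he)
  refine ⟨T, fun i j => ?_, fun j hj h => (hT j hj).1 h⟩
  rcases le_total i j with h | h
  · have := key (j.1 - i.1) i.1 (by omega)
    simpa [Nat.add_sub_cancel' (show i.1 ≤ j.1 from h)] using this
  · have := key (i.1 - j.1) j.1 (by omega)
    rw [eq_comm, eq_comm (a := t i.1)]
    simpa [Nat.add_sub_cancel' (show j.1 ≤ i.1 from h)] using this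

/-- Every configuration comes from a prism, that of its coarsest tree. -/
theorem IsConfig.exists_prism {n : ℕ} {d t : ℕ → unitInterval} (h : IsConfig n d t) :
    ∃ P : Prisms n, (∀ j, gapAt (gaps P) j = d j) ∧ ∀ j, seqAt (times P) j = t j := by
  obtain ⟨T, h1, h2⟩ := exists_level_composition (n := n) h.mono
  exact ⟨prismOf T d t h.mono,
    gapAt_gaps_prismOf T h fun j hj hb => (h.split j).resolve_right (h2 j hj hb),
    seqAt_times_prismOf T h fun i j => (h1 i j).1⟩

/-! ### Stretching the distances into the simplex -/

/-- The factor by which the distances `d_i` before the leaf `j` stretch `1 - t_j`. -/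
noncomputable def stretchFactor (d t : ℕ → unitInterval) (j : ℕ) : ℝ :=
  ∏ i ∈ Finset.range j, (1 - d i * t i / 2)

theorem stretchFactor_succ (d t : ℕ → unitInterval) (j : ℕ) :
    stretchFactor d t (j + 1) = stretchFactor d t j * (1 - d j * t j / 2) :=
  Finset.prod_range_succ _ _

theorem one_sub_mul_div_two_pos (x y : unitInterval) : (0 : ℝ) < 1 - x * y / 2 := by
  have := mul_le_one₀ x.2.2 y.2.1 y.2.2
  linarith

theorem one_sub_mul_div_two_le_one (x y : unitInterval) : (1 : ℝ) - x * y / 2 ≤ 1 := by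
  have := mul_nonneg x.2.1 y.2.1
  linarith

theorem stretchFactor_pos (d t : ℕ → unitInterval) (j : ℕ) : 0 < stretchFactor d t j :=
  Finset.prod_pos fun _ _ => one_sub_mul_div_two_pos _ _

theorem stretchFactor_le_one (d t : ℕ → unitInterval) (j : ℕ) : stretchFactor d t j ≤ 1 :=
  Finset.prod_le_one (fun _ _ => (one_sub_mul_div_two_pos _ _).le) fun _ _ =>
    one_sub_mul_div_two_le_one _ _

/-- The `j`-th coordinate of the point of the simplex with coordinates `d` and `t` in a prism:
`1 - (1 - t_j) ∏_{i < j} (1 - d_i t_i / 2)`. A distance `d_i` has no effect when `t_i = 0`, and none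
when `t_i = 1`, since then `t_j = 1` for all `j > i`; and consecutive coordinates agree
when the leaves have the same parameter and distance `0`. -/
noncomputable def stretch (d t : ℕ → unitInterval) (j : ℕ) : unitInterval :=
  ⟨1 - (1 - t j) * stretchFactor d t j, by
    have h1 := (stretchFactor_pos d t j).le
    have h2 := stretchFactor_le_one d t j
    have h3 : (0 : ℝ) ≤ 1 - t j := sub_nonneg.2 (t j).2.2
    have h4 : (1 : ℝ) - t j ≤ 1 := by linarith [(t j).2.1]
    have h5 := mul_le_one₀ h4 h1 h2
    have h6 := mul_nonneg h3 h1
    constructor <;> linarith⟩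

theorem stretch_eq (d t : ℕ → unitInterval) (j : ℕ) :
    (1 : ℝ) - stretch d t j = (1 - t j) * stretchFactor d t j := by
  simp [stretch]

theorem stretch_monotone (d : ℕ → unitInterval) {t : ℕ → unitInterval} (ht : Monotone t) :
    Monotone (stretch d t) := by
  refine monotone_nat_of_le_succ fun j => ?_
  change (stretch d t j : ℝ) ≤ stretch d t (j + 1)
  have h1 := stretch_eq d t j
  have h2 := stretch_eq d t (j + 1)
  rw [stretchFactor_succ] at h2
  have h3 : (t j : ℝ) ≤ t (j + 1) := ht (Nat.le_succ j)
  have h4 := stretchFactor_pos d t j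
  have h5 : stretchFactor d t j * (1 - d j * t j / 2) ≤ stretchFactor d t j :=
    mul_le_of_le_one_right h4.le (one_sub_mul_div_two_le_one _ _)
  have h6 : (1 - (t (j + 1) : ℝ)) * (stretchFactor d t j * (1 - d j * t j / 2)) ≤
      (1 - t j) * stretchFactor d t j :=
    mul_le_mul (by linarith) h5 (mul_nonneg h4.le (one_sub_mul_div_two_pos _ _).le)
      (sub_nonneg.2 (t j).2.2)
  linarith

theorem stretch_eq_one {d t : ℕ → unitInterval} {j : ℕ} (h : t j = 1) : stretch d t j = 1 := by
  apply Subtype.ext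
  simp [stretch, h]

theorem stretch_congr {d d' t : ℕ → unitInterval} (ht : Monotone t)
    (h : ∀ i, d i = d' i ∨ t i = 0 ∨ t i = 1) (j : ℕ) : stretch d t j = stretch d' t j := by
  by_cases h1 : t j = 1
  · rw [stretch_eq_one h1, stretch_eq_one h1]
  · apply Subtype.ext
    simp only [stretch, stretchFactor]
    congr 2
    refine Finset.prod_congr rfl fun i hi => ?_
    rcases h i with h | h | h
    · rw [h]
    · simp [h]
    · exact absurd (le_antisymm (show t j ≤ 1 from (t j).2.2)
        (h ▸ ht (Finset.mem_range.1 hi).le)) h1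

/-- The step from the leaf `j` to the leaf `j + 1` can be read off from the stretched
coordinates. -/
theorem stretch_step_unique {a b b' d d' : ℝ} (ha : 0 ≤ a) (ha1 : a < 1) (hb : a ≤ b) (hb' : a ≤ b')
    (hd : d ∈ Set.Icc (0 : ℝ) 1) (hd' : d' ∈ Set.Icc (0 : ℝ) 1) (h : d = 1 ∨ a = b)
    (h' : d' = 1 ∨ a = b') (he : (1 - b) * (1 - d * a / 2) = (1 - b') * (1 - d' * a / 2)) :
    b = b' ∧ d * a = d' * a := by
  have key : ∀ {b d : ℝ}, a ≤ b → d ∈ Set.Icc (0 : ℝ) 1 →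
      (1 - b) * (1 - 1 * a / 2) = (1 - a) * (1 - d * a / 2) → b = a ∧ 1 * a = d * a := by
    intro b d hb hd he
    have h1 : 0 ≤ (b - a) * (1 - a / 2) := mul_nonneg (by linarith) (by linarith)
    have h2 : 0 ≤ (1 - a) * ((1 - d) * a) :=
      mul_nonneg (by linarith) (mul_nonneg (by linarith [hd.2]) ha)
    have h3 : (b - a) * (1 - a / 2) = 0 := by nlinarith
    have h4 : (1 - a) * ((1 - d) * a) = 0 := by nlinarith
    constructor
    · rcases mul_eq_zero.1 h3 with h | h <;> linarith
    · rcases mul_eq_zero.1 h4 with h | h <;> linarith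
  rcases h with rfl | rfl
  · rcases h' with rfl | rfl
    · refine ⟨?_, rfl⟩
      have := mul_right_cancel₀ (by linarith : (1 - 1 * a / 2) ≠ 0) he
      linarith
    · exact key hb hd' he
  · rcases h' with rfl | rfl
    · obtain ⟨h1, h2⟩ := key hb' hd he.symm
      exact ⟨h1.symm, h2.symm⟩
    · refine ⟨rfl, ?_⟩
      have := mul_left_cancel₀ (by linarith : (1 - a) ≠ 0) he
      linarith

/-- The stretched coordinates determine the parameters, and the distances between leaves
with parameters different from `0` and `1`. -/
theorem IsConfig.eq_of_stretch_eq {n : ℕ} {d d' t t' : ℕ → unitInterval} (h : IsConfig n d t)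
    (h' : IsConfig n d' t') (he : ∀ j, stretch d t j = stretch d' t' j) :
    t = t' ∧ ∀ j, d j = d' j ∨ t j = 0 ∨ t j = 1 := by
  have he' : ∀ j, (1 - t j : ℝ) * stretchFactor d t j = (1 - t' j) * stretchFactor d' t' j := by
    intro j
    rw [← stretch_eq, ← stretch_eq, he]
  have step : ∀ j, t j = t' j → stretchFactor d t j = stretchFactor d' t' j → t j ≠ 1 →
      t (j + 1) = t' (j + 1) ∧ (d j * t j : ℝ) = d' j * t j := by
    intro j h1 h2 h3
    have h4 : (t j : ℝ) < 1 := lt_of_le_of_ne (t j).2.2 fun h => h3 (Subtype.ext h)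
    have h5 := he' (j + 1)
    rw [stretchFactor_succ, stretchFactor_succ, ← h2, ← h1] at h5
    have h6 : (1 - (t (j + 1) : ℝ)) * (1 - d j * t j / 2) =
        (1 - t' (j + 1)) * (1 - d' j * t j / 2) := by
      have := (stretchFactor_pos d t j).ne'
      apply mul_left_cancel₀ this
      linarith
    obtain ⟨h7, h8⟩ := stretch_step_unique (t j).2.1 h4 (h.mono (Nat.le_succ j))
      (by rw [h1]; exact h'.mono (Nat.le_succ j)) (d j).2 (d' j).2
      ((h.split j).imp (congrArg Subtype.val) (congrArg Subtype.val))
      ((h'.split j).imp (congrArg Subtype.val) (fun h => by rw [h1, h])) h6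
    exact ⟨Subtype.ext h7, h8⟩
  have key : ∀ j, t j = t' j ∧ (t j = 1 ∨ stretchFactor d t j = stretchFactor d' t' j) := by
    intro j
    induction j with
    | zero =>
      refine ⟨Subtype.ext ?_, Or.inr (by simp [stretchFactor])⟩
      have := he' 0
      simp only [stretchFactor, Finset.range_zero, Finset.prod_empty, mul_one] at this
      linarith
    | succ j ih =>
      obtain ⟨h1, h2⟩ := ih
      by_cases h3 : t j = 1
      · have h4 : t (j + 1) = 1 :=
          le_antisymm (unitInterval.le_one _) (h3 ▸ h.mono (Nat.le_succ j))
        have h5 : t' (j + 1) = 1 :=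
          le_antisymm (unitInterval.le_one _) (h3 ▸ h1 ▸ h'.mono (Nat.le_succ j))
        exact ⟨h4.trans h5.symm, Or.inl h4⟩
      · have h2 := h2.resolve_left h3
        obtain ⟨h4, h5⟩ := step j h1 h2 h3
        exact ⟨h4, Or.inr (by rw [stretchFactor_succ, stretchFactor_succ, h2, h5, h1])⟩
  refine ⟨funext fun j => (key j).1, fun j => ?_⟩
  by_cases h3 : t j = 1
  · exact Or.inr (Or.inr h3)
  · have := (step j (key j).1 ((key j).2.resolve_left h3) h3).2
    by_cases h0 : t j = 0
    · exact Or.inr (Or.inl h0)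
    · refine Or.inl (Subtype.ext (mul_right_cancel₀ (fun h => h0 (Subtype.ext h)) this))

/-- One step of the inversion of `stretch`: the distance increases up to `1` before the
parameter moves. -/
theorem exists_stretch_step (a : unitInterval) (v : ℝ) (h0 : 0 ≤ v) (h1 : v ≤ 1 - a) :
    ∃ b d : unitInterval, a ≤ b ∧ (d = 1 ∨ a = b) ∧ (1 - b : ℝ) * (1 - d * a / 2) = v ∧
      (v = 0 → d = 1) := by
  have ha0 := a.2.1
  have ha1 := a.2.2
  have hpos : (0 : ℝ) < 1 - a / 2 := by linarith
  rcases le_total v ((1 - a) * (1 - a / 2)) with hv | hv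
  · -- the parameter increases, and the distance is `1`
    have h2 : v / (1 - a / 2) ≤ 1 - a := (div_le_iff₀ hpos).2 hv
    have h3 : 0 ≤ v / (1 - a / 2) := div_nonneg h0 hpos.le
    refine ⟨⟨1 - v / (1 - a / 2), by constructor <;> linarith⟩, 1, ?_, Or.inl rfl, ?_, fun _ => rfl⟩
    · change (a : ℝ) ≤ 1 - v / (1 - a / 2)
      linarith
    · simp only [Set.Icc.coe_one, one_mul, sub_sub_cancel]
      exact div_mul_cancel₀ _ hpos.ne'
  · rcases eq_or_lt_of_le ha1 with h2 | h2
    · refine ⟨a, 1, le_rfl, Or.inr rfl, ?_, fun _ => rfl⟩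
      rw [h2] at h1 ⊢
      simp
      linarith
    · rcases eq_or_lt_of_le ha0 with h3 | h3
      · refine ⟨a, 1, le_rfl, Or.inr rfl, ?_, fun _ => rfl⟩
        rw [← h3] at h1 hv ⊢
        norm_num at h1 hv ⊢
        linarith
      · -- the parameter does not change, and the distance accounts for the difference
        have h4 : 0 < 1 - (a : ℝ) := by linarith
        refine ⟨a, ⟨(1 - v / (1 - a)) * 2 / a, ?_, ?_⟩, le_rfl, Or.inr rfl, ?_, fun h => ?_⟩
        · have : v / (1 - a) ≤ 1 := (div_le_one h4).2 h1
          exact div_nonneg (mul_nonneg (by linarith) zero_le_two) ha0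
        · rw [div_le_one h3]
          have : 1 - a / 2 ≤ v / (1 - a) := by rw [le_div_iff₀ h4]; linarith
          linarith
        · simp only
          field_simp
          ring
        · have := mul_pos h4 hpos
          linarith

/-- The map to the simplex is surjective. -/
theorem exists_config {n : ℕ} {s : ℕ → unitInterval} (hs : Monotone s)
    (h1 : ∀ j, n ≤ j → s j = 1) : ∃ d t, IsConfig n d t ∧ ∀ j, stretch d t j = s j := by
  choose B D hB hD hv hD1 using exists_stretch_step
  have hstep : ∀ (j : ℕ) (p : {p : unitInterval × ℝ // 0 < p.2 ∧ (1 - p.1 : ℝ) * p.2 = 1 - s j}),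
      0 ≤ (1 - s (j + 1) : ℝ) / p.1.2 ∧ (1 - s (j + 1) : ℝ) / p.1.2 ≤ 1 - p.1.1 := by
    rintro j ⟨p, hp0, hp⟩
    refine ⟨div_nonneg (sub_nonneg.2 (s (j + 1)).2.2) hp0.le, ?_⟩
    rw [div_le_iff₀ hp0, hp]
    have : (s j : ℝ) ≤ s (j + 1) := hs (Nat.le_succ j)
    linarith
  -- the parameter of the leaf `j`, together with the stretching factor
  let S : ∀ j, {p : unitInterval × ℝ // 0 < p.2 ∧ (1 - p.1 : ℝ) * p.2 = 1 - s j} := fun j =>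
    Nat.rec ⟨(s 0, 1), one_pos, mul_one _⟩
      (fun j p => ⟨(B _ _ (hstep j p).1 (hstep j p).2,
        p.1.2 * (1 - D _ _ (hstep j p).1 (hstep j p).2 * p.1.1 / 2)),
        mul_pos p.2.1 (one_sub_mul_div_two_pos _ _), by
          have h2 := hv _ _ (hstep j p).1 (hstep j p).2
          rw [eq_div_iff p.2.1.ne'] at h2
          refine Eq.trans ?_ h2
          ring⟩) j
  let t : ℕ → unitInterval := fun j => (S j).1.1
  let d : ℕ → unitInterval := fun j => D _ _ (hstep j (S j)).1 (hstep j (S j)).2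
  have hF : ∀ j, (S j).1.2 = stretchFactor d t j := by
    intro j
    induction j with
    | zero => simp [S, stretchFactor]
    | succ j ih => rw [stretchFactor_succ, ← ih]
  have hst : ∀ j, stretch d t j = s j := by
    intro j
    have h2 := stretch_eq d t j
    have h3 := (S j).2.2
    rw [hF] at h3
    apply Subtype.ext
    linarith
  refine ⟨d, t, ⟨monotone_nat_of_le_succ fun j => hB _ _ _ _, fun j => hD _ _ _ _, fun j hj => ?_,
    fun j hj => ?_⟩, hst⟩
  · have h2 : (1 - (S j).1.1 : ℝ) * (S j).1.2 = 0 := (S j).2.2.trans (by rw [h1 j hj]; simp)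
    rcases mul_eq_zero.1 h2 with h | h
    · apply Subtype.ext
      simp only [t, Set.Icc.coe_one]
      linarith
    · exact absurd h (S j).2.1.ne'
  · apply hD1
    rw [h1 (j + 1) hj]
    simp

/-! ### `Wb□` and the simplices -/

theorem stretch_of_le {n : ℕ} {d t : ℕ → unitInterval} (h : IsConfig n d t) (j : ℕ) (hj : n ≤ j) :
    stretch d t j = 1 :=
  stretch_eq_one (h.t_top j hj)

/-- The map from the prisms to the simplex. -/
noncomputable def stretchPrism {n : ℕ} (P : Prisms n) : Tri n :=
  Tri.ofSeq n (stretch (gapAt (gaps P)) (seqAt (times P)))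
    (stretch_monotone _ (isConfig_prism P).mono)

theorem seqAt_stretchPrism {n : ℕ} (P : Prisms n) (j : ℕ) :
    seqAt (stretchPrism P).1 j = stretch (gapAt (gaps P)) (seqAt (times P)) j :=
  seqAt_ofSeq _ (stretch_of_le (isConfig_prism P)) j

/-- The identifications in `Wb□(n)` are exactly those made by the map to the simplex. -/
theorem Wb.mk_eq_of_stretchPrism_eq {n : ℕ} {P Q : Prisms n} (h : stretchPrism P = stretchPrism Q) :
    Wb.mk P = Wb.mk Q := by
  have hs : ∀ j, stretch (gapAt (gaps P)) (seqAt (times P)) j =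
      stretch (gapAt (gaps Q)) (seqAt (times Q)) j := by
    intro j
    rw [← seqAt_stretchPrism, ← seqAt_stretchPrism, h]
  have hP := isConfig_prism P
  have hQ := isConfig_prism Q
  obtain ⟨ht, hd⟩ := hP.eq_of_stretch_eq hQ hs
  obtain ⟨T, hT1, hT2⟩ := exists_level_composition (n := n) hP.mono
  have glue : ∀ (R : Prisms n), seqAt (times P) = seqAt (times R) →
      (Quot.mk _ R : WbBar n) =
        Quot.mk _ (prismOf T (gapAt (gaps R)) (seqAt (times P)) hP.mono) := by
    intro R hR
    have hR' : IsConfig n (gapAt (gaps R)) (seqAt (times P)) := hR ▸ isConfig_prism R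
    apply Quot.sound
    refine ⟨fun i j hij => (hT1 i j).2 ?_, gapAt_injective fun j => ?_, seqAt_injective fun j => ?_⟩
    · rw [hR, seqAt_val, seqAt_val, times, times, hij]
    · exact (gapAt_gaps_prismOf T hR'
        (fun j hj hb => (hR'.split j).resolve_right (hT2 j hj hb)) j).symm
    · rw [← hR]
      exact (seqAt_times_prismOf T hR' (fun i j => (hT1 i j).1) j).symm
  refine Eq.trans (congrArg (Quot.mk Collapse) (glue P rfl))
    (Eq.trans (Quot.sound ?_) (congrArg (Quot.mk Collapse) (glue Q ht)).symm)
  refine ⟨T, _, _, _, _, fun b => ?_, rfl, rfl⟩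
  rcases Classical.em (seqAt (times P) (sizeBefore T.blocksFun b.1) = 0 ∨
      seqAt (times P) (sizeBefore T.blocksFun b.1) = 1) with h0 | h0
  · exact Or.inr ⟨rfl, h0⟩
  · refine Or.inl ⟨Subtype.ext (funext fun o => ?_), rfl⟩
    refine (hd _).resolve_right ?_
    have hle : sizeBefore T.blocksFun b.1 + o.1 < n := by
      have h1 := sizeBefore_succ T.blocksFun b
      have h2 := sizeBefore_mono T.blocksFun (Nat.succ_le_of_lt b.2)
      have h3 := sizeBefore_top T.blocksFun
      have h4 := T.sum_blocksFun
      have h5 := o.2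
      simp only [Nat.succ_eq_add_one] at h2
      omega
    have hbead : ∀ o (ho : o < T.blocksFun b) (hn : sizeBefore T.blocksFun b.1 + o < n),
        bead T ⟨sizeBefore T.blocksFun b.1 + o, hn⟩ = b := by
      intro o ho hn
      exact congrArg Sigma.fst (locate_unique T.blocksFun T.sum_blocksFun ho rfl)
    have h1 := (hT1 ⟨_, hle⟩ ⟨sizeBefore T.blocksFun b.1 + 0, by omega⟩).1
      ((hbead _ (by omega) _).trans (hbead 0 (by omega) _).symm)
    simp only [add_zero] at h1
    rw [h1]
    exact h0

theorem stretchPrism_eq_of_glue {n : ℕ} {P Q : Prisms n} (h : Glue P Q) :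
    stretchPrism P = stretchPrism Q := by
  refine tri_ext fun j => ?_
  rw [seqAt_stretchPrism, seqAt_stretchPrism, h.2.1, h.2.2]

/-- The map from `Wb□(n)` to the simplex. -/
noncomputable def Wb.toTri {n : ℕ} : Wb n → Tri n :=
  Quot.lift (Quot.lift stretchPrism fun _ _ => stretchPrism_eq_of_glue) (by
    rintro _ _ ⟨T, x, x', t, t', h, rfl, rfl⟩
    obtain rfl : t = t' := Subtype.ext (funext fun b => (h b).elim And.right And.left)
    refine tri_ext fun j => ?_
    refine (seqAt_stretchPrism _ j).trans (Eq.trans ?_ (seqAt_stretchPrism _ j).symm)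
    refine stretch_congr (isConfig_prism _).mono (fun i => ?_) j
    rcases Nat.lt_or_ge i n with hi | hi
    · have h1 := gapAt_gaps ⟨T, x, t⟩ ⟨i, hi⟩
      have h2 := gapAt_gaps ⟨T, x', t⟩ ⟨i, hi⟩
      simp only at h1 h2
      rcases h (bead T ⟨i, hi⟩) with ⟨h3, -⟩ | ⟨-, h3⟩
      · left
        rw [h1, h2, h3]
      · right
        rw [seqAt, dif_pos hi]
        exact h3
    · exact Or.inl ((gapAt_of_le _ (by omega)).trans (gapAt_of_le _ (by omega)).symm))

theorem Wb.toTri_mk {n : ℕ} (P : Prisms n) : (Wb.mk P).toTri = stretchPrism P := rfl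

theorem Wb.mk_surjective {n : ℕ} : Function.Surjective (Wb.mk (n := n)) := by
  rintro ⟨⟨P⟩⟩
  exact ⟨P, rfl⟩

theorem Wb.toTri_bijective (n : ℕ) : Function.Bijective (Wb.toTri (n := n)) := by
  constructor
  · intro u v h
    obtain ⟨P, rfl⟩ := Wb.mk_surjective u
    obtain ⟨Q, rfl⟩ := Wb.mk_surjective v
    exact Wb.mk_eq_of_stretchPrism_eq h
  · intro s
    obtain ⟨d, t, h, hs⟩ := exists_config (seqAt_monotone s.2) fun j => seqAt_of_le s.1 (j := j)
    obtain ⟨P, h1, h2⟩ := h.exists_prism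
    refine ⟨Wb.mk P, tri_ext fun j => ?_⟩
    rw [Wb.toTri_mk, seqAt_stretchPrism, funext h1, funext h2, hs]

instance (n : ℕ) : CompactSpace (Square n) := by
  apply isCompact_iff_compactSpace.1
  exact (isClosed_const : IsClosed {_d : Fin (n - 1) → unitInterval | 0 < n}).isCompact

instance (n : ℕ) : CompactSpace (WbBar n) :=
  inferInstanceAs (CompactSpace (Quot _))

instance (n : ℕ) : CompactSpace (Wb n) :=
  inferInstanceAs (CompactSpace (Quot _))

theorem continuous_stretch {K : Type*} [TopologicalSpace K] {d t : K → ℕ → unitInterval}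
    (hd : ∀ i, Continuous fun z => d z i) (ht : ∀ i, Continuous fun z => t z i) (j : ℕ) :
    Continuous fun z => stretch (d z) (t z) j := by
  refine Continuous.subtype_mk ?_ _
  unfold stretchFactor
  have hd' : ∀ i, Continuous fun z => (d z i : ℝ) := fun i => continuous_subtype_val.comp (hd i)
  have ht' : ∀ i, Continuous fun z => (t z i : ℝ) := fun i => continuous_subtype_val.comp (ht i)
  refine continuous_const.sub ((continuous_const.sub (ht' j)).mul
    (continuous_finsetProd _ fun i _ => ?_))
  exact continuous_const.sub (((hd' i).mul (ht' i)).div_const 2)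

theorem Wb.continuous_toTri (n : ℕ) : Continuous (Wb.toTri (n := n)) := by
  refine continuous_quot_lift _ (continuous_quot_lift _ (continuous_sigma fun T => ?_))
  refine Continuous.subtype_mk (continuous_pi fun j => ?_) _
  refine continuous_stretch (fun i => ?_) (fun i => ?_) j.1
  · rcases Nat.lt_or_ge i n with hi | hi
    · have : (fun z => gapAt (gaps (⟨T, z⟩ : Prisms n)) i) = fun z =>
          gapAt (z.1 (bead T ⟨i, hi⟩)).1 (locate T.blocksFun T.sum_blocksFun ⟨i, hi⟩).2.1 :=
        funext fun z => gapAt_gaps ⟨T, z⟩ ⟨i, hi⟩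
      rw [this]
      exact (continuous_gapAt _).comp ((continuous_apply _).comp continuous_fst)
    · have : (fun z => gapAt (gaps (⟨T, z⟩ : Prisms n)) i) = fun z => 1 :=
        funext fun z => gapAt_of_le _ (by omega)
      rw [this]
      exact continuous_const
  · unfold seqAt
    split_ifs with hi
    · exact (continuous_apply (bead T ⟨i, hi⟩)).comp (continuous_subtype_val.comp continuous_snd)
    · exact continuous_const

/-- The homeomorphism of `Wb□(n)` with the simplex. -/
noncomputable def wbHomeo (n : ℕ) : Wb n ≃ₜ Tri n :=
  Continuous.homeoOfEquivCompactToT2 (f := Equiv.ofBijective _ (Wb.toTri_bijective n))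
    (Wb.continuous_toTri n)

theorem wbHomeo_mk {n : ℕ} (P : Prisms n) : wbHomeo n (Wb.mk P) = stretchPrism P := rfl

/-- The weak bimodule structure of `Wb□`, transported from the simplices. -/
noncomputable def wb : WeakBimodule Wb where
  left p q _ _ h w := (wbHomeo _).symm (tri.left p q h (wbHomeo _ w))
  right p m q _ _ h h' w := (wbHomeo _).symm (tri.right p m q h h' (wbHomeo _ w))
  continuous_left p q _ _ h :=
    (wbHomeo _).symm.continuous.comp ((tri.continuous_left p q h).comp (wbHomeo _).continuous)
  continuous_right p m q _ _ h h' :=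
    (wbHomeo _).symm.continuous.comp ((tri.continuous_right p m q h h').comp (wbHomeo _).continuous)
  left_unit h x := by rw [tri.left_unit, Homeomorph.symm_apply_apply]
  right_unit p q _ h h' x := by rw [tri.right_unit, Homeomorph.symm_apply_apply]
  left_left p q p' q' _ _ _ h h' h'' x := by
    rw [Homeomorph.apply_symm_apply, tri.left_left]
  right_right p q s s' m _ _ _ h₁ h₂ h₃ h₄ h₅ x := by
    rw [Homeomorph.apply_symm_apply, tri.right_right]
  right_comm a b c m m' _ _ _ _ h₁ h₂ h₃ h₄ h₅ h₆ h₇ h₈ x := by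
    rw [Homeomorph.apply_symm_apply, Homeomorph.apply_symm_apply,
      tri.right_comm a b c m m' h₁ h₂ h₃ h₄ h₅ h₆ h₇ h₈]
  left_right p q s s' m _ _ _ _ h₁ h₂ h₃ h₄ h₅ h₆ x := by
    rw [Homeomorph.apply_symm_apply, Homeomorph.apply_symm_apply,
      tri.left_right p q s s' m h₁ h₂ h₃ h₄ h₅ h₆]
  right_before a b q m _ _ _ h₁ h₂ h₃ h₄ x := by
    rw [Homeomorph.apply_symm_apply, tri.right_before a b q m h₁ h₂ h₃ h₄]
  right_after p a b m _ _ _ h₁ h₂ h₃ h₄ x := by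
    rw [Homeomorph.apply_symm_apply, tri.right_after p a b m h₁ h₂ h₃ h₄]

theorem wbHomeo_isWeakHom : IsWeakHom wb.toWeakOps tri.toWeakOps (fun n => wbHomeo n) where
  continuous n := (wbHomeo n).continuous
  map_left _ _ _ _ _ _ := Homeomorph.apply_symm_apply _ _
  map_right _ _ _ _ _ _ _ _ := Homeomorph.apply_symm_apply _ _

theorem wbHomeo_symm_isWeakHom :
    IsWeakHom tri.toWeakOps wb.toWeakOps (fun n => (wbHomeo n).symm) where
  continuous n := (wbHomeo n).symm.continuous
  map_left p q _ _ h x := by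
    change _ = (wbHomeo _).symm _
    rw [Homeomorph.apply_symm_apply]
  map_right p m q _ _ h h' x := by
    change _ = (wbHomeo _).symm _
    rw [Homeomorph.apply_symm_apply]

theorem wb_isRegular : IsRegular wb.toWeakOps :=
  tri_isRegular.of_injective (fun n => (wbHomeo n).injective)
    wbHomeo_isWeakHom.map_left wbHomeo_isWeakHom.map_right
    fun n _ _ y _ => (wbHomeo n).surjective y

/-- The grafting operations add the coordinates that the operations of `△` add: a distance `0`
repeats a coordinate, and a bead with the parameter `0` has no effect on the following factors. -/
theorem isGrafting_wb : IsGrafting wb.toWeakOps where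
  left_mk p q k r h P Q ht hd1 hd2 := by
    apply (wbHomeo r).injective
    rw [wbHomeo_isWeakHom.map_left, wbHomeo_mk, wbHomeo_mk]
    refine tri_ext fun j => ?_
    refine (seqAt_pad p q h (stretchPrism P).1 j).trans ?_
    rw [seqAt_stretchPrism Q]
    have ht' : ∀ i, seqAt (times Q) i = if i < p then 0 else seqAt (times P) (i - p) := by
      intro i; rw [ht, seqAt_pad]
    have hF : stretchFactor (gapAt (gaps Q)) (seqAt (times Q)) p = 1 := by
      refine Finset.prod_eq_one fun i hi => ?_
      rw [ht', if_pos (Finset.mem_range.1 hi)]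
      simp
    split_ifs with hj
    · apply Subtype.ext
      have : stretchFactor (gapAt (gaps Q)) (seqAt (times Q)) j = 1 := by
        refine Finset.prod_eq_one fun i hi => ?_
        rw [ht', if_pos ((Finset.mem_range.1 hi).trans hj)]
        simp
      have h1 := stretch_eq (gapAt (gaps Q)) (seqAt (times Q)) j
      rw [this, ht' j, if_pos hj, Set.Icc.coe_zero] at h1
      change (0 : ℝ) = stretch (gapAt (gaps Q)) (seqAt (times Q)) j
      linarith
    · rw [seqAt_stretchPrism]
      obtain ⟨i, rfl⟩ : ∃ i, j = p + i := ⟨j - p, by omega⟩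
      apply Subtype.ext
      simp only [stretch, ht', if_neg hj]
      congr 2
      rw [stretchFactor, stretchFactor, Finset.prod_range_add]
      rw [stretchFactor] at hF
      rw [hF, one_mul, Nat.add_sub_cancel_left]
      refine Finset.prod_congr rfl fun l _ => ?_
      rw [hd2, ht', if_neg (by omega), Nat.add_sub_cancel_left]
  right_mk p m q k r h h' P Q ht hd1 hd2 hd3 := by
    apply (wbHomeo r).injective
    rw [wbHomeo_isWeakHom.map_right, wbHomeo_mk, wbHomeo_mk]
    refine tri_ext fun j => ?_
    refine (seqAt_dup p m q h h' (stretchPrism P).1 j).trans ?_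
    rw [seqAt_stretchPrism, seqAt_stretchPrism]
    have ht' : ∀ i, seqAt (times Q) i =
        seqAt (times P) (if i < p then i else if i ≤ p + m then p else i - m) := by
      intro i; rw [ht, seqAt_dup]
    have h1 : ∀ i, i ≤ p → stretchFactor (gapAt (gaps Q)) (seqAt (times Q)) i =
        stretchFactor (gapAt (gaps P)) (seqAt (times P)) i := by
      intro i hi
      refine Finset.prod_congr rfl fun l hl => ?_
      have hl' : l < p := (Finset.mem_range.1 hl).trans_le hi
      rw [hd1 l hl', ht', if_pos hl']
    have h2 : ∀ i, i ≤ m → stretchFactor (gapAt (gaps Q)) (seqAt (times Q)) (p + i) =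
        stretchFactor (gapAt (gaps P)) (seqAt (times P)) p := by
      intro i hi
      rw [← h1 p le_rfl, stretchFactor, stretchFactor, Finset.prod_range_add]
      refine mul_eq_left₀ ?_ |>.2 ?_
      · exact (stretchFactor_pos _ _ _).ne'
      · refine Finset.prod_eq_one fun l hl => ?_
        rw [hd2 l ((Finset.mem_range.1 hl).trans_le hi)]
        simp
    have h3 : ∀ i, stretchFactor (gapAt (gaps Q)) (seqAt (times Q)) (p + m + i) =
        stretchFactor (gapAt (gaps P)) (seqAt (times P)) (p + i) := by
      intro i
      have h4 := h2 m le_rfl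
      simp only [stretchFactor] at h4 ⊢
      rw [Finset.prod_range_add, h4, Finset.prod_range_add]
      congr 1
      refine Finset.prod_congr rfl fun l _ => ?_
      have h5 : (if p + m + l < p then p + m + l else if p + m + l ≤ p + m then p
          else p + m + l - m) = p + l := by split_ifs <;> omega
      rw [hd3, ht', h5]
    apply Subtype.ext
    simp only [stretch]
    rw [ht' j]
    congr 2
    split_ifs with h4 h5
    · exact (h1 j h4.le).symm
    · have := h2 (j - p) (by omega)
      rw [Nat.add_sub_cancel' (by omega)] at this
      exact this.symm
    · have := h3 (j - (p + m))
      rw [Nat.add_sub_cancel' (by omega)] at this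
      rw [this]
      congr 1
      omega

/-! ### Rows of elements of a bimodule -/

theorem getElem?_flatten_ofFn {α : Type u} {k : ℕ} (L : Fin k → List α) (b : Fin k) (o : ℕ)
    (ho : o < (L b).length) :
    (List.ofFn L).flatten[sizeBefore (fun i => (L i).length) b.1 + o]? = (L b)[o]? := by
  induction k with
  | zero => exact b.elim0
  | succ k ih =>
    rw [List.ofFn_succ, List.flatten_cons]
    refine Fin.cases (fun ho => ?_) (fun b ho => ?_) b ho
    · rw [show sizeBefore (fun i => (L i).length) (0 : Fin (k + 1)).1 = 0 by simp [sizeBefore],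
        zero_add, List.getElem?_append_left ho]
    · have h1 : sizeBefore (fun i => (L i).length) b.succ.1 =
          (L 0).length + sizeBefore (fun i : Fin k => (L i.succ).length) b.1 := by
        simp [sizeBefore, Fin.sum_univ_succ]
      rw [h1, List.getElem?_append_right (by omega), Nat.add_assoc, Nat.add_sub_cancel_left]
      exact ih (fun i => L i.succ) b ho

theorem ofFn_flat {α : Type u} {k : ℕ} {ms : Fin k → ℕ} (f : ∀ i, Fin (ms i) → α) :
    List.ofFn (flat f) = (List.ofFn fun i => List.ofFn (f i)).flatten := by
  apply List.ext_getElem?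
  intro s
  have hlen : (List.ofFn fun i => List.ofFn (f i)).flatten.length = ∑ i, ms i := by
    rw [List.length_flatten, List.map_ofFn, List.sum_ofFn]
    simp
  rcases Nat.lt_or_ge s (∑ i, ms i) with hs | hs
  · have h1 := locate_val ms rfl ⟨s, hs⟩
    have h2 := getElem?_flatten_ofFn (fun i => List.ofFn (f i)) (locate ms rfl ⟨s, hs⟩).1
      (locate ms rfl ⟨s, hs⟩).2.1 (by simp)
    simp only [List.length_ofFn] at h2
    rw [← h1] at h2
    rw [h2]
    simp [hs, flat]
  · rw [List.getElem?_eq_none (by simpa using hs), List.getElem?_eq_none (by omega)]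

section Row

variable {O : ℕ → Type u}

/-- `a_k(x_1, …, x_k)` for a family of elements with their degrees. -/
def row (M : BimodOps O) {k : ℕ} (s : Fin k → Σ n, O n) (hk : 0 < k) : Σ n, O n :=
  ⟨∑ i, (s i).1, M.left (fun i => (s i).1) hk rfl fun i => (s i).2⟩

theorem left_eq_row (M : BimodOps O) {k r : ℕ} (ns : Fin k → ℕ) (hk : 0 < k) (h : ∑ i, ns i = r)
    (x : ∀ i, O (ns i)) : (⟨r, M.left ns hk h x⟩ : Σ n, O n) = row M (fun i => ⟨ns i, x i⟩) hk := by
  subst h; rfl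

open Classical in
/-- `a_k(x_1, …, x_k)` for a list of elements with their degrees, and `z` for the empty list. -/
noncomputable def joinList (M : BimodOps O) (z : O 0) (l : List (Σ n, O n)) : Σ n, O n :=
  if h : 0 < l.length then row M l.get h else ⟨0, z⟩

theorem joinList_ofFn (M : BimodOps O) (z : O 0) {k : ℕ} (s : Fin k → Σ n, O n) (hk : 0 < k) :
    joinList M z (List.ofFn s) = row M s hk := by
  have key : ∀ k' (e : k = k') (s' : Fin k' → Σ n, O n) (hk' : 0 < k')
      (_ : ∀ i : Fin k, s i = s' (Fin.cast e i)), row M s' hk' = row M s hk := by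
    intro k' e s' hk' h
    subst e
    congr 1
    funext i
    exact (h i).symm
  rw [joinList, dif_pos (by simpa using hk)]
  refine key _ (by simp) _ _ fun i => ?_
  simp

variable [∀ n, TopologicalSpace (O n)] (M : Bimodule O)

theorem row_row {k : ℕ} {ms : Fin k → ℕ} (s : ∀ i, Fin (ms i) → Σ n, O n) (hk : 0 < k)
    (hm : ∀ i, 0 < ms i) (hk' : 0 < ∑ i, ms i) :
    row M.toBimodOps (fun i => row M.toBimodOps (s i) (hm i)) hk =
      row M.toBimodOps (flat s) hk' := by
  have h' : ∑ t, flat (fun i j => (s i j).1) t = ∑ i, ∑ j, (s i j).1 := by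
    rw [← Fintype.sum_sigma' (f := fun i j => (s i j).1)]
    exact Fintype.sum_equiv finSigmaFinEquiv.symm _ _ fun t => rfl
  have := M.left_left ms (fun i j => (s i j).1) hk hm rfl hk' h' (fun i j => (s i j).2)
  refine Eq.trans ?_ (left_eq_row M.toBimodOps _ hk' h' _)
  rw [← this]
  rfl

theorem joinList_flatten (z : O 0) (p : List (List (Σ n, O n))) (hp : ∀ l ∈ p, l ≠ []) :
    joinList M.toBimodOps z (p.map (joinList M.toBimodOps z)) =
      joinList M.toBimodOps z p.flatten := by
  rcases Nat.eq_zero_or_pos p.length with h0 | h0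
  · rw [List.length_eq_zero_iff.1 h0]
    rfl
  have hm : ∀ i : Fin p.length, 0 < (p.get i).length := fun i =>
    List.length_pos_iff.2 (hp _ (List.get_mem p i))
  have hsum : 0 < ∑ i, (p.get i).length :=
    (hm ⟨0, h0⟩).trans_le (Finset.single_le_sum (f := fun i => (p.get i).length)
      (fun _ _ => Nat.zero_le _) (Finset.mem_univ _))
  have h1 : p.map (joinList M.toBimodOps z) =
      List.ofFn fun i => row M.toBimodOps (p.get i).get (hm i) := by
    conv_lhs => rw [← List.ofFn_get p, List.map_ofFn]
    congr 1
    funext i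
    exact dif_pos (hm i)
  have h2 : p.flatten = List.ofFn (flat fun i => (p.get i).get) := by
    rw [ofFn_flat]
    conv_lhs => rw [← List.ofFn_get p]
    congr 2
    funext i
    exact (List.ofFn_get _).symm
  rw [h1, joinList_ofFn _ _ _ h0, row_row M _ h0 hm hsum, h2, joinList_ofFn _ _ _ hsum]

theorem joinList_singleton (z : O 0) (x : Σ n, O n) : joinList M.toBimodOps z [x] = x := by
  obtain ⟨n, x⟩ := x
  have h := joinList_ofFn M.toBimodOps z (fun _ : Fin 1 => (⟨n, x⟩ : Σ n, O n)) one_pos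
  rw [← left_eq_row M.toBimodOps (r := n) (fun _ => n) one_pos (by simp) (fun _ => x),
    M.left_unit] at h
  simpa using h

/-- The operations of `Assoc` act on the image of `Assoc` as in `Assoc`. -/
theorem joinList_map_unit {η : ∀ n : ℕ, Unit → O n}
    (hη : IsBimodHom assoc.toBimodOps M.toBimodOps η)
    (ns : List ℕ) : joinList M.toBimodOps (η 0 ()) (ns.map fun n => ⟨n, η n ()⟩) =
      ⟨ns.sum, η ns.sum ()⟩ := by
  rcases Nat.eq_zero_or_pos ns.length with h0 | h0
  · rw [List.length_eq_zero_iff.1 h0]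
    rfl
  · have h1 : ∑ i, ns.get i = ns.sum := by
      conv_rhs => rw [← List.ofFn_get ns, List.sum_ofFn]
    have := hη.map_left ns.get h0 h1 fun _ => ()
    rw [show η ns.sum () = _ from this, left_eq_row]
    rw [← joinList_ofFn _ (η 0 ())]
    congr 1
    conv_lhs => rw [← List.ofFn_get ns, List.map_ofFn]
    rfl

/-- Restricting the right action along the blocks of a row. -/
theorem right_left {K k r : ℕ} (ns : Fin K → ℕ) (hK : 0 < K) (e : ∑ i, ns i = k)
    (ls : ∀ i, Fin (ns i) → ℕ) (ks : Fin k → ℕ)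
    (hks : ∀ s, ks s = ls (locate ns e s).1 (locate ns e s).2) (hpos : ∀ s, 0 < ks s)
    (hl : ∀ i j, 0 < ls i j) (h : ∑ s, ks s = r) (h' : ∑ i, ∑ j, ls i j = r)
    (x : ∀ i, O (ns i)) : M.right ks hpos h (M.left ns hK e x) =
      M.left (fun i => ∑ j, ls i j) hK h' (fun i => M.right (ls i) (hl i) rfl (x i)) := by
  subst e
  obtain rfl : ks = flat ls := funext hks
  exact M.left_right ns ls hK hpos hl h h' x

end Row

/-! ### The evaluation map in terms of coordinates -/

/-- A list of block sizes, starting at the leaf `a`, is compatible with the coordinates `d` and `t`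
if `t` is constant on each block, and the distance at the end of each block is `1`. -/
def Compat (d t : ℕ → unitInterval) : ℕ → List ℕ → Prop
  | _, [] => True
  | a, b :: bs => (∀ j, j < b → t (a + j) = t a) ∧ d (a + b - 1) = 1 ∧ Compat d t (a + b) bs

theorem compat_append {d t : ℕ → unitInterval} {l₁ l₂ : List ℕ} {a : ℕ} :
    Compat d t a (l₁ ++ l₂) ↔ Compat d t a l₁ ∧ Compat d t (a + l₁.sum) l₂ := by
  induction l₁ generalizing a with
  | nil => simp [Compat]
  | cons b l ih =>
    simp only [List.cons_append, Compat, ih, List.sum_cons, Nat.add_assoc, and_assoc]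

theorem compat_shift {d t d' t' : ℕ → unitInterval} {c : ℕ} (hd : ∀ j, d' (c + j) = d j)
    (ht : ∀ j, t' (c + j) = t j) {l : List ℕ} (hl : ∀ b ∈ l, 0 < b) {a : ℕ}
    (h : Compat d t a l) : Compat d' t' (c + a) l := by
  induction l generalizing a with
  | nil => trivial
  | cons b l ih =>
    have hb : 0 < b := hl b (by simp)
    refine ⟨fun j hj => ?_, ?_, ?_⟩
    · rw [Nat.add_assoc, ht, ht, h.1 j hj]
    · rw [show c + a + b - 1 = c + (a + b - 1) by omega, hd, h.2.1]
    · rw [Nat.add_assoc]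
      exact ih (fun b hb => hl b (by simp [hb])) h.2.2

theorem compat_replicate {d t : ℕ → unitInterval} {a q : ℕ} (hd : ∀ j, j < q → d (a + j) = 1) :
    Compat d t a (List.replicate q 1) := by
  induction q generalizing a with
  | zero => trivial
  | succ q ih =>
    refine ⟨fun j hj => by rw [Nat.lt_one_iff.1 hj, Nat.add_zero], hd 0 (by omega), ih ?_⟩
    intro j hj
    rw [Nat.add_assoc]
    exact hd _ (by omega)

theorem compat_ofFn {d t : ℕ → unitInterval} {k : ℕ} (N : Fin k → ℕ) (a : ℕ) :
    Compat d t a (List.ofFn N) ↔ ∀ i : Fin k,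
      (∀ j, j < N i → t (a + sizeBefore N i.1 + j) = t (a + sizeBefore N i.1)) ∧
        d (a + sizeBefore N i.1 + N i - 1) = 1 := by
  induction k generalizing a with
  | zero => simp [Compat]
  | succ k ih =>
    have h0 : sizeBefore N 0 = 0 := by simp [sizeBefore]
    have h1 : ∀ i : ℕ, sizeBefore N (i + 1) = N 0 + sizeBefore (fun i => N i.succ) i := by
      intro i
      simp [sizeBefore, Fin.sum_univ_succ]
    rw [List.ofFn_succ, Compat, ih, Fin.forall_fin_succ, ← and_assoc]
    simp only [Fin.val_zero, h0, Nat.add_zero, Fin.val_succ, h1, Nat.add_assoc]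

section Evaluation

variable {O : ℕ → Type u} (g : ∀ n, Square n → unitInterval → O n) (z : O 0)
  (d t : ℕ → unitInterval)

/-- The value of `g` on the block of `b` leaves that starts at the leaf `a`. -/
noncomputable def entry (a b : ℕ) : Σ n, O n :=
  if hb : 0 < b then ⟨b, g b ⟨fun j => d (a + j.1), hb⟩ (t a)⟩ else ⟨0, z⟩

/-- The values of `g` on consecutive blocks of leaves. -/
noncomputable def entries : ℕ → List ℕ → List (Σ n, O n)
  | _, [] => []
  | a, b :: bs => entry g z d t a b :: entries (a + b) bs

theorem entries_append (a : ℕ) (l₁ l₂ : List ℕ) : entries g z d t a (l₁ ++ l₂) =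
    entries g z d t a l₁ ++ entries g z d t (a + l₁.sum) l₂ := by
  induction l₁ generalizing a with
  | nil => simp [entries]
  | cons b l ih => simp [entries, ih, Nat.add_assoc]

theorem length_entries (a : ℕ) (l : List ℕ) : (entries g z d t a l).length = l.length := by
  induction l generalizing a with
  | nil => rfl
  | cons b l ih => simp [entries, ih]

variable {g z d t}

theorem entries_shift {d' t' : ℕ → unitInterval} {c : ℕ} (hd : ∀ j, d' (c + j) = d j)
    (ht : ∀ j, t' (c + j) = t j) (a : ℕ) (l : List ℕ) :
    entries g z d' t' (c + a) l = entries g z d t a l := by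
  induction l generalizing a with
  | nil => rfl
  | cons b l ih =>
    simp only [entries, Nat.add_assoc, ih]
    congr 1
    simp only [entry, Nat.add_assoc, hd, ht]

theorem entries_replicate {e : O 1} {a q : ℕ}
    (h : ∀ j, j < q → ∀ x, g 1 x (t (a + j)) = e) :
    entries g z d t a (List.replicate q 1) = List.replicate q ⟨1, e⟩ := by
  induction q generalizing a with
  | zero => rfl
  | succ q ih =>
    rw [List.replicate_succ, List.replicate_succ, entries, ih]
    · congr 1
      have := h 0 (by omega)
      rw [Nat.add_zero] at this
      simp only [entry, this, Nat.one_pos, dif_pos]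
    · intro j hj
      rw [Nat.add_assoc]
      exact h _ (by omega)

theorem entries_ofFn {k : ℕ} (N : Fin k → ℕ) (a : ℕ) : entries g z d t a (List.ofFn N) =
    List.ofFn fun i => entry g z d t (a + sizeBefore N i.1) (N i) := by
  induction k generalizing a with
  | zero => simp [entries]
  | succ k ih =>
    have h0 : sizeBefore N 0 = 0 := by simp [sizeBefore]
    have h1 : ∀ i : ℕ, sizeBefore N (i + 1) = N 0 + sizeBefore (fun i => N i.succ) i := by
      intro i
      simp [sizeBefore, Fin.sum_univ_succ]
    rw [List.ofFn_succ, entries, ih, List.ofFn_succ]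
    simp only [Fin.val_zero, h0, Nat.add_zero, Fin.val_succ, h1, Nat.add_assoc]

/-- The coordinates of a row of blocks determine the values of `g` on the blocks. -/
theorem entries_join {k r : ℕ} (N : Fin k → ℕ) (hN : ∀ i, 0 < N i) (h : ∑ i, N i = r)
    (y : ∀ i, Square (N i)) (τ : Fin k → unitInterval)
    (hd : ∀ j, d j = gapAt (joinCoord N h y) j) (ht : ∀ j : Fin r, t j.1 = τ (locate N h j).1) :
    entries g z d t 0 (List.ofFn N) = List.ofFn fun i => ⟨N i, g (N i) (y i) (τ i)⟩ := by
  rw [entries_ofFn]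
  congr 1
  funext i
  have hlt : ∀ o, o < N i → sizeBefore N i.1 + o < r := by
    intro o ho
    have h1 := sizeBefore_succ N i
    have h2 := sizeBefore_mono N (Nat.succ_le_of_lt i.2)
    have h3 := sizeBefore_top N
    simp only [Nat.succ_eq_add_one] at h2
    omega
  have hloc : ∀ o (ho : o < N i), locate N h ⟨sizeBefore N i.1 + o, hlt o ho⟩ = ⟨i, o, ho⟩ :=
    fun o ho => locate_unique N h ho rfl
  rw [entry, dif_pos (hN i), Nat.zero_add]
  have h1 : t (sizeBefore N i.1) = τ i := by
    have := ht ⟨sizeBefore N i.1 + 0, hlt 0 (hN i)⟩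
    rw [hloc 0 (hN i)] at this
    exact this
  have h2 : (⟨fun j => d (sizeBefore N i.1 + j.1), hN i⟩ : Square (N i)) = y i := by
    apply Subtype.ext
    funext j
    have hj : j.1 < N i := by omega
    have := gapAt_joinCoord N h y ⟨sizeBefore N i.1 + j.1, hlt _ hj⟩
    rw [hloc _ hj] at this
    refine (hd _).trans (this.trans ?_)
    simp [gapAt]
  rw [h1, h2]

theorem compat_join {k r : ℕ} (N : Fin k → ℕ) (hN : ∀ i, 0 < N i) (h : ∑ i, N i = r)
    (y : ∀ i, Square (N i)) (τ : Fin k → unitInterval)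
    (hd : ∀ j, d j = gapAt (joinCoord N h y) j) (ht : ∀ j : Fin r, t j.1 = τ (locate N h j).1) :
    Compat d t 0 (List.ofFn N) := by
  rw [compat_ofFn]
  intro i
  have hlt : ∀ o, o < N i → sizeBefore N i.1 + o < r := by
    intro o ho
    have h1 := sizeBefore_succ N i
    have h2 := sizeBefore_mono N (Nat.succ_le_of_lt i.2)
    have h3 := sizeBefore_top N
    simp only [Nat.succ_eq_add_one] at h2
    omega
  have hloc : ∀ o (ho : o < N i), locate N h ⟨sizeBefore N i.1 + o, hlt o ho⟩ = ⟨i, o, ho⟩ :=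
    fun o ho => locate_unique N h ho rfl
  have h1 : ∀ o, o < N i → t (sizeBefore N i.1 + o) = τ i := by
    intro o ho
    have := ht ⟨sizeBefore N i.1 + o, hlt o ho⟩
    rw [hloc o ho] at this
    exact this
  rw [Nat.zero_add]
  refine ⟨fun j hj => ?_, ?_⟩
  · rw [h1 j hj]
    exact (h1 0 (hN i)).symm
  · have hi := hN i
    have hj : N i - 1 < N i := by omega
    rw [show sizeBefore N i.1 + N i - 1 = sizeBefore N i.1 + (N i - 1) by omega, hd]
    have := gapAt_joinCoord N h y ⟨sizeBefore N i.1 + (N i - 1), hlt _ hj⟩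
    rw [hloc _ hj] at this
    exact this.trans (gapAt_of_le _ (by simp only; omega))

variable [∀ n, TopologicalSpace (O n)] {M : Bimodule O}

/-- Merging consecutive blocks with the same parameter does not change the value, as `g` is
a morphism of bimodules for this parameter. -/
theorem joinList_entries (hg : ∀ τ, IsBimodHom square.toBimodOps M.toBimodOps (fun n x => g n x τ))
    {a : ℕ} {bs : List ℕ} (hne : bs ≠ []) (hpos : ∀ b ∈ bs, 0 < b) (hc : Compat d t a bs)
    (ht : ∀ j, j < bs.sum → t (a + j) = t a) :
    joinList M.toBimodOps z (entries g z d t a bs) = entry g z d t a bs.sum := by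
  have hk : 0 < bs.length := List.length_pos_iff.2 hne
  have hN : ∀ i, 0 < bs.get i := fun i => hpos _ (List.get_mem bs i)
  have hsum : ∑ i, bs.get i = bs.sum := by
    conv_rhs => rw [← List.ofFn_get bs, List.sum_ofFn]
  have hsum0 : 0 < bs.sum := by
    rw [← hsum]
    exact (hN ⟨0, hk⟩).trans_le (Finset.single_le_sum (f := bs.get)
      (fun _ _ => Nat.zero_le _) (Finset.mem_univ _))
  have hc' := hc
  rw [← List.ofFn_get bs, compat_ofFn] at hc'
  have hlt : ∀ i : Fin bs.length, sizeBefore bs.get i.1 + bs.get i ≤ bs.sum := by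
    intro i
    have h1 := sizeBefore_succ bs.get i
    have h2 := sizeBefore_mono bs.get (Nat.succ_le_of_lt i.2)
    have h3 := sizeBefore_top bs.get
    simp only [Nat.succ_eq_add_one] at h2
    omega
  let y : ∀ i, Square (bs.get i) := fun i => ⟨fun j => d (a + sizeBefore bs.get i.1 + j.1), hN i⟩
  have h1 : entries g z d t a bs = List.ofFn fun i => ⟨bs.get i, g (bs.get i) (y i) (t a)⟩ := by
    conv_lhs => rw [← List.ofFn_get bs, entries_ofFn]
    congr 1
    funext i
    have h2 := hlt i
    have h3 := hN i
    rw [entry, dif_pos (hN i), ht _ (by omega)]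
  have h2 := (hg (t a)).map_left bs.get hk hsum y
  rw [h1, joinList_ofFn _ _ _ hk, ← left_eq_row M.toBimodOps bs.get hk hsum, ← h2, entry,
    dif_pos hsum0]
  congr 2
  refine square_ext fun j hj => ?_
  refine (gapAt_joinCoord bs.get hsum y j).trans ?_
  have h4 := locate_val bs.get hsum j
  have h5 := (locate bs.get hsum j).2.2
  rw [gapAt, gapAt, dif_pos hj]
  simp only
  split_ifs with h6
  · simp only [y]
    congr 1
    omega
  · have := (hc' (locate bs.get hsum j).1).2
    rw [← this]
    congr 1
    omega

theorem joinList_entries_flatten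
    (hg : ∀ τ, IsBimodHom square.toBimodOps M.toBimodOps (fun n x => g n x τ))
    (bss : List (List ℕ)) (hne : ∀ bs ∈ bss, bs ≠ []) (hpos : ∀ bs ∈ bss, ∀ b ∈ bs, 0 < b)
    (hc : Compat d t 0 bss.flatten) (hc' : Compat d t 0 (bss.map List.sum)) :
    joinList M.toBimodOps z (entries g z d t 0 bss.flatten) =
      joinList M.toBimodOps z (entries g z d t 0 (bss.map List.sum)) := by
  have key : ∀ a, Compat d t a bss.flatten → Compat d t a (bss.map List.sum) →
      ∃ p : List (List (Σ n, O n)), p.flatten = entries g z d t a bss.flatten ∧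
        p.map (joinList M.toBimodOps z) = entries g z d t a (bss.map List.sum) ∧
        ∀ l ∈ p, l ≠ [] := by
    clear hc hc'
    induction bss with
    | nil => exact fun a _ _ => ⟨[], rfl, rfl, by simp⟩
    | cons bs bss ih =>
      intro a hc hc'
      rw [List.flatten_cons, compat_append] at hc
      rw [List.map_cons, Compat] at hc'
      obtain ⟨p, h1, h2, h3⟩ := ih (fun l hl => hne l (by simp [hl]))
        (fun l hl => hpos l (by simp [hl])) (a + bs.sum) hc.2 hc'.2.2
      refine ⟨entries g z d t a bs :: p, ?_, ?_, ?_⟩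
      · rw [List.flatten_cons, List.flatten_cons, entries_append, h1]
      · rw [List.map_cons, List.map_cons, entries, h2,
          joinList_entries hg (hne bs (by simp)) (hpos bs (by simp)) hc.1 hc'.1]
      · intro l hl
        rcases List.mem_cons.1 hl with rfl | hl
        · rw [← List.length_pos_iff, length_entries]
          exact List.length_pos_iff.2 (hne bs (by simp))
        · exact h3 l hl
  obtain ⟨p, h1, h2, h3⟩ := key 0 hc hc'
  rw [← h1, ← h2, joinList_flatten M z p h3]

end Evaluation

/-- A list whose partial sums include those of `cs` is a refinement of `cs`. -/
theorem exists_flatten {bs cs : List ℕ} (hb : ∀ b ∈ bs, 0 < b) (hsum : bs.sum = cs.sum)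
    (h : ∀ i, i ≤ cs.length → ∃ k, (cs.take i).sum = (bs.take k).sum) :
    ∃ bss : List (List ℕ), bss.flatten = bs ∧ bss.map List.sum = cs := by
  induction cs generalizing bs with
  | nil =>
    refine ⟨[], ?_, rfl⟩
    cases bs with
    | nil => rfl
    | cons b bs =>
      have := hb b (by simp)
      simp at hsum
      omega
  | cons c cs ih =>
    obtain ⟨k, hk⟩ := h 1 (by simp)
    simp only [List.take_succ_cons, List.take_zero, List.sum_cons, List.sum_nil, Nat.add_zero] at hk
    have hdrop : (bs.take k).sum + (bs.drop k).sum = bs.sum := by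
      rw [← List.sum_append, List.take_append_drop]
    obtain ⟨bss, h1, h2⟩ := ih (bs := bs.drop k) (fun b hb' => hb b (List.mem_of_mem_drop hb'))
      (by rw [List.sum_cons] at hsum; omega) (fun i hi => by
        obtain ⟨k', hk'⟩ := h (i + 1) (by simpa using hi)
        rw [List.take_succ_cons, List.sum_cons, hk] at hk'
        rcases le_total k k' with hkk | hkk
        · refine ⟨k' - k, ?_⟩
          have h3 : bs.take k' = bs.take k ++ (bs.drop k).take (k' - k) := by
            rw [← List.take_add, Nat.add_sub_cancel' hkk]
          rw [h3, List.sum_append] at hk'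
          omega
        · refine ⟨0, ?_⟩
          have h3 : (bs.take k).sum = (bs.take k').sum + ((bs.drop k').take (k - k')).sum := by
            rw [← List.sum_append, ← List.take_add, Nat.add_sub_cancel' hkk]
          simp only [List.take_zero, List.sum_nil]
          omega)
    refine ⟨bs.take k :: bss, ?_, ?_⟩
    · rw [List.flatten_cons, h1, List.take_append_drop]
    · rw [List.map_cons, h2, ← hk]

theorem exists_prism_of_compat {n : ℕ} {d t : ℕ → unitInterval} (h : IsConfig n d t)
    {bs : List ℕ} (hpos : ∀ b ∈ bs, 0 < b) (hsum : bs.sum = n) (hc : Compat d t 0 bs) :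
    ∃ Q : Prisms n, gapAt (gaps Q) = d ∧ seqAt (times Q) = t ∧ Q.1.blocks = bs := by
  let T : Composition n := ⟨bs, fun {b} hb => hpos b hb, hsum⟩
  have hT : List.ofFn T.blocksFun = bs := T.ofFn_blocksFun
  rw [← hT, compat_ofFn] at hc
  simp only [Nat.zero_add] at hc
  have hbead : ∀ i : Fin n, t i.1 = t (sizeBefore T.blocksFun (bead T i).1) := by
    intro i
    have h1 := locate_val T.blocksFun T.sum_blocksFun i
    rw [h1]
    exact (hc (bead T i)).1 _ (locate T.blocksFun T.sum_blocksFun i).2.2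
  refine ⟨prismOf T d t h.mono, funext (gapAt_gaps_prismOf T h fun j hj hb => ?_),
    funext (seqAt_times_prismOf T h fun i j hij => ?_), rfl⟩
  · obtain ⟨b, hb⟩ := (bead_ne_iff T hj).1 hb
    obtain ⟨b, hb'⟩ := b
    obtain _ | b := b
    · simp [sizeBefore] at hb
    · have h1 := (hc ⟨b, by omega⟩).2
      have h2 := sizeBefore_succ T.blocksFun ⟨b, by omega⟩
      simp only at h1 h2 hb
      rw [← h1]
      congr 1
      omega
  · rw [hbead, hbead j, hij]

/-! ### The evaluation map is a morphism -/

theorem insertEntry_eq {O : ℕ → Type u} (p : ℕ) {k : ℕ} (e : O 1) (x : O k) (b : ℕ) :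
    (⟨if b = p then k else 1, insertEntry p e x b⟩ : Σ n, O n) =
      if b = p then ⟨k, x⟩ else ⟨1, e⟩ := by
  unfold insertEntry
  by_cases hb : b = p
  · rw [if_pos (c := b = p) (t := (⟨k, x⟩ : Σ n, O n)) hb]
    refine Sigma.ext (if_pos hb) ?_
    rw [dif_pos hb]
    exact cast_heq _ _
  · rw [if_neg (c := b = p) (t := (⟨k, x⟩ : Σ n, O n)) hb]
    refine Sigma.ext (if_neg hb) ?_
    rw [dif_neg hb]
    exact cast_heq _ _

section EvaluationMap

variable {O : ℕ → Type u} [∀ n, TopologicalSpace (O n)] (M : Bimodule O) (η : ∀ n : ℕ, Unit → O n)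
  (g : ∀ n, Square n → unitInterval → O n)

/-- The evaluation map on the prisms. -/
noncomputable def evalPrism {n : ℕ} (P : Prisms n) : O n :=
  if hn : 0 < n then M.left P.1.blocksFun (P.1.length_pos_iff.2 hn) P.1.sum_blocksFun
    (fun b => g (P.1.blocksFun b) (P.2.1 b) (P.2.2.1 b)) else η n ()

/-- The evaluation map depends on a prism only through the coordinates and the block sizes. -/
theorem evalPrism_eq {n : ℕ} (P : Prisms n) : (⟨n, evalPrism M η g P⟩ : Σ n, O n) =
    joinList M.toBimodOps (η 0 ()) (entries g (η 0 ()) (gapAt (gaps P)) (seqAt (times P)) 0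
      P.1.blocks) := by
  rcases Nat.eq_zero_or_pos n with rfl | hn
  · have h1 : P.1.blocks = [] := by
      have := P.1.length_le
      exact List.length_eq_zero_iff.1 (Nat.le_zero.1 this)
    rw [h1]
    rfl
  · rw [evalPrism, dif_pos hn, left_eq_row, ← joinList_ofFn _ (η 0 ()), ← P.1.ofFn_blocksFun]
    refine congrArg _ (entries_join P.1.blocksFun (fun i => P.1.blocks_pos' _ _)
      P.1.sum_blocksFun P.2.1 P.2.2.1 (fun j => rfl) fun j => ?_).symm
    rw [seqAt_val]
    rfl

theorem compat_prism {n : ℕ} (P : Prisms n) :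
    Compat (gapAt (gaps P)) (seqAt (times P)) 0 P.1.blocks := by
  have := compat_join (d := gapAt (gaps P)) (t := seqAt (times P)) P.1.blocksFun
    (fun i => P.1.blocks_pos' _ _) P.1.sum_blocksFun P.2.1 P.2.2.1 (fun j => rfl)
    (fun j => by rw [seqAt_val]; rfl)
  rwa [P.1.ofFn_blocksFun] at this

variable {M η g}

/-- The blocks of `P` refine those of `Q`, and the parameters agree, so the values agree by merging
the blocks of `P` within each block of `Q`. -/
theorem evalPrism_glue
    (hg : ∀ τ, IsBimodHom square.toBimodOps M.toBimodOps (fun n x => g n x τ))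
    {n : ℕ} {P Q : Prisms n} (h : Glue P Q) : evalPrism M η g P = evalPrism M η g Q := by
  obtain ⟨hb, hd, ht⟩ := h
  have hsize : ∀ (T : Composition n) i, i ≤ T.length →
      (T.blocks.take i).sum = sizeBefore T.blocksFun i := fun T i hi =>
    (sizeBefore_blocksFun T i hi).symm
  obtain ⟨bss, h1, h2⟩ := exists_flatten (bs := P.1.blocks) (cs := Q.1.blocks)
    (fun b hb => P.1.blocks_pos hb) (P.1.blocks_sum.trans Q.1.blocks_sum.symm) (by
      intro i hi
      rcases Nat.eq_zero_or_pos i with rfl | h0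
      · exact ⟨0, rfl⟩
      rcases Nat.lt_or_ge i Q.1.length with hlt | hge
      · have hle : sizeBefore Q.1.blocksFun i < n := by
          have h1 := sizeBefore_succ Q.1.blocksFun ⟨i, hlt⟩
          have h2 := sizeBefore_mono Q.1.blocksFun (Nat.succ_le_of_lt hlt)
          have h3 := sizeBefore_top Q.1.blocksFun
          have h4 := Q.1.sum_blocksFun
          have h5 : 0 < Q.1.blocksFun ⟨i, hlt⟩ := Q.1.blocks_pos' _ _
          simp only [Nat.succ_eq_add_one] at h2 h1
          omega
        have hpos : 0 < sizeBefore Q.1.blocksFun i := by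
          have hl : 0 < Q.1.length := h0.trans hlt
          have h1 := sizeBefore_succ Q.1.blocksFun ⟨0, hl⟩
          have h2 := sizeBefore_mono Q.1.blocksFun (show 0 + 1 ≤ i from h0)
          have h5 : 0 < Q.1.blocksFun ⟨0, hl⟩ := Q.1.blocks_pos' _ _
          simp only at h1
          omega
        obtain ⟨j, hj⟩ : ∃ j, sizeBefore Q.1.blocksFun i = j + 1 :=
          ⟨sizeBefore Q.1.blocksFun i - 1, by omega⟩
        rw [hj] at hle
        have h3 := (bead_ne_iff Q.1 hle).2 ⟨⟨i, hlt⟩, hj⟩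
        obtain ⟨b, hb'⟩ := (bead_ne_iff P.1 hle).1 fun h => h3 (hb _ _ h)
        refine ⟨b.1, ?_⟩
        rw [hsize _ _ hi, hsize _ _ b.2.le, hj, hb']
      · refine ⟨P.1.length, ?_⟩
        rw [List.take_of_length_le (show Q.1.blocks.length ≤ i from hge),
          List.take_of_length_le (show P.1.blocks.length ≤ P.1.length from le_rfl),
          P.1.blocks_sum, Q.1.blocks_sum])
  have h3 := evalPrism_eq M η g P
  have h4 := evalPrism_eq M η g Q
  have hcP := compat_prism P
  have hcQ := compat_prism Q
  rw [← h2, ← hd, ← ht] at h4 hcQ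
  rw [← h1] at h3 hcP
  have hpos : ∀ bs ∈ bss, 0 < bs.sum := by
    intro bs hbs
    apply Q.1.blocks_pos
    rw [← h2]
    exact List.mem_map_of_mem hbs
  have h5 := joinList_entries_flatten (z := η 0 ()) hg bss
    (fun bs hbs he => by have := hpos bs hbs; rw [he] at this; simp at this)
    (fun bs hbs b hb => P.1.blocks_pos (by rw [← h1]; exact List.mem_flatten.2 ⟨bs, hbs, hb⟩))
    hcP hcQ
  exact sigma_mk_injective (h3.trans (h5.trans h4.symm))

/-- The evaluation map of a loop of morphisms of bimodules. -/
noncomputable def evalMap (hg : IsBimodLoop M η g) (n : ℕ) : Wb n → O n :=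
  Quot.lift (Quot.lift (evalPrism M η g) fun _ _ => evalPrism_glue hg.isBimodHom) (by
    rintro _ _ ⟨T, x, x', t, t', h, rfl, rfl⟩
    change evalPrism M η g _ = evalPrism M η g _
    have key : (fun b => g (T.blocksFun b) (x b) (t.1 b)) =
        fun b => g (T.blocksFun b) (x' b) (t'.1 b) := by
      funext b
      rcases h b with ⟨h1, h2⟩ | ⟨h1, h2⟩
      · rw [h1, h2]
      · rw [← h1]
        rcases h2 with h2 | h2
        · rw [h2, hg.map_zero, hg.map_zero]
        · rw [h2, hg.map_one, hg.map_one]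
    simp only [evalPrism, key])

theorem evalMap_mk (hg : IsBimodLoop M η g) {n : ℕ} (P : Prisms n) :
    evalMap hg n (Wb.mk P) = evalPrism M η g P := rfl

theorem continuous_evalMap (hg : IsBimodLoop M η g) (n : ℕ) : Continuous (evalMap hg n) := by
  refine continuous_quot_lift _ (continuous_quot_lift _ (continuous_sigma fun T => ?_))
  rcases Nat.eq_zero_or_pos n with rfl | hn
  · exact continuous_const (y := η 0 ())
  · have h1 : (fun z => evalPrism M η g (⟨T, z⟩ : Prisms n)) = fun z => M.left T.blocksFun
        (T.length_pos_iff.2 hn) T.sum_blocksFun fun b => g (T.blocksFun b) (z.1 b) (z.2.1 b) :=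
      funext fun z => dif_pos hn
    rw [h1]
    refine M.continuous_left _ _ _ _ 
      (fun (z : (∀ b, Square (T.blocksFun b)) × Tri T.length) b =>
        g (T.blocksFun b) (z.1 b) (z.2.1 b))
      (continuous_pi fun b => ?_)
    have h2 : Continuous fun z : (∀ b, Square (T.blocksFun b)) × Tri T.length =>
        (z.1 b, z.2.1 b) := ((continuous_apply b).comp continuous_fst).prodMk
      ((continuous_apply b).comp (continuous_subtype_val.comp continuous_snd))
    exact (hg.continuous (T.blocksFun b)).comp h2

theorem isEvaluation_evalMap (hg : IsBimodLoop M η g) : IsEvaluation M η g (evalMap hg) := by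
  refine ⟨fun n hn P => dif_pos hn, fun w => ?_⟩
  obtain ⟨P, rfl⟩ := Wb.mk_surjective w
  rfl

/-- The left operations of the underlying weak bimodule fill the other inputs with units. -/
theorem weakOps_left_eq (p q : ℕ) {k r : ℕ} (h : p + k + q = r) (x : O k) :
    (⟨r, (M.weakOps η).left p q h x⟩ : Σ n, O n) = joinList M.toBimodOps (η 0 ())
      (List.replicate p ⟨1, η 1 ()⟩ ++ ([⟨k, x⟩] ++ List.replicate q ⟨1, η 1 ()⟩)) := by
  change (⟨r, M.left _ _ _ _⟩ : Σ n, O n) = _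
  rw [left_eq_row, ← joinList_ofFn _ (η 0 ())]
  simp only [insertEntry_eq]
  congr 1
  apply List.ext_getElem
  · simp; omega
  · intro i h1 h2
    simp only [List.getElem_ofFn, List.getElem_append, List.length_replicate,
      List.getElem_replicate, List.length_singleton]
    split_ifs <;> first | omega | rfl | simp

theorem evalMap_left (hη : IsBimodHom assoc.toBimodOps M.toBimodOps η) (hg : IsBimodLoop M η g)
    (p q : ℕ) {k r : ℕ} (h : p + k + q = r) (w : Wb k) :
    evalMap hg r (wb.left p q h w) = (M.weakOps η).left p q h (evalMap hg k w) := by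
  obtain ⟨P, rfl⟩ := Wb.mk_surjective w
  have hP := isConfig_prism P
  -- the coordinates of the grafted tree
  let d : ℕ → unitInterval := fun j => if j < p then 1 else gapAt (gaps P) (j - p)
  let t : ℕ → unitInterval := fun j => if j < p then 0 else seqAt (times P) (j - p)
  have hd : ∀ j, d (p + j) = gapAt (gaps P) j := by
    intro j; simp [d]
  have ht : ∀ j, t (p + j) = seqAt (times P) j := by
    intro j; simp [t]
  have hc : IsConfig r d t := by
    refine ⟨fun i j hij => ?_, fun j => ?_, fun j hj => ?_, fun j hj => ?_⟩
    · simp only [t]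
      split_ifs
      · exact le_rfl
      · exact unitInterval.nonneg _
      · omega
      · exact hP.mono (by omega)
    · rcases Nat.lt_or_ge j p with hj | hj
      · exact Or.inl (if_pos hj)
      · obtain ⟨i, rfl⟩ : ∃ i, j = p + i := ⟨j - p, by omega⟩
        rw [hd, ht, Nat.add_assoc, ht]
        exact hP.split i
    · obtain ⟨i, rfl⟩ : ∃ i, j = p + i := ⟨j - p, by omega⟩
      rw [ht]
      exact hP.t_top i (by omega)
    · rcases Nat.lt_or_ge j p with hjp | hjp
      · exact if_pos hjp
      · obtain ⟨i, rfl⟩ : ∃ i, j = p + i := ⟨j - p, by omega⟩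
        rw [hd]
        exact hP.d_top i (by omega)
  have hlast : ∀ j, d (p + k + j) = 1 := by
    intro j
    rw [Nat.add_assoc, hd]
    exact hP.d_top _ (by omega)
  have hbs : (List.replicate p 1 ++ (P.1.blocks ++ List.replicate q 1)).sum = r := by
    simp [P.1.blocks_sum]
    omega
  have hcompat : Compat d t 0 (List.replicate p 1 ++ (P.1.blocks ++ List.replicate q 1)) := by
    rw [compat_append, compat_append]
    refine ⟨compat_replicate fun j hj => ?_, ?_, compat_replicate fun j hj => ?_⟩
    · rw [Nat.zero_add]
      exact if_pos hj
    · have := compat_shift hd ht (fun b hb => P.1.blocks_pos hb) (compat_prism P)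
      simpa using this
    · simp only [List.sum_replicate, smul_eq_mul, mul_one, Nat.zero_add, P.1.blocks_sum]
      exact hlast j
  obtain ⟨Q, hQ1, hQ2, hQ3⟩ := exists_prism_of_compat hc (by
    intro b hb
    simp only [List.mem_append, List.mem_replicate] at hb
    rcases hb with hb | hb | hb
    · omega
    · exact P.1.blocks_pos hb
    · omega) hbs hcompat
  have hmk : wb.left p q h (Wb.mk P) = Wb.mk Q := by
    refine isGrafting_wb.left_mk p q h P Q (seqAt_injective fun j => ?_) (fun j hj => ?_)
      fun j => ?_
    · rw [hQ2, seqAt_pad]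
    · rw [hQ1]
      exact if_pos hj
    · rw [hQ1, hd]
  have hunit : ∀ τ, τ = 0 ∨ τ = 1 → ∀ x, g 1 x τ = η 1 () := by
    rintro τ (rfl | rfl) x
    · exact hg.map_zero 1 x
    · exact hg.map_one 1 x
  rw [hmk, evalMap_mk, evalMap_mk]
  apply sigma_mk_injective (β := O)
  rw [evalPrism_eq, hQ1, hQ2, hQ3, entries_append, entries_append, weakOps_left_eq,
    entries_replicate (e := η 1 ()) (fun j hj => hunit _ (Or.inl (by
      rw [Nat.zero_add]; exact if_pos hj)))]
  simp only [List.sum_replicate, smul_eq_mul, mul_one, Nat.zero_add, P.1.blocks_sum]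
  have hmid := entries_shift (g := g) (z := η 0 ()) hd ht 0 P.1.blocks
  rw [Nat.add_zero] at hmid
  rw [hmid, entries_replicate (e := η 1 ()) (fun j hj => hunit _ (Or.inr (by
      rw [Nat.add_assoc, ht]; exact hP.t_top _ (by omega))))]
  have hP' := evalPrism_eq M η g P
  rcases Nat.eq_zero_or_pos k with rfl | hk
  · -- there is no bead, and `η(a_0)` is absorbed by the units next to it
    have h0 : P.1.blocks = [] :=
      List.length_eq_zero_iff.1 (Nat.le_zero.1 P.1.length_le)
    rw [h0]
    have h1 := joinList_map_unit M hη (List.replicate p 1 ++ ([] ++ List.replicate q 1))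
    have h2 := joinList_map_unit M hη (List.replicate p 1 ++ ([0] ++ List.replicate q 1))
    simp only [List.map_append, List.map_replicate, List.map_nil, List.map_cons] at h1 h2
    rw [show evalPrism M η g P = η 0 () from rfl, h2, entries, h1]
    have h3 : (List.replicate p 1 ++ ([0] ++ List.replicate q 1)).sum =
        (List.replicate p 1 ++ ([] ++ List.replicate q 1)).sum := by simp
    rw [h3]
  · have h3 := joinList_flatten M (η 0 ()) (List.replicate p [⟨1, η 1 ()⟩] ++
      ([entries g (η 0 ()) (gapAt (gaps P)) (seqAt (times P)) 0 P.1.blocks] ++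
        List.replicate q [⟨1, η 1 ()⟩])) (by
        intro l hl
        simp only [List.mem_append, List.mem_replicate, List.mem_singleton] at hl
        rcases hl with ⟨-, rfl⟩ | rfl | ⟨-, rfl⟩
        · simp
        · rw [← List.length_pos_iff, length_entries]
          exact P.1.length_pos_iff.2 hk
        · simp)
    simp only [List.map_append, List.map_replicate, List.map_cons, List.map_nil,
      joinList_singleton, ← hP', List.flatten_append, List.flatten_cons, List.flatten_nil,
      List.append_nil] at h3
    have h4 : ∀ (m : ℕ) (e : Σ n, O n), (List.replicate m [e]).flatten = List.replicate m e := by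
      intro m e
      induction m with
      | zero => rfl
      | succ m ih => rw [List.replicate_succ, List.flatten_cons, ih]; rfl
    rw [h4, h4] at h3
    exact h3.symm

/-- The block of the block of an index, in a row of rows. -/
theorem locate_locate {K k r : ℕ} (ns : Fin K → ℕ) (e : ∑ i, ns i = k) (ls : ∀ i, Fin (ns i) → ℕ)
    (ks : Fin k → ℕ) (hks : ∀ s, ks s = ls (locate ns e s).1 (locate ns e s).2)
    (h : ∑ s, ks s = r) (h' : ∑ i, ∑ j, ls i j = r) (j : Fin r) :
    (locate ns e (locate ks h j).1).1 = (locate (fun i => ∑ j, ls i j) h' j).1 := by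
  subst e
  obtain rfl : ks = flat ls := funext hks
  exact (congrArg Sigma.fst (locate_flat ls h' h j)).symm

theorem sizeBefore_insert (p m : ℕ) {k : ℕ} (i : ℕ) (hi : i ≤ k) :
    sizeBefore (fun b : Fin k => if b.1 = p then m + 1 else 1) i = if i ≤ p then i else i + m := by
  induction i with
  | zero => simp [sizeBefore]
  | succ i ih =>
    rw [sizeBefore_succ (fun b : Fin k => if b.1 = p then m + 1 else 1) ⟨i, hi⟩, ih (by omega)]
    simp only
    split_ifs <;> omega

theorem locate_insert (p m q : ℕ) {k r : ℕ} (h : p + 1 + q = k) (h' : p + m + 1 + q = r)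
    (hs : ∑ b : Fin k, (if b.1 = p then m + 1 else 1) = r) (j : Fin r) :
    (locate (fun b : Fin k => if b.1 = p then m + 1 else 1) hs j).1.1 =
      (if j.1 < p then j.1 else if j.1 ≤ p + m then p else j.1 - m) ∧
    (locate (fun b : Fin k => if b.1 = p then m + 1 else 1) hs j).2.1 =
      if j.1 < p then 0 else if j.1 ≤ p + m then j.1 - p else 0 := by
  have hj := j.2
  have hb : (if j.1 < p then j.1 else if j.1 ≤ p + m then p else j.1 - m) < k := by
    split_ifs <;> omega
  have := locate_unique (fun b : Fin k => if b.1 = p then m + 1 else 1) hs (j := j)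
    (b := ⟨_, hb⟩) (o := if j.1 < p then 0 else if j.1 ≤ p + m then j.1 - p else 0)
    (by dsimp only; split_ifs <;> omega)
    (by rw [sizeBefore_insert p m _ hb.le]; split_ifs <;> omega)
  rw [this]
  exact ⟨rfl, rfl⟩

theorem evalMap_right (hg : IsBimodLoop M η g)
    (p m q : ℕ) {k r : ℕ} (h : p + 1 + q = k) (h' : p + m + 1 + q = r) (w : Wb k) :
    evalMap hg r (wb.right p m q h h' w) = (M.weakOps η).right p m q h h' (evalMap hg k w) := by
  obtain ⟨P, rfl⟩ := Wb.mk_surjective w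
  have hP := isConfig_prism P
  have hk : 0 < k := by omega
  let ks : Fin k → ℕ := fun b => if b.1 = p then m + 1 else 1
  have hks : ∀ b, 0 < ks b := fun b => by simp only [ks]; split_ifs <;> omega
  have hsum : ∑ b, ks b = r := by
    subst h; simp only [ks]; rw [sum_insert p q (m + 1)]; omega
  -- the arities of the operations that are grafted into the leaves of the bead `i`
  let ls : ∀ i, Fin (P.1.blocksFun i) → ℕ := fun i j =>
    ks (Fin.cast P.1.sum_blocksFun (finSigmaFinEquiv ⟨i, j⟩))
  have hls : ∀ s, ks s = ls (locate P.1.blocksFun P.1.sum_blocksFun s).1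
      (locate P.1.blocksFun P.1.sum_blocksFun s).2 := by
    intro s
    simp only [ls, locate]
    congr 1
    rw [Sigma.eta, Equiv.apply_symm_apply]
    rfl
  have hlpos : ∀ i j, 0 < ls i j := fun i j => hks _
  have hlsum : ∑ i, ∑ j, ls i j = r := by
    rw [← Fintype.sum_sigma' (f := ls), ← hsum]
    refine (Fintype.sum_equiv (finSigmaFinEquiv.symm.symm.trans (finCongr P.1.sum_blocksFun))
      _ _ fun x => ?_)
    rfl
  let N : Fin P.1.length → ℕ := fun i => ∑ j, ls i j
  have hN : ∀ i, 0 < N i := by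
    intro i
    have hb : 0 < P.1.blocksFun i := P.1.blocks_pos' _ _
    exact (hlpos i ⟨0, hb⟩).trans_le (Finset.single_le_sum (f := ls i)
      (fun _ _ => Nat.zero_le _) (Finset.mem_univ _))
  let y : ∀ i, Square (N i) := fun i => square.right (ls i) (hlpos i) rfl (P.2.1 i)
  -- the gaps and the parameters of the leaves after the grafting
  let D : Fin (r - 1) → unitInterval := joinCoord N hlsum y
  have hD : D = splitCoord ks hsum ⟨gaps P, hk⟩ := by
    have := right_left square P.1.blocksFun (P.1.length_pos_iff.2 hk) P.1.sum_blocksFun ls ks hls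
      hks hlpos hsum hlsum P.2.1
    exact (congrArg Subtype.val this).symm
  let d : ℕ → unitInterval := gapAt D
  let t : ℕ → unitInterval := seqAt (dup p m q h h' (times P))
  have ht : ∀ j, t j = seqAt (times P) (if j < p then j else if j ≤ p + m then p else j - m) :=
    seqAt_dup p m q h h' _
  have hd : ∀ j, d j = if p ≤ j ∧ j < p + m then 0 else
      gapAt (gaps P) (if j < p then j else if j ≤ p + m then p else j - m) := by
    intro j
    rcases Nat.lt_or_ge j r with hj | hj
    · simp only [d, hD]
      obtain ⟨h1, h2⟩ := locate_insert p m q h h' hsum ⟨j, hj⟩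
      have h3 := gapAt_splitCoord ks hsum hks ⟨gaps P, hk⟩ ⟨j, hj⟩
      rw [h3]
      simp only [ks]
      simp only at h1 h2
      have hcond : ((if j < p then 0 else if j ≤ p + m then j - p else 0) + 1 <
          (if (if j < p then j else if j ≤ p + m then p else j - m) = p then m + 1 else 1)) ↔
          (p ≤ j ∧ j < p + m) := by
        split_ifs <;> omega
      simp only [← hcond, ← h1, ← h2]
    · rw [show d j = 1 from gapAt_of_le _ (by omega), if_neg (by omega)]
      refine (gapAt_of_le _ ?_).symm
      split_ifs <;> omega
  have hc : IsConfig r d t := by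
    refine ⟨seqAt_monotone ?_, fun j => ?_, fun j hj => seqAt_of_le _ hj,
      fun j hj => gapAt_of_le _ hj⟩
    · refine dup_monotone p m q h h' fun i j hij => ?_
      exact P.2.2.2 (bead_monotone P.1 hij)
    · by_cases hj : p ≤ j ∧ j < p + m
      · right
        rw [ht, ht]
        congr 1
        split_ifs <;> omega
      · rw [hd, if_neg hj, ht, ht]
        have := hP.split (if j < p then j else if j ≤ p + m then p else j - m)
        have h2 : (if j + 1 < p then j + 1 else if j + 1 ≤ p + m then p else j + 1 - m) =
            (if j < p then j else if j ≤ p + m then p else j - m) + 1 := by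
          split_ifs <;> omega
        rw [h2]
        exact this
  have htN : ∀ j : Fin r, t j.1 = P.2.2.1 (locate N hlsum j).1 := by
    intro j
    refine (seqAt_val (dup p m q h h' (times P)) j).trans ?_
    rw [← locate_locate P.1.blocksFun P.1.sum_blocksFun ls ks hls hsum hlsum j]
    simp only [dup, times, bead]
    exact congrArg (fun i => P.2.2.1 (locate P.1.blocksFun P.1.sum_blocksFun i).1)
      (Fin.ext (locate_insert p m q h h' hsum j).1.symm)
  have hcompat : Compat d t 0 (List.ofFn N) :=
    compat_join N hN hlsum y P.2.2.1 (fun j => rfl) htN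
  obtain ⟨Q, hQ1, hQ2, hQ3⟩ := exists_prism_of_compat hc (by
    intro b hb
    obtain ⟨i, rfl⟩ := (List.mem_ofFn' _ _).1 hb
    exact hN i) (by rw [List.sum_ofFn]; exact hlsum) hcompat
  have hmk : wb.right p m q h h' (Wb.mk P) = Wb.mk Q := by
    refine isGrafting_wb.right_mk p m q h h' P Q (seqAt_injective fun j => ?_) (fun j hj => ?_)
      (fun j hj => ?_) fun j => ?_
    · rw [hQ2]
    · rw [hQ1, hd, if_neg (by omega), if_pos hj]
    · rw [hQ1, hd, if_pos (by omega)]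
    · rw [hQ1, hd, if_neg (by omega)]
      congr 1
      split_ifs <;> omega
  rw [hmk, evalMap_mk, evalMap_mk]
  apply sigma_mk_injective (β := O)
  have hE : (M.weakOps η).right p m q h h' (evalPrism M η g P) =
      M.right ks hks hsum (evalPrism M η g P) := rfl
  have hP' : evalPrism M η g P = M.left P.1.blocksFun (P.1.length_pos_iff.2 hk) P.1.sum_blocksFun
    (fun b => g (P.1.blocksFun b) (P.2.1 b) (P.2.2.1 b)) := dif_pos hk
  rw [hE, hP',
    right_left M P.1.blocksFun _ P.1.sum_blocksFun ls ks hls hks hlpos hsum hlsum,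
    evalPrism_eq, hQ1, hQ2, hQ3, entries_join N hN hlsum y P.2.2.1 (fun j => rfl) htN,
    joinList_ofFn _ _ _ (P.1.length_pos_iff.2 hk), left_eq_row]
  congr 1
  funext i
  congr 1
  exact (hg.isBimodHom (P.2.2.1 i)).map_right (ls i) (hlpos i) rfl (P.2.1 i)

theorem evalMap_isWeakHom (hη : IsBimodHom assoc.toBimodOps M.toBimodOps η)
    (hg : IsBimodLoop M η g) : IsWeakHom wb.toWeakOps (M.weakOps η) (evalMap hg) where
  continuous := continuous_evalMap hg
  map_left p q _ _ h w := evalMap_left hη hg p q h w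
  map_right p m q _ _ h h' w := evalMap_right hg p m q h h' w

end EvaluationMap

/-! ### Generation by nondegenerate elements -/

theorem IsDegenerate.map {X : ℕ → Type u} {Y : ℕ → Type v} [∀ n, TopologicalSpace (X n)]
    [∀ n, TopologicalSpace (Y n)] {A : WeakOps X} {B : WeakOps Y} {f : ∀ n, X n → Y n}
    (hf : IsWeakHom A B f) {n : ℕ} {x : X n} (h : IsDegenerate A n x) :
    IsDegenerate B n (f n x) := by
  obtain ⟨i, hi, y⟩ := h
  rw [hf.map_coface]
  exact .coface i hi _

section Saturated

variable {X : ℕ → Type u} {A : WeakOps X}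

/-- A weak sub-bimodule of a regular weak bimodule is saturated if it contains an element
as soon as it contains one of its cofaces. -/
def SubWeak.IsSaturated (S : SubWeak A) : Prop :=
  ∀ n i (hi : i ≤ n + 1) (x : X n), A.coface i hi x ∈ S.carrier (n + 1) → x ∈ S.carrier n

/-- A saturated weak sub-bimodule is determined by its nondegenerate elements. -/
theorem SubWeak.IsSaturated.subset {S T : SubWeak A} (hS : S.IsSaturated)
    (h : ∀ n x, x ∈ S.carrier n → ¬ IsDegenerate A n x → x ∈ T.carrier n) (n : ℕ) :
    S.carrier n ⊆ T.carrier n := by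
  induction n with
  | zero => exact fun x hx => h 0 x hx fun hd => absurd hd.degree_pos (lt_irrefl _)
  | succ n ih =>
    intro x hx
    by_cases hd : IsDegenerate A (n + 1) x
    · obtain ⟨i, hi, y, rfl⟩ := hd.exists
      exact T.coface_mem i hi (ih (hS n i hi y hx))
    · exact h _ x hx hd

/-- The elements obtained by coface operators from nondegenerate elements of `G`. -/
inductive GeneratedFrom (A : WeakOps X) (G : ∀ n, Set (X n)) : ∀ n, X n → Prop
  | base {n : ℕ} (x : X n) : x ∈ G n → ¬ IsDegenerate A n x → GeneratedFrom A G n x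
  | coface {n : ℕ} (i : ℕ) (hi : i ≤ n + 1) (x : X n) :
      GeneratedFrom A G n x → GeneratedFrom A G (n + 1) (A.coface i hi x)

variable {G : ∀ n, Set (X n)}

theorem GeneratedFrom.mem {n : ℕ} {x : X n} (h : GeneratedFrom A G n x)
    (hx : ¬ IsDegenerate A n x) : x ∈ G n := by
  cases h with
  | base _ h => exact h
  | coface i hi x => exact absurd (.coface i hi x) hx

theorem GeneratedFrom.exists {n : ℕ} {x : X (n + 1)} (h : GeneratedFrom A G (n + 1) x)
    (hx : IsDegenerate A (n + 1) x) :
    ∃ i, ∃ hi : i ≤ n + 1, ∃ y : X n, A.coface i hi y = x ∧ GeneratedFrom A G n y := by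
  have : ∀ m (z : X m) (h : GeneratedFrom A G m z) (e : m = n + 1) (hz : e ▸ z = x),
      ∃ i, ∃ hi : i ≤ n + 1, ∃ y : X n, A.coface i hi y = x ∧ GeneratedFrom A G n y := by
    rintro m z h e hz
    cases h with
    | base _ _ hn =>
      subst e
      subst hz
      exact absurd hx hn
    | coface i hi y hy =>
      obtain rfl := Nat.succ_injective e
      exact ⟨i, hi, y, hz, hy⟩
  exact this _ x h rfl rfl

/-- By the diamond property, the elements generated by nondegenerate ones form a saturated
part. -/
theorem GeneratedFrom.of_coface (hA : IsRegular A) {n : ℕ} : ∀ {i : ℕ} (hi : i ≤ n + 1) {x : X n},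
    GeneratedFrom A G (n + 1) (A.coface i hi x) → GeneratedFrom A G n x := by
  induction n with
  | zero =>
    intro i hi x h
    obtain ⟨j, hj, y, he, hy⟩ := h.exists (.coface i hi x)
    obtain rfl | rfl : i = 0 ∨ i = 1 := by omega
    all_goals obtain rfl | rfl : j = 0 ∨ j = 1 := by omega
    · rwa [hA.injective _ _ _ he] at hy
    · exact absurd he.symm (hA.coface_ne _ _)
    · exact absurd he (hA.coface_ne _ _)
    · rwa [hA.injective _ _ _ he] at hy
  | succ n ih =>
    intro i hi x h
    obtain ⟨j, hj, y, he, hy⟩ := h.exists (.coface i hi x)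
    rcases lt_trichotomy i j with hij | rfl | hij
    · obtain ⟨z, rfl, rfl⟩ := hA.diamond n i j hij hj x y he.symm
      exact .coface _ _ _ (ih _ hy)
    · rwa [hA.injective _ _ _ he] at hy
    · obtain ⟨z, rfl, rfl⟩ := hA.diamond n j i hij hi y x he
      exact .coface _ _ _ (ih _ hy)

/-- Degenerate generators are superfluous if all elements of lower degree are generators. -/
theorem generatedFrom_of_le {N : ℕ} (hG : ∀ n, n < N → ∀ x, x ∈ G n) {n : ℕ} (hn : n ≤ N)
    {x : X n} (hx : x ∈ G n) : GeneratedFrom A G n x := by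
  induction n with
  | zero => exact .base x hx fun hd => absurd hd.degree_pos (lt_irrefl _)
  | succ n ih =>
    by_cases hd : IsDegenerate A (n + 1) x
    · obtain ⟨i, hi, y, rfl⟩ := hd.exists
      exact .coface i hi y (ih (by omega) (hG n hn y))
    · exact .base x hx hd

/-- A weak sub-bimodule generated by everything in the degrees below `N` and some elements of
degree `N` consists of the cofaces of its nondegenerate generators. -/
theorem mem_generate_iff (hA : IsRegular A) {N : ℕ} (hG : ∀ n, n < N → ∀ x, x ∈ G n)
    (hG' : ∀ n x, x ∈ G n → n ≤ N) {n : ℕ} {x : X n} :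
    x ∈ (SubWeak.generate A G).carrier n ↔ GeneratedFrom A G n x := by
  constructor
  · intro h
    exact h (SubWeak.ofCoface hA.generated (fun n => {x | GeneratedFrom A G n x})
      fun n i hi x hx => .coface i hi x hx) fun m y hy => generatedFrom_of_le hG (hG' m y hy) hy
  · intro h S hS
    induction h with
    | base x hx _ => exact hS _ hx
    | coface i hi x _ ih => exact S.coface_mem i hi ih

theorem generate_isSaturated (hA : IsRegular A) {N : ℕ} (hG : ∀ n, n < N → ∀ x, x ∈ G n)
    (hG' : ∀ n x, x ∈ G n → n ≤ N) : (SubWeak.generate A G).IsSaturated := by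
  intro n i hi x h
  rw [mem_generate_iff hA hG hG'] at h ⊢
  exact h.of_coface hA

theorem mem_generate_of_mem {n : ℕ} {x : X n} (h : x ∈ G n) :
    x ∈ (SubWeak.generate A G).carrier n := fun _ hS => hS n h

end Saturated

/-! ### Nondegenerate points of the prisms -/

theorem isDegenerate_wb_iff {n : ℕ} (w : Wb n) : IsDegenerate wb.toWeakOps n w ↔
    IsDegenerate tri.toWeakOps n (wbHomeo n w) := by
  refine ⟨fun h => h.map wbHomeo_isWeakHom, fun h => ?_⟩
  have := h.map wbHomeo_symm_isWeakHom
  rwa [Homeomorph.symm_apply_apply] at this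

/-- Nondegenerate points of a prism have all their parameters in `(0, 1)`, and nonzero
distances. -/
theorem not_isDegenerate_mk {n : ℕ} (P : Prisms n) : ¬ IsDegenerate wb.toWeakOps n (Wb.mk P) ↔
    (∀ j, 0 < times P j ∧ times P j < 1) ∧ ∀ j, 0 < gaps P j := by
  have hP := isConfig_prism P
  rw [isDegenerate_wb_iff, wbHomeo_mk, not_isDegenerate_tri]
  simp only [seqAt_stretchPrism]
  have hpos : ∀ j, (0 : ℝ) < stretchFactor (gapAt (gaps P)) (seqAt (times P)) j :=
    stretchFactor_pos _ _
  have hle := stretchFactor_le_one (gapAt (gaps P)) (seqAt (times P))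
  have heq := stretch_eq (gapAt (gaps P)) (seqAt (times P))
  constructor
  · rintro ⟨h1, h2⟩
    have ht : ∀ j, 0 < times P j ∧ times P j < 1 := by
      intro j
      constructor
      · have h3 := (h1 0 (by have := j.2; omega)).1
        have h4 : stretch (gapAt (gaps P)) (seqAt (times P)) 0 = seqAt (times P) 0 := by
          apply Subtype.ext
          simp [stretch, stretchFactor]
        rw [h4] at h3
        rw [← seqAt_val (times P)]
        exact h3.trans_le (hP.mono (Nat.zero_le _))
      · rw [← seqAt_val (times P)]
        refine lt_of_le_of_ne (unitInterval.le_one _) fun h3 => ?_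
        exact (h1 j.1 j.2).2.ne (stretch_eq_one h3)
    refine ⟨ht, fun j => lt_of_le_of_ne (unitInterval.nonneg _) fun h3 => ?_⟩
    have hg : gapAt (gaps P) j.1 = 0 := by
      rw [gapAt, dif_pos j.2]
      exact h3.symm
    have h4 := hP.split j.1
    rw [hg] at h4
    have h4 := h4.resolve_left zero_ne_one
    refine (h2 j.1 (by omega)).ne (Subtype.ext ?_)
    have h5 := heq (j.1 + 1)
    rw [stretchFactor_succ, hg, ← h4] at h5
    have h6 := heq j.1
    simp only [Set.Icc.coe_zero, zero_mul, zero_div, sub_zero, mul_one] at h5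
    linarith
  · rintro ⟨h1, h2⟩
    have ht : ∀ j, j < n → (0 : ℝ) < seqAt (times P) j ∧ (seqAt (times P) j : ℝ) < 1 := by
      intro j hj
      have := h1 ⟨j, hj⟩
      rw [← seqAt_val (times P)] at this
      exact this
    refine ⟨fun j hj => ⟨?_, ?_⟩, fun j hj => ?_⟩
    · change (0 : ℝ) < stretch _ _ j
      have := mul_le_of_le_one_right (sub_nonneg.2 (ht j hj).2.le) (hle j)
      linarith [heq j, (ht j hj).1]
    · change (stretch _ _ j : ℝ) < 1
      have := mul_pos (sub_pos.2 (ht j hj).2) (hpos j)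
      linarith [heq j]
    · change (stretch _ _ j : ℝ) < stretch _ _ (j + 1)
      have h3 : (0 : ℝ) < gapAt (gaps P) j := by
        rw [gapAt, dif_pos (show j < n - 1 by omega)]
        exact h2 _
      have h4 : (seqAt (times P) j : ℝ) ≤ seqAt (times P) (j + 1) := hP.mono (Nat.le_succ j)
      have h5 := heq (j + 1)
      rw [stretchFactor_succ] at h5
      have h6 := mul_pos h3 (ht j (by omega)).1
      have h7 := mul_pos (mul_pos (sub_pos.2 (ht (j + 1) hj).2) (hpos j)) h6
      have h8 := mul_nonneg (sub_nonneg.2 h4) (hpos j).le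
      have h9 := heq j
      nlinarith

/-- The coordinates of a nondegenerate element are unique. -/
theorem coords_eq_of_mk_eq {n : ℕ} {P Q : Prisms n} (h : Wb.mk P = Wb.mk Q)
    (hP : ¬ IsDegenerate wb.toWeakOps n (Wb.mk P)) : gaps P = gaps Q ∧ times P = times Q := by
  have hs : stretchPrism P = stretchPrism Q := by rw [← wbHomeo_mk, h, wbHomeo_mk]
  obtain ⟨ht, hd⟩ := (isConfig_prism P).eq_of_stretch_eq (isConfig_prism Q) fun j => by
    rw [← seqAt_stretchPrism, hs, seqAt_stretchPrism]
  refine ⟨funext fun j => ?_, seqAt_injective fun j => congrFun ht j⟩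
  have h1 := ((not_isDegenerate_mk P).1 hP).1 ⟨j.1, by omega⟩
  rw [← seqAt_val (times P)] at h1
  have h2 := (hd j.1).resolve_right (not_or.2 ⟨h1.1.ne', h1.2.ne⟩)
  rw [gapAt, gapAt, dif_pos j.2, dif_pos j.2] at h2
  exact h2

/-! ### Cells of the prisms -/

section Cells

variable {N : ℕ} (A : Finset (Fin N)) (C : Finset (Fin (N - 1)))

/-- The open cell of the prisms with `N` leaves where the parameters increase in the leaves in `A`,
and where the distances after the leaves in `C` are less than `1`. Its coordinates are the different
parameters and these distances. -/
def openCell : Set (A ⊕ C → ℝ) :=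
  {y | (∀ e, y e ∈ Set.Ioo (0 : ℝ) 1) ∧ ∀ a b : A, a.1 < b.1 → y (.inl a) < y (.inl b)}

theorem convex_openCell : Convex ℝ (openCell A C) := by
  rintro x ⟨hx, hx'⟩ y ⟨hy, hy'⟩ a b ha hb hab
  refine ⟨fun e => convex_Ioo (0 : ℝ) 1 (hx e) (hy e) ha hb hab, fun i j hij => ?_⟩
  have := convex_Ioi (0 : ℝ) (sub_pos.2 (hx' i j hij)) (sub_pos.2 (hy' i j hij)) ha hb hab
  simp only [smul_eq_mul, Set.mem_Ioi] at this
  simp only [Pi.add_apply, Pi.smul_apply, smul_eq_mul]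
  linarith

theorem isOpen_openCell : IsOpen (openCell A C) := by
  have h1 : IsOpen {y : A ⊕ C → ℝ | ∀ e, y e ∈ Set.Ioo (0 : ℝ) 1} := by
    simp only [Set.ofPred_forall]
    exact isOpen_iInter_of_finite fun e => isOpen_Ioo.preimage (continuous_apply e)
  have h2 : IsOpen {y : A ⊕ C → ℝ | ∀ a b : A, a.1 < b.1 → y (.inl a) < y (.inl b)} := by
    simp only [Set.ofPred_forall]
    exact isOpen_iInter_of_finite fun a => isOpen_iInter_of_finite fun b =>
      isOpen_iInter_of_finite fun _ => isOpen_lt (continuous_apply _) (continuous_apply _)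
  exact h1.inter h2

theorem openCell_nonempty : (openCell A C).Nonempty := by
  refine ⟨Sum.elim (fun a => (a.1.1 + 1) / (N + 1)) fun _ => 1 / 2, ?_, fun a b hab => ?_⟩
  · rintro (a | c)
    · have h2 : (a.1.1 : ℝ) + 1 < N + 1 := by exact_mod_cast Nat.succ_lt_succ a.1.2
      exact ⟨by simp only [Sum.elim_inl]; positivity, (div_lt_one (by positivity)).2 h2⟩
    · simp only [Sum.elim_inr]
      norm_num
  · have h2 : (a.1.1 : ℝ) + 1 < b.1.1 + 1 := by exact_mod_cast Nat.succ_lt_succ hab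
    exact div_lt_div_of_pos_right h2 (by positivity)

theorem isBounded_openCell : Bornology.IsBounded (openCell A C) := by
  refine (Metric.isBounded_Icc (0 : A ⊕ C → ℝ) 1).subset ?_
  rintro x ⟨hx, -⟩
  exact ⟨fun i => (hx i).1.le, fun i => (hx i).2.le⟩

theorem closure_openCell_subset : closure (openCell A C) ⊆
    {y | (∀ e, y e ∈ Set.Icc (0 : ℝ) 1) ∧ ∀ a b : A, a.1 < b.1 → y (.inl a) ≤ y (.inl b)} := by
  refine closure_minimal (fun y hy => ⟨fun e => Set.Ioo_subset_Icc_self (hy.1 e),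
    fun a b hab => (hy.2 a b hab).le⟩) ?_
  have h1 : IsClosed {y : A ⊕ C → ℝ | ∀ e, y e ∈ Set.Icc (0 : ℝ) 1} := by
    simp only [Set.ofPred_forall]
    exact isClosed_iInter fun e => isClosed_Icc.preimage (continuous_apply e)
  have h2 : IsClosed {y : A ⊕ C → ℝ | ∀ a b : A, a.1 < b.1 → y (.inl a) ≤ y (.inl b)} := by
    simp only [Set.ofPred_forall]
    exact isClosed_iInter fun a => isClosed_iInter fun b =>
      isClosed_iInter fun _ => isClosed_le (continuous_apply _) (continuous_apply _)
  exact h1.inter h2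

variable {A C}

/-- The coordinates of a cell, truncated to the unit interval. -/
noncomputable def cellCoord (y : A ⊕ C → ℝ) (e : A ⊕ C) : unitInterval :=
  Set.projIcc 0 1 zero_le_one (y e)

theorem coe_cellCoord {y : A ⊕ C → ℝ} {e : A ⊕ C} (h : y e ∈ Set.Icc (0 : ℝ) 1) :
    (cellCoord y e : ℝ) = y e := by
  rw [cellCoord, Set.projIcc_of_mem _ h]

/-- The parameter of a leaf is the coordinate of the last leaf of `A` that is not after it. -/
noncomputable def cellTime (y : A ⊕ C → ℝ) (j : Fin N) : unitInterval :=
  (Finset.univ.filter fun a : A => a.1 ≤ j).sup fun a => cellCoord y (.inl a)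

/-- The distances after the leaves. -/
noncomputable def cellGap (y : A ⊕ C → ℝ) (j : Fin (N - 1)) : unitInterval :=
  if h : j ∈ C then cellCoord y (.inr ⟨j, h⟩) else 1

theorem continuous_cellCoord (e : A ⊕ C) : Continuous fun y : A ⊕ C → ℝ => cellCoord y e :=
  continuous_projIcc.comp (continuous_apply e)

theorem continuous_cellTime (j : Fin N) : Continuous fun y : A ⊕ C → ℝ => cellTime y j :=
  Continuous.finset_sup_apply fun _ _ => continuous_cellCoord _

theorem continuous_cellGap (j : Fin (N - 1)) : Continuous fun y : A ⊕ C → ℝ => cellGap y j := by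
  unfold cellGap
  split_ifs
  · exact continuous_cellCoord _
  · exact continuous_const

theorem cellTime_monotone (y : A ⊕ C → ℝ) : Monotone (cellTime y) := fun i j hij =>
  Finset.sup_mono fun a ha => by
    simp only [Finset.mem_filter, Finset.mem_univ, true_and] at ha ⊢
    exact ha.trans hij

theorem cellCoord_le_cellTime (y : A ⊕ C → ℝ) {a : A} {j : Fin N} (h : a.1 ≤ j) :
    cellCoord y (.inl a) ≤ cellTime y j :=
  Finset.le_sup (f := fun a : A => cellCoord y (.inl a)) (by simpa using h)

theorem exists_cellTime_eq {y : A ⊕ C → ℝ} {j : Fin N} (h : 0 < cellTime y j) :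
    ∃ a : A, a.1 ≤ j ∧ cellTime y j = cellCoord y (.inl a) := by
  have hne : (Finset.univ.filter fun a : A => a.1 ≤ j).Nonempty := by
    by_contra hne
    rw [cellTime, Finset.not_nonempty_iff_eq_empty.1 hne, Finset.sup_empty] at h
    exact lt_irrefl _ h
  obtain ⟨a, ha, h1⟩ := Finset.exists_mem_eq_sup _ hne fun a : A => cellCoord y (.inl a)
  exact ⟨a, by simpa using ha, h1⟩

theorem cellTime_eq {y : A ⊕ C → ℝ} (hy : y ∈ openCell A C) (a : A) :
    cellTime y a.1 = cellCoord y (.inl a) := by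
  refine le_antisymm (Finset.sup_le fun b hb => ?_) (cellCoord_le_cellTime y le_rfl)
  simp only [Finset.mem_filter, Finset.mem_univ, true_and] at hb
  refine Set.monotone_projIcc _ ?_
  rcases hb.lt_or_eq with hb | hb
  · exact (hy.2 b a hb).le
  · rw [Subtype.ext hb]

theorem cellCoord_mem {y : A ⊕ C → ℝ} (hy : y ∈ openCell A C) (e : A ⊕ C) :
    0 < cellCoord y e ∧ cellCoord y e < 1 := by
  have h := coe_cellCoord (Set.Ioo_subset_Icc_self (hy.1 e))
  have h1 := hy.1 e
  rw [← h] at h1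
  exact h1

theorem cellGap_eq (y : A ⊕ C → ℝ) (c : C) : cellGap y c.1 = cellCoord y (.inr c) := dif_pos c.2

/-- The parameters do not increase outside of `A`. -/
theorem cellTime_succ (y : A ⊕ C → ℝ) {i j : Fin N} (hij : j.1 = i.1 + 1) (hj : j ∉ A) :
    cellTime y i = cellTime y j := by
  rw [cellTime, cellTime]
  congr 1
  ext a
  simp only [Finset.mem_filter, Finset.mem_univ, true_and]
  have : a.1 ≠ j := fun h => hj (h ▸ a.2)
  have : a.1.1 ≠ j.1 := fun h => this (Fin.ext h)
  simp only [Fin.le_def]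
  omega

theorem exists_cellTime_eq_of_mem {y : A ⊕ C → ℝ} {s : unitInterval}
    (h : s ∈ interiorValues (cellTime y)) : ∃ a : A, s = cellCoord y (.inl a) := by
  obtain ⟨⟨j, rfl⟩, h0, -⟩ := h
  obtain ⟨a, -, ha⟩ := exists_cellTime_eq h0
  exact ⟨a, ha⟩

theorem mem_of_cellGap_lt {y : A ⊕ C → ℝ} {j : Fin (N - 1)} (h : cellGap y j < 1) : j ∈ C := by
  by_contra hj
  rw [cellGap, dif_neg hj] at h
  exact lt_irrefl _ h

theorem ncard_interiorValues_le (y : A ⊕ C → ℝ) :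
    (interiorValues (cellTime y)).ncard ≤ A.card := by
  classical
  have h1 : interiorValues (cellTime y) ⊆
      ↑((Finset.univ : Finset A).image fun a => cellCoord y (.inl a)) := by
    intro s hs
    obtain ⟨a, rfl⟩ := exists_cellTime_eq_of_mem hs
    simp
  refine (Set.ncard_le_ncard h1 (Finset.finite_toSet _)).trans ?_
  rw [Set.ncard_coe_finset]
  exact Finset.card_image_le.trans (by simp)

theorem ncard_gaps_le (y : A ⊕ C → ℝ) :
    {j : Fin (N - 1) | 0 < cellGap y j ∧ cellGap y j < 1}.ncard ≤ C.card := by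
  have h1 : {j : Fin (N - 1) | 0 < cellGap y j ∧ cellGap y j < 1} ⊆ ↑C :=
    fun j hj => mem_of_cellGap_lt hj.2
  exact (Set.ncard_le_ncard h1 (Finset.finite_toSet _)).trans (Set.ncard_coe_finset C).le

theorem le_ncard_interiorValues {y : A ⊕ C → ℝ} (hy : y ∈ openCell A C) :
    A.card ≤ (interiorValues (cellTime y)).ncard := by
  have h1 : Set.range (fun a : A => cellCoord y (.inl a)) ⊆ interiorValues (cellTime y) := by
    rintro _ ⟨a, rfl⟩
    exact ⟨⟨a.1, cellTime_eq hy a⟩, cellCoord_mem hy _⟩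
  have h2 : Function.Injective fun a : A => cellCoord y (.inl a) := by
    intro a b hab
    have hab : y (.inl a) = y (.inl b) := by
      rw [← coe_cellCoord (Set.Ioo_subset_Icc_self (hy.1 (.inl a))),
        ← coe_cellCoord (Set.Ioo_subset_Icc_self (hy.1 (.inl b)))]
      exact congrArg _ hab
    rcases lt_trichotomy a.1 b.1 with h | h | h
    · exact absurd hab (hy.2 a b h).ne
    · exact Subtype.ext h
    · exact absurd hab (hy.2 b a h).ne'
  have h3 := Set.ncard_le_ncard h1 ((Set.finite_range (cellTime y)).subset fun s hs => hs.1)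
  rw [← Set.image_univ, Set.ncard_image_of_injective _ h2, Set.ncard_univ] at h3
  simpa using h3

theorem le_ncard_gaps {y : A ⊕ C → ℝ} (hy : y ∈ openCell A C) :
    C.card ≤ {j : Fin (N - 1) | 0 < cellGap y j ∧ cellGap y j < 1}.ncard := by
  have h1 : ↑C ⊆ {j : Fin (N - 1) | 0 < cellGap y j ∧ cellGap y j < 1} := by
    intro c hc
    have h2 := cellCoord_mem hy (.inr ⟨c, hc⟩)
    rwa [← cellGap_eq] at h2
  exact (Set.ncard_coe_finset C).ge.trans (Set.ncard_le_ncard h1 (Set.toFinite _))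

/-- On the boundary of a cell the dimension drops: one of the coordinates becomes `0` or `1`, or
two of the parameters become equal. -/
theorem ncard_lt_of_boundary {y : A ⊕ C → ℝ} (hy : y ∈ closure (openCell A C))
    (hy' : y ∉ openCell A C) :
    {j : Fin (N - 1) | 0 < cellGap y j ∧ cellGap y j < 1}.ncard +
      (interiorValues (cellTime y)).ncard < A.card + C.card := by
  classical
  obtain ⟨h01, hmono⟩ := closure_openCell_subset A C hy
  have hcases : (∃ c : C, ¬ (0 < cellCoord y (.inr c) ∧ cellCoord y (.inr c) < 1)) ∨
      ∃ a : A, ¬ (0 < cellCoord y (.inl a) ∧ cellCoord y (.inl a) < 1) ∨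
        ∃ b, b ≠ a ∧ cellCoord y (.inl a) = cellCoord y (.inl b) := by
    by_contra hcon
    simp only [not_or, not_exists, not_not] at hcon
    refine hy' ⟨?_, fun a b hab => lt_of_le_of_ne (hmono a b hab) fun he => ?_⟩
    · have key : ∀ e, 0 < cellCoord y e ∧ cellCoord y e < 1 := by
        rintro (a | c)
        · exact (hcon.2 a).1
        · exact hcon.1 c
      intro e
      have h := key e
      rw [← coe_cellCoord (h01 e)]
      exact h
    · refine (hcon.2 a).2 b ⟨fun h => hab.ne (congrArg Subtype.val h).symm, ?_⟩
      rw [cellCoord, cellCoord, he]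
  rcases hcases with ⟨c, hc⟩ | ⟨a, ha⟩
  · have h1 : {j : Fin (N - 1) | 0 < cellGap y j ∧ cellGap y j < 1} ⊆ ↑(C.erase c.1) := by
      intro j hj
      refine Finset.mem_coe.2 (Finset.mem_erase.2 ⟨fun h => hc ?_, mem_of_cellGap_lt hj.2⟩)
      rw [← cellGap_eq, ← h]
      exact hj
    have h2 := Set.ncard_le_ncard h1 (Finset.finite_toSet _)
    rw [Set.ncard_coe_finset, Finset.card_erase_of_mem c.2] at h2
    have h3 := Finset.card_pos.2 ⟨c.1, c.2⟩
    have h4 := ncard_interiorValues_le y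
    omega
  · have h1 : interiorValues (cellTime y) ⊆
        ↑(((Finset.univ : Finset A).erase a).image fun a => cellCoord y (.inl a)) := by
      intro s hs
      have hs' := hs.2
      obtain ⟨a', rfl⟩ := exists_cellTime_eq_of_mem hs
      refine Finset.mem_coe.2 (Finset.mem_image.2 ?_)
      by_cases haa : a' = a
      · subst haa
        rcases ha with ha | ⟨b, hb, hab⟩
        · exact absurd hs' ha
        · exact ⟨b, by simpa using hb, hab.symm⟩
      · exact ⟨a', by simpa using haa, rfl⟩
    have h2 := Set.ncard_le_ncard h1 (Finset.finite_toSet _)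
    rw [Set.ncard_coe_finset] at h2
    have h3 := h2.trans Finset.card_image_le
    rw [Finset.card_erase_of_mem (Finset.mem_univ _), Finset.card_univ, Fintype.card_coe] at h3
    have h4 := Finset.card_pos.2 ⟨a.1, a.2⟩
    have h5 := ncard_gaps_le y
    omega

/-- Points of the open cell are determined by their distances and parameters. -/
theorem openCell_ext {y y' : A ⊕ C → ℝ} (hy : y ∈ openCell A C) (hy' : y' ∈ openCell A C)
    (ht : cellTime y = cellTime y') (hd : cellGap y = cellGap y') : y = y' := by
  funext e
  rw [← coe_cellCoord (Set.Ioo_subset_Icc_self (hy.1 e)),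
    ← coe_cellCoord (Set.Ioo_subset_Icc_self (hy'.1 e))]
  rcases e with a | c
  · rw [← cellTime_eq hy, ← cellTime_eq hy', ht]
  · rw [← cellGap_eq, ← cellGap_eq, hd]

/-- The closed cells are discs. -/
theorem exists_cell_homeomorph {d : ℕ} (h : A.card + C.card = d) :
    ∃ e : Disc d ≃ₜ closure (openCell A C), ∀ v, ‖v.1‖ < 1 ↔ (e v).1 ∈ openCell A C := by
  have ho := (isOpen_openCell A C).interior_eq
  obtain ⟨e, he⟩ := exists_disc_homeomorph_closure (convex_openCell A C)
    (by rw [ho]; exact openCell_nonempty A C) (isBounded_openCell A C) (d := d) (by simp [h])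
  rw [ho] at he
  exact ⟨e, he⟩

end Cells

/-! ### The filtration of the simplices by their skeleta -/

theorem interiorValues_coface {n : ℕ} (i : ℕ) (hi : i ≤ n + 1) (t : Tri n) :
    interiorValues (tri.coface i hi t).1 = interiorValues t.1 := by
  ext s
  constructor
  · rintro ⟨⟨j, rfl⟩, h0, h1⟩
    refine ⟨?_, h0, h1⟩
    rw [← seqAt_val (tri.coface i hi t).1, seqAt_coface] at h0 h1 ⊢
    have key : ∀ a, seqAt t.1 a < 1 → seqAt t.1 a ∈ Set.range t.1 := by
      intro a ha
      by_cases h : a < n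
      · exact ⟨⟨a, h⟩, (seqAt_val t.1 ⟨a, h⟩).symm⟩
      · rw [seqAt_of_le _ (by omega)] at ha
        exact absurd ha (lt_irrefl _)
    split_ifs at h0 h1 ⊢
    · exact key _ h1
    · exact absurd h0 (lt_irrefl _)
    · exact key _ h1
  · rintro ⟨⟨j, rfl⟩, h0, h1⟩
    refine ⟨?_, h0, h1⟩
    have hj := j.2
    rw [← seqAt_val t.1]
    by_cases h : j.1 < i
    · refine ⟨⟨j.1, by omega⟩, ?_⟩
      rw [← seqAt_val (tri.coface i hi t).1, seqAt_coface, if_pos h]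
    · refine ⟨⟨j.1 + 1, by omega⟩, ?_⟩
      rw [← seqAt_val (tri.coface i hi t).1, seqAt_coface, if_neg (by simp only; omega),
        if_neg (by simp)]
      rfl

theorem triSkeleton_isSaturated (N : ℕ) : (triSkeleton N).IsSaturated := by
  intro n i hi t ht
  change (interiorValues _).ncard ≤ N at ht
  rwa [interiorValues_coface] at ht

theorem ncard_interiorValues_le_degree {n : ℕ} (t : Fin n → unitInterval) :
    (interiorValues t).ncard ≤ n := by
  have h1 : interiorValues t ⊆ t '' Set.univ := fun s hs => by simpa using hs.1
  have h2 := (Set.ncard_le_ncard h1 (Set.toFinite _)).trans (Set.ncard_image_le (Set.toFinite _))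
  simpa [Set.ncard_univ] using h2

theorem ncard_interiorValues_of_strictMono {n : ℕ} {t : Fin n → unitInterval} (ht : StrictMono t)
    (h : ∀ j, 0 < t j ∧ t j < 1) : (interiorValues t).ncard = n := by
  have h1 : interiorValues t = t '' Set.univ := by
    ext s
    constructor
    · rintro ⟨⟨j, rfl⟩, -⟩
      exact ⟨j, trivial, rfl⟩
    · rintro ⟨j, -, rfl⟩
      exact ⟨⟨j, rfl⟩, h j⟩
  rw [h1, Set.ncard_image_of_injective _ ht.injective]
  simp [Set.ncard_univ]

theorem not_isDegenerate_tri_iff {n : ℕ} (t : Tri n) : ¬ IsDegenerate tri.toWeakOps n t ↔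
    (∀ j, 0 < t.1 j ∧ t.1 j < 1) ∧ StrictMono t.1 := by
  rw [not_isDegenerate_tri]
  constructor
  · rintro ⟨h1, h2⟩
    refine ⟨fun j => by rw [← seqAt_val t.1]; exact h1 j.1 j.2, fun i j hij => ?_⟩
    have hij : i.1 < j.1 := hij
    have hj := j.2
    rw [← seqAt_val t.1, ← seqAt_val t.1]
    exact (h2 i.1 (by omega)).trans_le (seqAt_monotone t.2 hij)
  · rintro ⟨h1, h2⟩
    refine ⟨fun j hj => ?_, fun j hj => ?_⟩
    · rw [seqAt, dif_pos hj]
      exact h1 _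
    · rw [seqAt, dif_pos (by omega), seqAt, dif_pos hj]
      exact h2 (Nat.lt_succ_self j)

theorem mem_triSkeleton_iff {n : ℕ} {t : Tri n} (ht : ¬ IsDegenerate tri.toWeakOps n t) (N : ℕ) :
    t ∈ (triSkeleton N).carrier n ↔ n ≤ N := by
  rw [not_isDegenerate_tri_iff] at ht
  change (interiorValues t.1).ncard ≤ N ↔ n ≤ N
  rw [ncard_interiorValues_of_strictMono ht.2 ht.1]

theorem triSkeleton_isCellFiltration : IsCellFiltration tri.toWeakOps triSkeleton := by
  have hcell := fun N : ℕ => exists_cell_homeomorph (A := (Finset.univ : Finset (Fin N)))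
    (C := (∅ : Finset (Fin (N - 1)))) (d := N) (by simp)
  choose e he using hcell
  have hnondeg : ∀ N (v : Disc N), ‖v.1‖ < 1 →
      ¬ IsDegenerate tri.toWeakOps N ⟨cellTime (e N v).1, cellTime_monotone _⟩ := by
    intro N v hv
    have hy := (he N v).1 hv
    rw [not_isDegenerate_tri_iff]
    refine ⟨fun j => ?_, fun i j hij => ?_⟩
    · change 0 < cellTime _ _ ∧ cellTime _ _ < 1
      rw [cellTime_eq hy ⟨j, Finset.mem_univ j⟩]
      exact cellCoord_mem hy _
    · change (cellTime _ _ : ℝ) < cellTime _ _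
      rw [cellTime_eq hy ⟨i, Finset.mem_univ i⟩, cellTime_eq hy ⟨j, Finset.mem_univ j⟩,
        coe_cellCoord (Set.Ioo_subset_Icc_self (hy.1 _)),
        coe_cellCoord (Set.Ioo_subset_Icc_self (hy.1 _))]
      exact hy.2 _ _ hij
  refine isCellFiltration_of (A := tri) tri_isRegular wellFounded_lt
    (fun i j hij n t ht => le_trans (show (interiorValues t.1).ncard ≤ i from ht) hij)
    (fun j => ?_) (fun j => triSkeleton_isSaturated j) id (fun _ => Unit) (fun j _ => j)
    (fun j _ v => ⟨cellTime (e j v).1, cellTime_monotone _⟩) ?_ ?_ ?_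
    (fun j _ v hv => hnondeg j v hv) ?_ ?_ ?_
    (fun n => ⟨n, fun t => ncard_interiorValues_le_degree t.1⟩)
  · obtain _ | j := j
    · exact Or.inl fun i => Nat.not_lt_zero i
    · exact Or.inr ⟨j, Nat.lt_succ_self j, fun i => Nat.le_of_lt_succ⟩
  · intro j _
    exact (continuous_pi fun i => (continuous_cellTime i).comp
      (continuous_subtype_val.comp (e j).continuous)).subtype_mk _
  · intro j c c' v v' hv hv' h
    have h1 : (e j v).1 = (e j v').1 := openCell_ext ((he j v).1 hv) ((he j v').1 hv')
      (congrArg Subtype.val h) (funext fun i => by simp [cellGap])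
    rw [(e j).injective (Subtype.ext h1)]
  · intro j _ v
    exact ncard_interiorValues_le_degree _
  · intro j _ v hv i hij h
    exact absurd ((mem_triSkeleton_iff (hnondeg j v hv) i).1 h) (Nat.not_le.2 hij)
  · intro j _ v hv
    have h1 := ncard_lt_of_boundary (e j v).2 fun h => by
      have := (he j v).2 h
      rw [hv] at this
      exact lt_irrefl _ this
    simp only [Finset.card_univ, Fintype.card_fin, Finset.card_empty, Nat.add_zero] at h1
    refine ⟨j - 1, by omega, ?_⟩
    change (interiorValues _).ncard ≤ j - 1
    simp only [id]
    omega
  · intro j n t ht hd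
    rcases ((mem_triSkeleton_iff hd j).1 ht).lt_or_eq with h | rfl
    · exact Or.inl ⟨n, h, ncard_interiorValues_le_degree t.1⟩
    · right
      rw [not_isDegenerate_tri_iff] at hd
      let y : (↥(Finset.univ : Finset (Fin n)) ⊕ ↥(∅ : Finset (Fin (n - 1)))) → ℝ :=
        Sum.elim (fun a => t.1 a.1) fun _ => 0
      have hy : y ∈ openCell Finset.univ ∅ := by
        refine ⟨?_, fun a b hab => hd.2 hab⟩
        rintro (a | c)
        · exact hd.1 a.1
        · exact absurd c.2 (Finset.notMem_empty _)
      refine ⟨(), (e n).symm ⟨y, subset_closure hy⟩, ?_⟩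
      simp only [Homeomorph.apply_symm_apply, id]
      congr 1
      apply Subtype.ext
      funext j
      apply Subtype.ext
      change (cellTime y j : ℝ) = t.1 j
      rw [cellTime_eq hy ⟨j, Finset.mem_univ j⟩, coe_cellCoord (Set.Ioo_subset_Icc_self (hy.1 _))]
      rfl

/-! ### The filtration of `Wb□` by its cells -/

section CellPoint

variable {N : ℕ} {A : Finset (Fin N)} {C : Finset (Fin (N - 1))}

theorem isConfig_cell (hAC : ∀ c ∈ C, ∀ a ∈ A, a.1 ≠ c.1 + 1) (y : A ⊕ C → ℝ) :
    IsConfig N (gapAt (cellGap y)) (seqAt (cellTime y)) where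
  mono := seqAt_monotone (cellTime_monotone y)
  split j := by
    by_cases hj : j < N - 1
    · by_cases hC : (⟨j, hj⟩ : Fin (N - 1)) ∈ C
      · right
        rw [seqAt, dif_pos (by omega), seqAt, dif_pos (by omega)]
        exact cellTime_succ y rfl fun h => hAC _ hC _ h rfl
      · left
        rw [gapAt, dif_pos hj, cellGap, dif_neg hC]
    · exact Or.inl (gapAt_of_le _ (by omega))
  t_top j hj := seqAt_of_le _ hj
  d_top j hj := gapAt_of_le _ hj

/-- The map of a cell to `Wb□`. -/
noncomputable def cellPoint (y : A ⊕ C → ℝ) : Wb N :=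
  (wbHomeo N).symm (Tri.ofSeq N (stretch (gapAt (cellGap y)) (seqAt (cellTime y)))
    (stretch_monotone _ (seqAt_monotone (cellTime_monotone y))))

theorem continuous_cellPoint : Continuous (cellPoint (A := A) (C := C)) := by
  refine (wbHomeo N).symm.continuous.comp (Continuous.subtype_mk (continuous_pi fun j => ?_) _)
  refine continuous_stretch (fun i => ?_) (fun i => ?_) j.1
  · unfold gapAt
    split_ifs
    · exact continuous_cellGap _
    · exact continuous_const
  · unfold seqAt
    split_ifs
    · exact continuous_cellTime _
    · exact continuous_const

theorem cellPoint_eq_mk {y : A ⊕ C → ℝ} {P : Prisms N} (hd : gaps P = cellGap y)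
    (ht : times P = cellTime y) : cellPoint y = Wb.mk P := by
  rw [cellPoint, Homeomorph.symm_apply_eq, wbHomeo_mk, stretchPrism]
  simp only [hd, ht]

theorem exists_cellPrism (hAC : ∀ c ∈ C, ∀ a ∈ A, a.1 ≠ c.1 + 1) (y : A ⊕ C → ℝ) :
    ∃ P : Prisms N, gaps P = cellGap y ∧ times P = cellTime y ∧ cellPoint y = Wb.mk P := by
  obtain ⟨P, h1, h2⟩ := (isConfig_cell hAC y).exists_prism
  exact ⟨P, gapAt_injective h1, seqAt_injective h2,
    cellPoint_eq_mk (gapAt_injective h1) (seqAt_injective h2)⟩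

theorem cellPoint_nondegenerate (hA : ∀ j : Fin N, j.1 = 0 → j ∈ A)
    (hAC : ∀ c ∈ C, ∀ a ∈ A, a.1 ≠ c.1 + 1) {y : A ⊕ C → ℝ} (hy : y ∈ openCell A C) :
    ¬ IsDegenerate wb.toWeakOps N (cellPoint y) := by
  obtain ⟨P, hd, ht, h⟩ := exists_cellPrism hAC y
  rw [h, not_isDegenerate_mk, hd, ht]
  refine ⟨fun j => ?_, fun j => ?_⟩
  · have hj := j.2
    have h0 := hA ⟨0, by omega⟩ rfl
    have hpos : 0 < cellTime y j := by
      refine (cellCoord_mem hy (.inl ⟨_, h0⟩)).1.trans_le (cellCoord_le_cellTime y ?_)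
      exact Nat.zero_le _
    obtain ⟨a, -, ha⟩ := exists_cellTime_eq hpos
    rw [ha]
    exact cellCoord_mem hy _
  · by_cases hj : j ∈ C
    · rw [cellGap, dif_pos hj]
      exact (cellCoord_mem hy _).1
    · rw [cellGap, dif_neg hj]
      exact zero_lt_one

/-- The set `A` consists of the leaves where the parameter increases. -/
theorem mem_iff_cellTime {y : A ⊕ C → ℝ} (hA : ∀ j : Fin N, j.1 = 0 → j ∈ A)
    (hy : y ∈ openCell A C) (j : Fin N) :
    j ∈ A ↔ ∀ i : Fin N, i.1 + 1 = j.1 → cellTime y i < cellTime y j := by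
  constructor
  · intro hj i hij
    rw [cellTime_eq hy ⟨j, hj⟩]
    rcases (unitInterval.nonneg (cellTime y i)).lt_or_eq with h | h
    · obtain ⟨a, ha, h1⟩ := exists_cellTime_eq (y := y) (j := i) h
      rw [h1]
      change (cellCoord y _ : ℝ) < cellCoord y _
      rw [coe_cellCoord (Set.Ioo_subset_Icc_self (hy.1 _)),
        coe_cellCoord (Set.Ioo_subset_Icc_self (hy.1 _))]
      refine hy.2 _ _ ?_
      have ha : a.1.1 ≤ i.1 := ha
      exact show a.1.1 < j.1 by omega
    · rw [show cellTime y i = 0 from Subtype.ext h.symm]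
      exact (cellCoord_mem hy _).1
  · intro h
    by_contra hj
    rcases Nat.eq_zero_or_pos j.1 with h0 | h0
    · exact hj (hA j h0)
    · have hij : (⟨j.1 - 1, by omega⟩ : Fin N).1 + 1 = j.1 := by simp only; omega
      exact (h _ hij).ne (cellTime_succ y hij.symm hj)

theorem mem_iff_cellGap {y : A ⊕ C → ℝ} (hy : y ∈ openCell A C) (j : Fin (N - 1)) :
    j ∈ C ↔ cellGap y j < 1 := by
  refine ⟨fun hj => ?_, mem_of_cellGap_lt⟩
  rw [cellGap, dif_pos hj]
  exact (cellCoord_mem hy _).2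

end CellPoint

/-- The cells of dimension `d` in `Wb□(N)`: the leaves where the parameter increases, among them the
first one, and the distances in the interior of `[0, 1]`, which are between leaves with
the same parameter. -/
abbrev WbCell (N d : ℕ) : Type :=
  {p : Finset (Fin N) × Finset (Fin (N - 1)) // (∀ j : Fin N, j.1 = 0 → j ∈ p.1) ∧
    (∀ c ∈ p.2, ∀ a ∈ p.1, a.1 ≠ c.1 + 1) ∧ p.1.card + p.2.card = d}

/-- A leaf where the parameter increases does not follow a distance in `(0, 1)`. -/
theorem card_add_card_le {N : ℕ} {A : Finset (Fin N)} {C : Finset (Fin (N - 1))}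
    (hAC : ∀ c ∈ C, ∀ a ∈ A, a.1 ≠ c.1 + 1) : A.card + C.card ≤ N := by
  let f : Fin (N - 1) ↪ Fin N := ⟨fun c => ⟨c.1 + 1, by omega⟩, fun c c' h => by
    simpa [Fin.ext_iff] using h⟩
  have hdisj : Disjoint A (C.map f) := by
    rw [Finset.disjoint_left]
    intro a ha hac
    obtain ⟨c, hc, rfl⟩ := Finset.mem_map.1 hac
    exact hAC c hc _ ha rfl
  have h := Finset.card_le_univ (A.disjUnion _ hdisj)
  rwa [Finset.card_disjUnion, Finset.card_map, Fintype.card_fin] at h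

/-- Every nondegenerate point lies in an open cell. -/
theorem exists_cell_of_nondegenerate {N : ℕ} (P : Prisms N)
    (hP : ¬ IsDegenerate wb.toWeakOps N (Wb.mk P)) :
    ∃ (A : Finset (Fin N)) (C : Finset (Fin (N - 1))), (∀ j : Fin N, j.1 = 0 → j ∈ A) ∧
      (∀ c ∈ C, ∀ a ∈ A, a.1 ≠ c.1 + 1) ∧ ∃ y ∈ openCell A C,
        gaps P = cellGap y ∧ times P = cellTime y := by
  classical
  rw [not_isDegenerate_mk] at hP
  have hc := isConfig_prism P
  have hmono : Monotone (times P) := fun i j hij => P.2.2.2 (bead_monotone P.1 hij)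
  let A : Finset (Fin N) := Finset.univ.filter fun j => ∀ i : Fin N, i.1 + 1 = j.1 →
    times P i < times P j
  let C : Finset (Fin (N - 1)) := Finset.univ.filter fun j => gaps P j < 1
  have hA : ∀ j, j ∈ A ↔ ∀ i : Fin N, i.1 + 1 = j.1 → times P i < times P j := by simp [A]
  have hC : ∀ j, j ∈ C ↔ gaps P j < 1 := by simp [C]
  let y : A ⊕ C → ℝ := Sum.elim (fun a => times P a.1) fun c => gaps P c.1
  have hy : y ∈ openCell A C := by
    refine ⟨?_, fun a b hab => ?_⟩
    · rintro (a | c)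
      · exact hP.1 a.1
      · exact ⟨hP.2 c.1, (hC _).1 c.2⟩
    · have hab' : a.1.1 < b.1.1 := hab
      have h1 := (hA _).1 b.2 ⟨b.1.1 - 1, by omega⟩ (by simp only; omega)
      exact (hmono (Fin.le_def.2 (by simp only; omega))).trans_lt h1
  have hcoord : ∀ a : A, cellCoord y (.inl a) = times P a.1 := fun a =>
    Subtype.ext (coe_cellCoord (Set.Ioo_subset_Icc_self (hy.1 _)))
  refine ⟨A, C, fun j hj => (hA j).2 fun i hi => by omega, fun c hc' a ha hac => ?_, y, hy,
    funext fun j => ?_, funext fun j => ?_⟩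
  · have h1 := (hC c).1 hc'
    have h2 := (hA a).1 ha ⟨c.1, by omega⟩ hac.symm
    have h3 := hc.split c.1
    rw [gapAt, dif_pos c.2, seqAt, dif_pos (by omega), seqAt, dif_pos (by omega)] at h3
    refine h3.elim h1.ne fun h4 => h2.ne (h4.trans ?_)
    congr 1
    exact Fin.ext hac.symm
  · by_cases hj : j ∈ C
    · rw [cellGap, dif_pos hj]
      exact (Subtype.ext (coe_cellCoord (Set.Ioo_subset_Icc_self (hy.1 (.inr ⟨j, hj⟩))))).symm
    · rw [cellGap, dif_neg hj]
      exact le_antisymm (unitInterval.le_one _) (not_lt.1 fun h => hj ((hC j).2 h))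
  · refine le_antisymm ?_ (Finset.sup_le fun a ha => ?_)
    · -- the parameter of the leaf `j` is that of the last leaf of `A` before it
      have key : ∀ m (hm : m < N), times P ⟨m, hm⟩ ≤ cellTime y ⟨m, hm⟩ := by
        intro m
        induction m with
        | zero =>
          intro hm
          have h0 : (⟨0, hm⟩ : Fin N) ∈ A := (hA _).2 fun i hi => by simp at hi
          rw [← hcoord ⟨_, h0⟩]
          exact cellCoord_le_cellTime y le_rfl
        | succ m ih =>
          intro hm
          by_cases hmA : (⟨m + 1, hm⟩ : Fin N) ∈ A
          · rw [← hcoord ⟨_, hmA⟩]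
            exact cellCoord_le_cellTime y le_rfl
          · rw [← cellTime_succ y (i := ⟨m, by omega⟩) rfl hmA]
            refine le_trans (not_lt.1 fun h => hmA ((hA _).2 fun i hi => ?_)) (ih (by omega))
            rw [show i = ⟨m, by omega⟩ from Fin.ext (by simpa using hi)]
            exact h
      exact key j.1 j.2
    · simp only [Finset.mem_filter, Finset.mem_univ, true_and] at ha
      rw [hcoord]
      exact hmono ha

theorem faceDim_le {N : ℕ} {A : Finset (Fin N)} {C : Finset (Fin (N - 1))} {y : A ⊕ C → ℝ}
    {P : Prisms N} (hd : gaps P = cellGap y) (ht : times P = cellTime y) :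
    faceDim P ≤ A.card + C.card := by
  rw [faceDim, hd, ht]
  have h1 := ncard_interiorValues_le y
  have h2 := ncard_gaps_le y
  omega

theorem faceDim_eq {N : ℕ} {A : Finset (Fin N)} {C : Finset (Fin (N - 1))} {y : A ⊕ C → ℝ}
    {P : Prisms N} (hd : gaps P = cellGap y) (ht : times P = cellTime y) (hy : y ∈ openCell A C) :
    faceDim P = A.card + C.card := by
  refine le_antisymm (faceDim_le hd ht) ?_
  rw [faceDim, hd, ht]
  have h1 := le_ncard_interiorValues hy
  have h2 := le_ncard_gaps hy
  omega

theorem faceDim_le_degree {N : ℕ} (P : Prisms N) (hP : ¬ IsDegenerate wb.toWeakOps N (Wb.mk P)) :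
    faceDim P ≤ N := by
  obtain ⟨A, C, -, hAC, y, -, hd, ht⟩ := exists_cell_of_nondegenerate P hP
  exact (faceDim_le hd ht).trans (card_add_card_le hAC)

/-- A nondegenerate point lies in the faces of dimension at most `d` exactly when
its own open face has dimension at most `d`. -/
theorem mk_mem_wbFaces_iff {N d : ℕ} {P : Prisms N}
    (hP : ¬ IsDegenerate wb.toWeakOps N (Wb.mk P)) : Wb.mk P ∈ wbFaces N d ↔ faceDim P ≤ d := by
  refine ⟨?_, fun h => ⟨P, rfl, h⟩⟩
  rintro ⟨Q, hQ, h⟩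
  obtain ⟨h1, h2⟩ := coords_eq_of_mk_eq hQ.symm hP
  rwa [faceDim, h1, h2]

/-- The generators of a term of `wbFiltration`. -/
def wbGenerators (i : CellIndex) (n : ℕ) : Set (Wb n) :=
  {w | n < (ofLex i.1).1 ∨ (n = (ofLex i.1).1 ∧ w ∈ wbFaces n (ofLex i.1).2)}

theorem wbFiltration_isSaturated (i : CellIndex) : (wbFiltration wb.toWeakOps i).IsSaturated :=
  generate_isSaturated (G := wbGenerators i) (N := (ofLex i.1).1) wb_isRegular
    (fun _ hn _ => Or.inl hn) fun _ _ h => h.elim le_of_lt fun h => h.1.le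

theorem mem_wbFiltration_iff {n : ℕ} {w : Wb n} (hw : ¬ IsDegenerate wb.toWeakOps n w)
    (i : CellIndex) : w ∈ (wbFiltration wb.toWeakOps i).carrier n ↔ w ∈ wbGenerators i n := by
  refine ⟨fun h => ?_, fun h => mem_generate_of_mem (G := wbGenerators i) h⟩
  exact ((mem_generate_iff (G := wbGenerators i) (N := (ofLex i.1).1) wb_isRegular
    (fun _ hn _ => Or.inl hn) fun _ _ h => h.elim le_of_lt fun h => h.1.le).1 h).mem hw

theorem cellIndex_lt_iff {i j : CellIndex} : i < j ↔ (ofLex i.1).1 < (ofLex j.1).1 ∨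
    ((ofLex i.1).1 = (ofLex j.1).1 ∧ (ofLex i.1).2 < (ofLex j.1).2) :=
  Prod.Lex.lt_iff

theorem wbFiltration_mono {i j : CellIndex} (hij : i ≤ j) (n : ℕ) :
    (wbFiltration wb.toWeakOps i).carrier n ⊆ (wbFiltration wb.toWeakOps j).carrier n := by
  rcases hij.lt_or_eq with hij | rfl
  · rw [cellIndex_lt_iff] at hij
    intro w hw S hS
    refine hw S fun m x hx => hS m ?_
    rcases hx with hx | ⟨rfl, P, hP, hx⟩
    · exact Or.inl (by omega)
    · rcases hij with hij | ⟨hij, hd⟩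
      · exact Or.inl hij
      · exact Or.inr ⟨hij, P, hP, hx.trans hd.le⟩
  · exact subset_rfl

/-- The first index has no predecessor; the predecessor of `(N, d + 1)` is `(N, d)`, and that of
`(N + 1, 0)` is `(N, N)`. -/
theorem cellIndex_pred (j : CellIndex) :
    (∀ i, ¬ i < j) ∨ ∃ i₀, i₀ < j ∧ ∀ i, i < j → i ≤ i₀ := by
  have hle : ∀ i j : CellIndex, i ≤ j ↔ (ofLex i.1).1 < (ofLex j.1).1 ∨
    ((ofLex i.1).1 = (ofLex j.1).1 ∧ (ofLex i.1).2 ≤ (ofLex j.1).2) := fun i j => Prod.Lex.le_iff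
  obtain ⟨p, hp⟩ := j
  obtain ⟨⟨N, d⟩, rfl⟩ := toLex.surjective p
  simp only [ofLex_toLex] at hp
  obtain _ | d := d
  · obtain _ | N := N
    · left
      intro i hi
      rw [cellIndex_lt_iff] at hi
      simp at hi
    · refine Or.inr ⟨⟨toLex (N, N), le_rfl⟩, ?_, fun i hi => ?_⟩
      · rw [cellIndex_lt_iff]
        simp
      · rw [cellIndex_lt_iff] at hi
        rw [hle]
        have := i.2
        simp only [ofLex_toLex] at hi ⊢
        omega
  · refine Or.inr ⟨⟨toLex (N, d), by simp only [ofLex_toLex]; omega⟩, ?_, fun i hi => ?_⟩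
    · rw [cellIndex_lt_iff]
      simp
    · rw [cellIndex_lt_iff] at hi
      rw [hle]
      simp only [ofLex_toLex] at hi ⊢
      omega

theorem wbFiltration_isCellFiltration :
    IsCellFiltration wb.toWeakOps (wbFiltration wb.toWeakOps) := by
  have hcell := fun (N d : ℕ) (c : WbCell N d) =>
    exists_cell_homeomorph (A := c.1.1) (C := c.1.2) c.2.2.2
  choose e he using hcell
  have hnondeg : ∀ N d (c : WbCell N d) (v : Disc d), ‖v.1‖ < 1 →
      ¬ IsDegenerate wb.toWeakOps N (cellPoint (e N d c v).1) := fun N d c v hv =>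
    cellPoint_nondegenerate c.2.1 c.2.2.1 ((he N d c v).1 hv)
  have : ∀ n, T2Space (Wb n) := fun n => (wbHomeo n).symm.t2Space
  refine isCellFiltration_of (A := wb) wb_isRegular wellFounded_lt
    (fun i j hij n => wbFiltration_mono hij n) cellIndex_pred
    (fun j => wbFiltration_isSaturated j) (fun j => (ofLex j.1).1)
    (fun j => WbCell (ofLex j.1).1 (ofLex j.1).2) (fun j _ => (ofLex j.1).2)
    (fun j c v => cellPoint (e _ _ c v).1) ?_ ?_ ?_
    (fun j c v hv => hnondeg _ _ c v hv) ?_ ?_ ?_ ?_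
  · intro j c
    exact continuous_cellPoint.comp (continuous_subtype_val.comp (e _ _ c).continuous)
  · intro j c c' v v' hv hv' h
    obtain ⟨P, hd, ht, hP⟩ := exists_cellPrism c.2.2.1 (e _ _ c v).1
    obtain ⟨P', hd', ht', hP'⟩ := exists_cellPrism c'.2.2.1 (e _ _ c' v').1
    have hn := hnondeg _ _ c v hv
    rw [hP, hP'] at h
    rw [hP] at hn
    obtain ⟨h1, h2⟩ := coords_eq_of_mk_eq h hn
    rw [hd, hd'] at h1
    rw [ht, ht'] at h2
    have hy := (he _ _ c v).1 hv
    have hy' := (he _ _ c' v').1 hv'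
    obtain rfl : c = c' := by
      refine Subtype.ext (Prod.ext (Finset.ext fun i => ?_) (Finset.ext fun i => ?_))
      · rw [mem_iff_cellTime c.2.1 hy, mem_iff_cellTime c'.2.1 hy', h2]
      · rw [mem_iff_cellGap hy, mem_iff_cellGap hy', h1]
    rw [(e _ _ c).injective (Subtype.ext (openCell_ext hy hy' h2 h1))]
  · intro j c v
    obtain ⟨P, hd, ht, hP⟩ := exists_cellPrism c.2.2.1 (e _ _ c v).1
    refine mem_generate_of_mem (G := wbGenerators j) (Or.inr ⟨rfl, P, hP.symm, ?_⟩)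
    exact (faceDim_le hd ht).trans c.2.2.2.le
  · intro j c v hv i hij h
    have hn := hnondeg _ _ c v hv
    obtain ⟨P, hd, ht, hP⟩ := exists_cellPrism c.2.2.1 (e _ _ c v).1
    rw [mem_wbFiltration_iff hn] at h
    rw [hP] at h hn
    have h1 := faceDim_eq hd ht ((he _ _ c v).1 hv)
    rw [c.2.2.2] at h1
    rw [cellIndex_lt_iff] at hij
    rcases h with h | ⟨h, h2⟩
    · omega
    · rw [mk_mem_wbFaces_iff hn] at h2
      omega
  · intro j c v hv
    obtain ⟨P, hd, ht, hP⟩ := exists_cellPrism c.2.2.1 (e _ _ c v).1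
    have h1 := ncard_lt_of_boundary (e _ _ c v).2 fun h => by
      have := (he _ _ c v).2 h
      rw [hv] at this
      exact lt_irrefl _ this
    rw [← hd, ← ht, c.2.2.2] at h1
    have h2 := j.2
    refine ⟨⟨toLex ((ofLex j.1).1, (ofLex j.1).2 - 1), ?_⟩, ?_, ?_⟩
    · simp only [ofLex_toLex]
      omega
    · rw [cellIndex_lt_iff]
      exact Or.inr ⟨rfl, Nat.sub_lt ((Nat.zero_le _).trans_lt h1) one_pos⟩
    · refine mem_generate_of_mem (G := wbGenerators _) (Or.inr ⟨rfl, P, hP.symm, ?_⟩)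
      exact Nat.le_sub_one_of_lt h1
  · intro j n w hw hd
    rw [mem_wbFiltration_iff hd] at hw
    obtain ⟨P, rfl⟩ := Wb.mk_surjective w
    have hdim := faceDim_le_degree P hd
    rcases hw with hw | ⟨hw, hw'⟩
    · refine Or.inl ⟨⟨toLex (n, n), le_rfl⟩, ?_, ?_⟩
      · rw [cellIndex_lt_iff]
        exact Or.inl hw
      · exact mem_generate_of_mem (G := wbGenerators _) (Or.inr ⟨rfl, P, rfl, hdim⟩)
    · rw [mk_mem_wbFaces_iff hd] at hw'
      rcases hw'.lt_or_eq with hlt | heq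
      · refine Or.inl ⟨⟨toLex (n, faceDim P), hdim⟩, ?_, ?_⟩
        · rw [cellIndex_lt_iff]
          exact Or.inr ⟨hw, hlt⟩
        · exact mem_generate_of_mem (G := wbGenerators _) (Or.inr ⟨rfl, P, rfl, le_rfl⟩)
      · right
        subst hw
        obtain ⟨A, C, hA, hAC, y, hy, hgaps, htimes⟩ := exists_cell_of_nondegenerate P hd
        have hcard := (faceDim_eq hgaps htimes hy).symm.trans heq
        refine ⟨⟨(A, C), hA, hAC, hcard⟩, (e _ _ ⟨(A, C), hA, hAC, hcard⟩).symm
          ⟨y, subset_closure hy⟩, ?_⟩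
        simp only [Homeomorph.apply_symm_apply]
        rw [cellPoint_eq_mk hgaps htimes]
  · intro n
    refine ⟨⟨toLex (n + 1, 0), Nat.zero_le _⟩, fun w => ?_⟩
    exact mem_generate_of_mem (G := wbGenerators _) (Or.inl (Nat.lt_succ_self n))

/-! ### The refinement -/

/-- The skeleton `△_N` and the term `(N, N)` have the same nondegenerate elements, those of degree
at most `N`. -/
theorem image_triSkeleton (N n : ℕ) : (wbHomeo n).symm '' (triSkeleton N).carrier n =
    (wbFiltration wb.toWeakOps ⟨toLex (N, N), le_rfl⟩).carrier n := by
  let S : SubWeak wb.toWeakOps := SubWeak.ofCoface wb_isRegular.generated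
    (fun n => {w | wbHomeo n w ∈ (triSkeleton N).carrier n}) fun n i hi w hw => by
      change wbHomeo (n + 1) _ ∈ (triSkeleton N).carrier (n + 1)
      rw [wbHomeo_isWeakHom.map_coface]
      exact (triSkeleton N).coface_mem i hi hw
  have hS : S.IsSaturated := fun n i hi w hw => by
    change wbHomeo (n + 1) _ ∈ (triSkeleton N).carrier (n + 1) at hw
    rw [wbHomeo_isWeakHom.map_coface] at hw
    exact triSkeleton_isSaturated N n i hi _ hw
  have hS' : ∀ n w, ¬ IsDegenerate wb.toWeakOps n w → (w ∈ S.carrier n ↔ n ≤ N) := by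
    intro n w hw
    rw [isDegenerate_wb_iff] at hw
    exact mem_triSkeleton_iff hw N
  have hT : ∀ n w, ¬ IsDegenerate wb.toWeakOps n w →
      (w ∈ (wbFiltration wb.toWeakOps ⟨toLex (N, N), le_rfl⟩).carrier n ↔ n ≤ N) := by
    intro n w hw
    rw [mem_wbFiltration_iff hw]
    refine ⟨fun h => h.elim le_of_lt fun h => h.1.le, fun h => ?_⟩
    rcases h.lt_or_eq with h | rfl
    · exact Or.inl h
    · obtain ⟨P, rfl⟩ := Wb.mk_surjective w
      exact Or.inr ⟨rfl, P, rfl, faceDim_le_degree P hw⟩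
  have h1 : S.carrier n = (wbFiltration wb.toWeakOps ⟨toLex (N, N), le_rfl⟩).carrier n :=
    Set.Subset.antisymm
      (hS.subset (fun n w hw hd => (hT n w hd).2 ((hS' n w hd).1 hw)) n)
      ((wbFiltration_isSaturated _).subset (fun n w hw hd => (hS' n w hd).2 ((hT n w hd).1 hw)) n)
  rw [← h1]
  exact (wbHomeo n).symm.image_eq_preimage_symm _

theorem wb_isRefinement : IsRefinement (wbFiltration wb.toWeakOps) triSkeleton := by
  refine ⟨wbFiltration_isCellFiltration, triSkeleton_isCellFiltration,
    fun N => ⟨toLex (N, N), le_rfl⟩, fun N N' h => ?_, fun n => (wbHomeo n).symm,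
    wbHomeo_symm_isWeakHom, fun N n => image_triSkeleton N n⟩
  rw [cellIndex_lt_iff]
  exact Or.inl h

end WbSquare

theorem propositionp :
    ∃ W : WbSquare.WeakBimodule WbSquare.Wb,
      -- (i): `Wb□` is a weak bimodule under grafting, and all evaluation maps are morphisms
      WbSquare.IsGrafting W.toWeakOps ∧
      (∀ (O : ℕ → Type u) [∀ n, TopologicalSpace (O n)] (M : WbSquare.Bimodule O)
        (η : ∀ n : ℕ, Unit → O n) (g : ∀ n, WbSquare.Square n → unitInterval → O n),
        WbSquare.IsBimodHom WbSquare.assoc.toBimodOps M.toBimodOps η →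
        WbSquare.IsBimodLoop M η g →
        ∃ ξ : ∀ n, WbSquare.Wb n → O n, WbSquare.IsEvaluation M η g ξ ∧
          WbSquare.IsWeakHom W.toWeakOps (M.weakOps η) ξ) ∧
      -- (ii): `Wb□` is cofibrant and contractible in each degree
      WbSquare.IsCofibrant W ∧
      (∀ n, ContractibleSpace (WbSquare.Wb n)) ∧
      -- (iii): `Wb□` is homeomorphic to `△`, each `Wb□(n)` is an `n`-disc, and `Wb□` with its
      -- cell filtration is a refinement of `△` with its filtration by skeleta
      (∃ f : ∀ n, WbSquare.Wb n ≃ₜ WbSquare.Tri n,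
        WbSquare.IsWeakHom W.toWeakOps WbSquare.tri.toWeakOps (fun n => f n)) ∧
      (∀ n, Nonempty (WbSquare.Wb n ≃ₜ WbSquare.Disc n)) ∧
      WbSquare.IsRefinement (WbSquare.wbFiltration W.toWeakOps) WbSquare.triSkeleton := by
  refine ⟨WbSquare.wb, WbSquare.isGrafting_wb, fun O _ M η g hη hg => ⟨WbSquare.evalMap hg,
    WbSquare.isEvaluation_evalMap hg, WbSquare.evalMap_isWeakHom hη hg⟩, ⟨WbSquare.CellIndex,
    inferInstance, WbSquare.wbFiltration WbSquare.wb.toWeakOps,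
    WbSquare.wbFiltration_isCellFiltration⟩, fun n => ?_,
    ⟨WbSquare.wbHomeo, WbSquare.wbHomeo_isWeakHom⟩, fun n => ?_, WbSquare.wb_isRefinement⟩
  · have := WbSquare.contractibleSpace_tri n
    exact (WbSquare.wbHomeo n).contractibleSpace
  · obtain ⟨e⟩ := WbSquare.tri_homeomorph_disc n
    exact ⟨(WbSquare.wbHomeo n).trans e⟩
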